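/- **Theorem.** Let $\mathcal S\ge 1$ be an integer and $\Sigma_N=\{0,\pm1,\dots,\pm\mathcal S\}^N$. For $\beta\ge 0$, $D\in\mathbb R$, $h\ge 0$ let $$H_N(\sigma)=\frac{\beta}{\sqrt N}\sum_{i<j}g_{i,j}\sigma_i\sigma_j+D\sum_{i}\sigma_i^2+h\sum_i\sigma_i,\qquad g_{i,j}\ (i<j)\ \text{i.i.d. } \mathcal N(0,1),$$ let $G(\sigma)=e^{H_N(\sigma)}/\sum_{\tau\in\Sigma_N} e^{H_N(\tau)}$ be the Gibbs measure, $\langle f\rangle$ the average of a function $f$ of $n$ replicas $\sigma^1,\dots,\sigma^n$ under $G^{\otimes n}$, $\nu(f)=\mathbb E\langle f\rangle$, and $R_{k,l}=\frac1N\sum_{i}\sigma^k_i\sigma^l_i$ $(1\le k\le l\le n)$. For $p,q\in\mathbb R$ and $z\in\mathbb R$ let $\langle\cdot\rangle_0$ be the average over independent replicas $\epsilon_1,\epsilon_2,\dots\in\{0,\pm1,\dots,\pm\mathcal S\}$, each with probability proportional to $\exp\big(\beta z\sqrt q\,\epsilon+\frac{\beta^2}{2}(p-q)\epsilon^2+D\epsilon^2+h\epsilon\big)$,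 and let $\nu_0(f)=\mathbb E\langle f\rangle_0$ with $z\sim\mathcal N(0,1)$. Consider the equations $$p=\nu_0(\epsilon_1^2),\qquad q=\nu_0(\epsilon_1\epsilon_2).\tag{1}$$ For a solution $(p,q)$ define $$\begin{aligned} A&=\nu_0((\epsilon_1-\epsilon_3)(\epsilon_2-\epsilon_4)\epsilon_1\epsilon_2), & \mathsf D&=\nu_0((\epsilon_1^2-\epsilon_2^2)\epsilon_1^2), & E&=\nu_0((\epsilon_1^2-\epsilon_2^2)\epsilon_1\epsilon_3),\\ F&=\nu_0((\epsilon_1\epsilon_3-\epsilon_2\epsilon_3)\epsilon_1\epsilon_3), & G&=\nu_0((\epsilon_1\epsilon_3-\epsilon_2\epsilon_3)\epsilon_1\epsilon_4), & I_3&=\nu_0((\epsilon_1\epsilon_2-q)\epsilon_3\epsilon_4),\\ I_5&=\nu_0((\epsilon_1\epsilon_2-q)\epsilon_3^2), & K_3&=\nu_0((\epsilon_1^2-p)\epsilon_2\epsilon_3), & K_4&=\nu_0((\epsilon_1^2-p)\epsilon_2^2), \end{aligned}$$ $$M_1=1-\beta^2(F-3G),\quad M_2=1-\tfrac{\beta^2}{2}\mathsf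 D,\quad M_3=1-\beta^2(F-G),\quad M=M_1M_2+\beta^4E^2,$$ $$A_2^2=\frac{A}{1-\beta^2A},\quad A_1^2=\frac{GM_2+\frac{\beta^2}{2}E^2}{M\,M_3},\quad B_1^2=\frac{\mathsf DM_1-2\beta^2E^2}{M},\quad C_1^2=\frac{E}{M},$$ $$\begin{aligned} A_0^2&=\tfrac{\beta^2}{M}(\beta^2EK_4+M_2I_5)C_1^2+\tfrac{2\beta^2}{M}\big(\beta^2E(E-K_3)+M_2(2G-I_3)\big)A_1^2+\tfrac{1}{M}(\beta^2EK_3+M_2I_3)(\beta^2A_2^2+1),\\ B_0^2&=\tfrac{1}{M}(M_1K_4-\beta^2EI_5)\big(\tfrac{\beta^2}{2}B_1^2+1\big)+\tfrac{\beta^2}{M}\big(M_1(E-K_3)-\beta^2E(2G-I_3)\big)C_1^2,\\ C_0^2&=\tfrac{1}{M}(M_2I_5+\beta^2EK_4)\big(\tfrac{\beta^2}{2}B_1^2+1\big)+\tfrac{\beta^2}{M}\big(M_2(2G-I_3)+\beta^2E(E-K_3)\big)C_1^2 \end{aligned}$$ (the superscript $2$ is only notation: for instance $C_1^2$, $C_0^2$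 denote covariances). There is $\beta'>0$, depending only on $\mathcal S$, such that for all $0\le\beta<\beta'$, $D\in\mathbb R$ and $h\ge0$ the equations (1) have exactly one solution $(p,q)\in\mathbb R^2$ (any solution has $q\ge 0$), $M_3>0$, $M>0$, and the following holds for every $n$. Put $Q_{k,l}=q$ for $k\ne l$ and $Q_{k,k}=p$. There is a centered Gaussian family $(\eta_{k,l})_{1\le k\le l\le n}$ with covariances, where $(k,l)$ is identified with the set $\{k,l\}$, $$\mathrm{Cov}(\eta_{k,l},\eta_{k',l'})=\begin{cases} A_2^2\,\mathbf 1[|(k,l)\cap(k',l')|=2]+|(k,l)\cap(k',l')|\,A_1^2+A_0^2,& |(k,l)|=|(k',l')|=2,\\ B_1^2\,\mathbf 1[|(k,l)\cap(k',l')|=1]+B_0^2,& |(k,l)|=|(k',l')|=1,\\ C_1^2\,\mathbf 1[|(k,l)\cap(k',l')|=1]+C_0^2,& |(k,l)|\ne|(k',l')|, \end{cases}$$ and for all nonnegative integers $m(k,l)$, $1\le k\le l\le n$, with $m=\sum_{k\le l}m(k,l)$, there is a constant $K$ independent of $N$ such that for all $N\ge1$ $$\Big|N^{m/2}\,\nu\Big(\prod_{k\le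 l}(R_{k,l}-Q_{k,l})^{m(k,l)}\Big)-\mathbb E\prod_{k\le l}\eta_{k,l}^{m(k,l)}\Big|\le \frac{K}{\sqrt N}.$$ -/

import Mathlib

open MeasureTheory ProbabilityTheory

noncomputable section

namespace GhatakSherrington

/-- The spin values `0, ±1, …, ±S`. -/
abbrev Spin (S : ℕ) : Type := {a : ℤ // a ∈ Finset.Icc (-(S : ℤ)) (S : ℤ)}

/-- A spin as a real number. -/
def Spin.toReal {S : ℕ} (a : Spin S) : ℝ := ((a : ℤ) : ℝ)

/-- Spin configurations of a system of size `N`. -/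
abbrev Config (N S : ℕ) : Type := Fin N → Spin S

/-- The pairs `i < j` of sites. -/
abbrev Bond (N : ℕ) : Type := {e : Fin N × Fin N // e.1 < e.2}

/-- The law of the interaction parameters: `g i j`, `i < j`, i.i.d. standard Gaussian. -/
def disorder (N : ℕ) : Measure (Bond N → ℝ) :=
  Measure.pi fun _ => gaussianReal 0 1

/-- The Ghatak-Sherrington Hamiltonian, with inverse temperature `β`, crystal field `D` and
external field `h`. -/
def hamiltonian {N S : ℕ} (β D h : ℝ) (g : Bond N → ℝ) (σ : Config N S) : ℝ :=
  β / √(N : ℝ) * ∑ e : Bond N, g e * (σ e.1.1).toReal * (σ e.1.2).toReal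
    + D * ∑ i, (σ i).toReal ^ 2 + h * ∑ i, (σ i).toReal

/-- The partition function. -/
def partitionFn (N S : ℕ) (β D h : ℝ) (g : Bond N → ℝ) : ℝ :=
  ∑ σ : Config N S, Real.exp (hamiltonian β D h g σ)

/-- The mass that the Gibbs measure gives to a configuration. -/
def gibbs {N S : ℕ} (β D h : ℝ) (g : Bond N → ℝ) (σ : Config N S) : ℝ :=
  Real.exp (hamiltonian β D h g σ) / partitionFn N S β D h g

/-- `⟨f⟩`: the average of a function of `n` replicas under the `n`-fold product Gibbs measure. -/
def gibbsAvg {N S n : ℕ} (β D h : ℝ) (g : Bond N → ℝ) (f : (Fin n → Config N S) → ℝ) : ℝ :=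
  ∑ σ : Fin n → Config N S, f σ * ∏ k, gibbs β D h g (σ k)

/-- `ν(f) = 𝔼⟨f⟩`. -/
def nu {N S n : ℕ} (β D h : ℝ) (f : (Fin n → Config N S) → ℝ) : ℝ :=
  ∫ g, gibbsAvg β D h g f ∂(disorder N)

/-- The overlap of two configurations; the self-overlap when they are the same. -/
def overlap {N S : ℕ} (σ τ : Config N S) : ℝ :=
  (∑ i, (σ i).toReal * (τ i).toReal) / N

/-- The parameters of the model, and two numbers `p`, `q`, on which the law of the decoupled
(cavity) spin depends. -/
structure Params where
  S : ℕ
  β : ℝ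
  D : ℝ
  h : ℝ
  p : ℝ
  q : ℝ

namespace Params

/-- The Boltzmann weight of the decoupled last spin, for the value `z` of the standard Gaussian
variable that replaces its interaction with the other spins. -/
def weight (P : Params) (z : ℝ) (a : Spin P.S) : ℝ :=
  Real.exp (a.toReal * (P.β * z * √P.q) + P.β ^ 2 / 2 * (P.p - P.q) * a.toReal ^ 2
    + P.D * a.toReal ^ 2 + P.h * a.toReal)

/-- The mass of the Gibbs measure of the decoupled spin. -/
def gibbs0 (P : Params) (z : ℝ) (a : Spin P.S) : ℝ :=
  P.weight z a / ∑ c : Spin P.S, P.weight z c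

/-- `ν₀(f)`, for a function `f` of the decoupled spins `ε 0, …, ε (r - 1)` of `r` replicas. -/
def nu0 (P : Params) (r : ℕ) (f : (Fin r → ℝ) → ℝ) : ℝ :=
  ∫ z, (∑ ε : Fin r → Spin P.S, f (fun k => (ε k).toReal) * ∏ k, P.gibbs0 z (ε k))
    ∂(gaussianReal 0 1)

/-- The replica-symmetric equations for `p` (self-overlap) and `q` (overlap). -/
def IsFixedPoint (P : Params) : Prop :=
  P.p = P.nu0 1 (fun ε => ε 0 ^ 2) ∧ P.q = P.nu0 2 (fun ε => ε 0 * ε 1)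

/-! Expectations of the decoupled spins of several replicas. -/

def cA (P : Params) : ℝ := P.nu0 4 fun ε => (ε 0 - ε 2) * (ε 1 - ε 3) * (ε 0 * ε 1)
def cD (P : Params) : ℝ := P.nu0 2 fun ε => (ε 0 ^ 2 - ε 1 ^ 2) * ε 0 ^ 2
def cE (P : Params) : ℝ := P.nu0 3 fun ε => (ε 0 ^ 2 - ε 1 ^ 2) * (ε 0 * ε 2)
def cF (P : Params) : ℝ := P.nu0 3 fun ε => (ε 0 * ε 2 - ε 1 * ε 2) * (ε 0 * ε 2)
def cG (P : Params) : ℝ := P.nu0 4 fun ε => (ε 0 * ε 2 - ε 1 * ε 2) * (ε 0 * ε 3)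
def cI3 (P : Params) : ℝ := P.nu0 4 fun ε => (ε 0 * ε 1 - P.q) * (ε 2 * ε 3)
def cI5 (P : Params) : ℝ := P.nu0 3 fun ε => (ε 0 * ε 1 - P.q) * ε 2 ^ 2
def cK3 (P : Params) : ℝ := P.nu0 3 fun ε => (ε 0 ^ 2 - P.p) * (ε 1 * ε 2)
def cK4 (P : Params) : ℝ := P.nu0 2 fun ε => (ε 0 ^ 2 - P.p) * ε 1 ^ 2

/-! Normalizing constants. -/

def M1 (P : Params) : ℝ := 1 - P.β ^ 2 * (P.cF - 3 * P.cG)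
def M2 (P : Params) : ℝ := 1 - P.β ^ 2 / 2 * P.cD
def M3 (P : Params) : ℝ := 1 - P.β ^ 2 * (P.cF - P.cG)
def M (P : Params) : ℝ := P.M1 * P.M2 + P.β ^ 4 * P.cE ^ 2

/-! The variances and covariances, multiplied by the system size: `A2sq` is `N * A₂²`, and so on.
None of them depends on the system size. -/

def A2sq (P : Params) : ℝ := P.cA / (1 - P.β ^ 2 * P.cA)

def A1sq (P : Params) : ℝ :=
  (P.cG * P.M2 + P.β ^ 2 / 2 * P.cE ^ 2) / P.M * (1 / P.M3)

def B1sq (P : Params) : ℝ := (P.cD * P.M1 - 2 * P.β ^ 2 * P.cE ^ 2) / P.M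

def C1sq (P : Params) : ℝ := P.cE / P.M

def A0sq (P : Params) : ℝ :=
  P.β ^ 2 / P.M * (P.β ^ 2 * P.cE * P.cK4 + P.M2 * P.cI5) * P.C1sq
    + 2 * (P.β ^ 2 / P.M)
      * (P.β ^ 2 * P.cE * (P.cE - P.cK3) + P.M2 * (2 * P.cG - P.cI3)) * P.A1sq
    + P.β ^ 2 / P.M * (P.β ^ 2 * P.cE * P.cK3 + P.M2 * P.cI3) * P.A2sq
    + 1 / P.M * (P.β ^ 2 * P.cE * P.cK3 + P.M2 * P.cI3)

def B0sq (P : Params) : ℝ :=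
  P.β ^ 2 / (2 * P.M) * (P.M1 * P.cK4 - P.β ^ 2 * P.cE * P.cI5) * P.B1sq
    + P.β ^ 2 / P.M
      * (P.M1 * (P.cE - P.cK3) - P.cE * P.β ^ 2 * (2 * P.cG - P.cI3)) * P.C1sq
    + 1 / P.M * (P.M1 * P.cK4 - P.β ^ 2 * P.cE * P.cI5)

def C0sq (P : Params) : ℝ :=
  P.β ^ 2 / P.M * (1 / 2 * P.M2 * P.cI5 + 1 / 2 * P.β ^ 2 * P.cE * P.cK4) * P.B1sq
    + P.β ^ 2 / P.M
      * (P.M2 * (2 * P.cG - P.cI3) + P.β ^ 2 * P.cE * (P.cE - P.cK3)) * P.C1sq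
    + 1 / P.M * (P.M2 * P.cI5 + P.β ^ 2 * P.cE * P.cK4)

end Params

/-- The pairs `k ≤ l` of replicas among `n` replicas. -/
abbrev RPair (n : ℕ) : Type := {e : Fin n × Fin n // e.1 ≤ e.2}

/-- The set of replicas in a pair: two of them for an overlap, one for a self-overlap. -/
def RPair.supp {n : ℕ} (e : RPair n) : Finset (Fin n) := {e.1.1, e.1.2}

/-- The covariance of the limiting Gaussians indexed by two pairs of replicas. -/
def etaCov (P : Params) {n : ℕ} (e f : RPair n) : ℝ :=
  if e.supp.card = 2 ∧ f.supp.card = 2 then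
    (if (e.supp ∩ f.supp).card = 2 then P.A2sq else 0)
      + (e.supp ∩ f.supp).card * P.A1sq + P.A0sq
  else if e.supp.card = 1 ∧ f.supp.card = 1 then
    (if (e.supp ∩ f.supp).card = 1 then P.B1sq else 0) + P.B0sq
  else
    (if (e.supp ∩ f.supp).card = 1 then P.C1sq else 0) + P.C0sq

/-- The centering of an overlap (`q`) or of a self-overlap (`p`). -/
def center (p q : ℝ) {n : ℕ} (e : RPair n) : ℝ := if e.1.1 = e.1.2 then p else q

/-- The product over pairs `k ≤ l` of `(R k l - Q k l) ^ m k l`, as a function of `n` replicas. -/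
def overlapMonomial {N S n : ℕ} (p q : ℝ) (m : RPair n → ℕ) (σ : Fin n → Config N S) : ℝ :=
  ∏ e : RPair n, (overlap (σ e.1.1) (σ e.1.2) - center p q e) ^ m e

end GhatakSherrington

end

/-!
# Gaussian fluctuations of the overlaps in the Ghatak-Sherrington model at high temperature

The proof is the cavity method. A path of Gaussian Hamiltonians (`cavityAvg`) leads from a system
whose spin at a site `i` is independent of the other spins, with the law that defines `nu0`, to the
Gibbs average `nu`. By Gaussian integration by parts (`hasDerivAt_cavityAvg`) the derivative along
the path of the average of `f` is the average of `cavityGen f`, in which every term has an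
additional factor, a centered overlap of two replicas. An expansion along the path is therefore an
expansion in the size of the overlap fluctuations.

The equations for `(p, q)` have a unique solution because their right-hand sides are a contraction
for small `β` (`existsUnique_isFixedPoint`). With this solution, the product of the spins of two
replicas at the site `i`, centered at `p` or `q`, has mean zero at the start of the path. Writing
one factor of an even moment of a centered overlap `dev` as an average over the sites, and
expanding to first order, bounds this moment by a multiple less than `1` of itself and a lower
moment divided by `N`. Hence `dev` is of order `1 / √N` in every `L^p` (`exists_devMoment_le`).

Expanding `ν (W * dev k l)`, for a product `W` of centered overlaps, to second order gives an
approximate linear relation (`exists_moment_relation`). Up to an error that is smaller by `1 / √N`,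
the numbers `ν (W * dev a b)`, for all pairs `a`, `b` of replicas, solve a linear system whose
right-hand side is a combination of `ν (W') / N`, where `W'` is `W` without one factor. The replicas
that do not occur in `W` are exchangeable, so that the unknowns split into a part depending on two
replicas, parts depending on one, and constants. In this form the system is triangular with
determinants `M₃`, `M`, `M`, and two replicas outside of `W` suffice to make it injective
(`eq_zero_of_relationOp_eq_zero`), thus stable. The covariances `A₂², …, C₀²` are its solutions for
`W` with a single factor (`relationOp_etaArray`). Subtracting these solutions yields the
recursion `ν (W * dev k l) ≈ (1 / N) ∑ Cov(η k l, η f) ν (W without dev f)`, where the sum is over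
the factors `dev f` of `W` (`exists_nu_devProd_mul_dev`).

This is the recursion that integration by parts gives for the moments of a Gaussian family
(`integral_mul_prod_gaussianFamily`), and induction on the number of factors concludes
(`exists_moment_convergence`). The Gaussian family exists because the matrix of the covariances is a
limit of matrices of second moments (`posSemidef_etaCov`).
-/

open MeasureTheory ProbabilityTheory

noncomputable section

namespace GhatakSherrington

/-! ### Averages over independent replicas of a finite Gibbs measure -/

section Replica

variable {X : Type*} [Fintype X] {ι κ : Type*} [Fintype ι] [Fintype κ]

/-- The Gibbs weight `exp (H x) / ∑ exp (H y)` on a finite set. -/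
def gibbsProb (H : X → ℝ) (x : X) : ℝ := Real.exp (H x) / ∑ y, Real.exp (H y)

/-- The average of a function of independent replicas, indexed by `ι`, of the Gibbs measure with
Hamiltonian `H` on a finite set. -/
def replicaAvg [DecidableEq ι] (H : X → ℝ) (f : (ι → X) → ℝ) : ℝ :=
  ∑ x : ι → X, f x * ∏ k, gibbsProb H (x k)

lemma gibbsProb_nonneg (H : X → ℝ) (x : X) : 0 ≤ gibbsProb H x := by
  unfold gibbsProb; positivity

lemma sum_gibbsProb [Nonempty X] (H : X → ℝ) : ∑ x, gibbsProb H x = 1 := by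
  unfold gibbsProb
  rw [← Finset.sum_div, div_self]
  have : 0 < ∑ y, Real.exp (H y) :=
    Finset.sum_pos (fun _ _ => Real.exp_pos _) Finset.univ_nonempty
  exact this.ne'

variable [DecidableEq ι] [DecidableEq κ]

lemma sum_prod_replicas (F : ι → X → ℝ) :
    ∑ x : ι → X, ∏ k, F k (x k) = ∏ k, ∑ a, F k a := by
  rw [Finset.prod_univ_sum, Fintype.piFinset_univ]

lemma sum_prod_gibbsProb [Nonempty X] (H : X → ℝ) :
    ∑ x : ι → X, ∏ k, gibbsProb H (x k) = 1 := by
  rw [sum_prod_replicas (fun _ => gibbsProb H)]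
  simp [sum_gibbsProb]

lemma replicaAvg_const [Nonempty X] (H : X → ℝ) (c : ℝ) :
    replicaAvg H (fun _ : ι → X => c) = c := by
  unfold replicaAvg
  rw [← Finset.mul_sum, sum_prod_gibbsProb, mul_one]

lemma replicaAvg_mono (H : X → ℝ) {f g : (ι → X) → ℝ} (h : ∀ x, f x ≤ g x) :
    replicaAvg H f ≤ replicaAvg H g :=
  Finset.sum_le_sum fun x _ => mul_le_mul_of_nonneg_right (h x)
    (Finset.prod_nonneg fun _ _ => gibbsProb_nonneg H _)

lemma replicaAvg_add (H : X → ℝ) (f g : (ι → X) → ℝ) :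
    replicaAvg H (fun x => f x + g x) = replicaAvg H f + replicaAvg H g := by
  simp [replicaAvg, add_mul, Finset.sum_add_distrib]

lemma replicaAvg_const_mul (H : X → ℝ) (c : ℝ) (f : (ι → X) → ℝ) :
    replicaAvg H (fun x => c * f x) = c * replicaAvg H f := by
  simp [replicaAvg, mul_assoc, Finset.mul_sum]

lemma replicaAvg_sum {α : Type*} (s : Finset α) (H : X → ℝ) (f : α → (ι → X) → ℝ) :
    replicaAvg H (fun x => ∑ a ∈ s, f a x) = ∑ a ∈ s, replicaAvg H (f a) := by
  simp only [replicaAvg, Finset.sum_mul]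
  exact Finset.sum_comm

lemma abs_replicaAvg_le (H : X → ℝ) (f : (ι → X) → ℝ) :
    |replicaAvg H f| ≤ replicaAvg H (fun x => |f x|) := by
  unfold replicaAvg
  refine (Finset.abs_sum_le_sum_abs _ _).trans (Finset.sum_le_sum fun x _ => ?_)
  rw [abs_mul, abs_of_nonneg (Finset.prod_nonneg fun _ _ => gibbsProb_nonneg H _)]

lemma abs_replicaAvg_le_of_le [Nonempty X] (H : X → ℝ) {f : (ι → X) → ℝ} {c : ℝ}
    (h : ∀ x, |f x| ≤ c) : |replicaAvg H f| ≤ c :=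
  (abs_replicaAvg_le H f).trans
    ((replicaAvg_mono H h).trans_eq (replicaAvg_const H c))

lemma replicaAvg_reindex (H : X → ℝ) (e : ι ≃ κ) (f : (ι → X) → ℝ) :
    replicaAvg H (fun x : κ → X => f (x ∘ e)) = replicaAvg H f := by
  unfold replicaAvg
  refine Fintype.sum_equiv (e.arrowCongr (Equiv.refl X)).symm _ _ fun x => ?_
  have h1 : (e.arrowCongr (Equiv.refl X)).symm x = x ∘ e := by
    ext k; simp [Equiv.arrowCongr]
  rw [h1]
  congr 1
  exact (Equiv.prod_comp e (fun k => gibbsProb H (x k))).symm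

lemma replicaAvg_comp_inl [Nonempty X] (H : X → ℝ) (f : (ι → X) → ℝ) :
    replicaAvg H (fun x : ι ⊕ κ → X => f (x ∘ Sum.inl)) = replicaAvg H f := by
  unfold replicaAvg
  rw [← Equiv.sum_comp (Equiv.sumArrowEquivProdArrow ι κ X).symm, Fintype.sum_prod_type]
  refine Finset.sum_congr rfl fun x _ => ?_
  have : ∀ y : κ → X, (∏ k, gibbsProb H ((Equiv.sumArrowEquivProdArrow ι κ X).symm (x, y) k))
      = (∏ k, gibbsProb H (x k)) * ∏ k, gibbsProb H (y k) := fun y => by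
    rw [Fintype.prod_sum_type]; simp
  simp only [this]
  have h2 : ∀ y : κ → X, ((Equiv.sumArrowEquivProdArrow ι κ X).symm (x, y)) ∘ Sum.inl = x :=
    fun y => by ext k; simp
  simp only [h2]
  rw [← Finset.mul_sum, ← Finset.mul_sum, sum_prod_gibbsProb, mul_one]

/-- The law of a subfamily of the replicas is that of as many independent replicas. -/
lemma replicaAvg_comp_injective [Nonempty X] (H : X → ℝ) {i : ι → κ} (hi : Function.Injective i)
    (f : (ι → X) → ℝ) :
    replicaAvg H (fun x : κ → X => f (x ∘ i)) = replicaAvg H f := by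
  classical
  let e : ι ⊕ ((Set.range i)ᶜ : Set κ) ≃ κ :=
    (Equiv.sumCongr (Equiv.ofInjective i hi) (Equiv.refl _)).trans (Equiv.Set.sumCompl (Set.range i))
  rw [← replicaAvg_comp_inl (κ := ((Set.range i)ᶜ : Set κ)) H f, ← replicaAvg_reindex H e]
  congr 1

end Replica

/-! ### The derivative of a replica average along a path of Hamiltonians -/

section Tilt

variable {X : Type*} {n : ℕ}

/-- The effect of a change `V` of the Hamiltonian on the average of a function of `n` replicas: the
derivative of `replicaAvg H f` in the direction `V` is the average of `tilt V f`, a function of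
`n + 1` replicas. The additional replica accounts for the normalization. -/
def tilt (V : X → ℝ) (f : (Fin n → X) → ℝ) (x : Fin (n + 1) → X) : ℝ :=
  f (fun k => x k.castSucc) * ((∑ k : Fin n, V (x k.castSucc)) - n * V (x (Fin.last n)))

lemma replicaAvg_castSucc [Fintype X] [Nonempty X] (H : X → ℝ) (f : (Fin n → X) → ℝ) :
    replicaAvg H (fun x : Fin (n + 1) → X => f (fun k => x k.castSucc)) = replicaAvg H f :=
  replicaAvg_comp_injective H (Fin.castSucc_injective n) f

lemma sum_fin_succ_fun [Fintype X] (F : (Fin (n + 1) → X) → ℝ) :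
    ∑ x, F x = ∑ x : Fin n → X, ∑ a : X, F (Fin.snoc x a) := by
  rw [← Equiv.sum_comp (Fin.snocEquiv (fun _ : Fin (n + 1) => X)), Fintype.sum_prod_type,
    Finset.sum_comm]
  rfl

lemma replicaAvg_tilt [Fintype X] [Nonempty X] (H V : X → ℝ) (f : (Fin n → X) → ℝ) :
    replicaAvg H (tilt V f) = ∑ x : Fin n → X, f x *
      ((∏ k, gibbsProb H (x k)) * ∑ k, (V (x k) - ∑ a, V a * gibbsProb H a)) := by
  unfold replicaAvg tilt
  rw [sum_fin_succ_fun]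
  refine Finset.sum_congr rfl fun x _ => ?_
  simp only [Fin.prod_univ_castSucc, Fin.snoc_castSucc, Fin.snoc_last]
  have : ∀ a, f x * (∑ k, V (x k) - n * V a) * ((∏ k, gibbsProb H (x k)) * gibbsProb H a)
      = f x * (∏ k, gibbsProb H (x k)) * (∑ k, V (x k)) * gibbsProb H a
        - f x * (∏ k, gibbsProb H (x k)) * n * (V a * gibbsProb H a) := fun a => by ring
  simp only [this, Finset.sum_sub_distrib, ← Finset.mul_sum, sum_gibbsProb]
  simp
  ring

lemma hasDerivAt_gibbsProb [Fintype X] [Nonempty X] {H : ℝ → X → ℝ} {V : X → ℝ} {s : ℝ}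
    (h : ∀ x, HasDerivAt (fun r => H r x) (V x) s) (x : X) :
    HasDerivAt (fun r => gibbsProb (H r) x)
      (gibbsProb (H s) x * (V x - ∑ a, V a * gibbsProb (H s) a)) s := by
  have hZ : 0 < ∑ y, Real.exp (H s y) :=
    Finset.sum_pos (fun _ _ => Real.exp_pos _) Finset.univ_nonempty
  have h1 : HasDerivAt (fun r => ∑ y, Real.exp (H r y)) (∑ y, Real.exp (H s y) * V y) s :=
    HasDerivAt.fun_sum fun y _ => (h y).exp
  have h2 := (h x).exp.div h1 hZ.ne'
  refine h2.congr_deriv ?_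
  have : ∑ a, V a * gibbsProb (H s) a = (∑ y, Real.exp (H s y) * V y) / ∑ y, Real.exp (H s y) := by
    rw [Finset.sum_div]
    refine Finset.sum_congr rfl fun a _ => ?_
    unfold gibbsProb; ring
  rw [this]
  unfold gibbsProb
  field_simp

lemma hasDerivAt_replicaAvg [Fintype X] [Nonempty X] {H : ℝ → X → ℝ} {V : X → ℝ} {s : ℝ}
    (h : ∀ x, HasDerivAt (fun r => H r x) (V x) s) (f : (Fin n → X) → ℝ) :
    HasDerivAt (fun r => replicaAvg (H r) f) (replicaAvg (H s) (tilt V f)) s := by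
  rw [replicaAvg_tilt]
  unfold replicaAvg
  refine HasDerivAt.fun_sum fun x _ => HasDerivAt.const_mul _ ?_
  have := HasDerivAt.fun_finsetProd (u := (Finset.univ : Finset (Fin n)))
    (f := fun k r => gibbsProb (H r) (x k))
    (fun k _ => hasDerivAt_gibbsProb h (x k))
  refine this.congr_deriv ?_
  rw [Finset.mul_sum]
  refine Finset.sum_congr rfl fun k _ => ?_
  rw [smul_eq_mul, ← mul_assoc, Finset.prod_erase_mul _ _ (Finset.mem_univ k)]

/-- Weight of a replica in the first of two successive tilts. -/
def tiltWeight₁ (n : ℕ) : Fin (n + 2) → ℝ :=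
  Fin.snoc (Fin.snoc (fun _ : Fin n => (1 : ℝ)) (-n : ℝ) : Fin (n + 1) → ℝ) 0

/-- Weight of a replica in the second of two successive tilts. -/
def tiltWeight₂ (n : ℕ) : Fin (n + 2) → ℝ :=
  Fin.snoc (fun _ : Fin (n + 1) => (1 : ℝ)) (-(n + 1) : ℝ)

lemma sum_tiltWeight₁ (v : Fin (n + 2) → ℝ) :
    ∑ k, tiltWeight₁ n k * v k
      = ∑ k : Fin n, v k.castSucc.castSucc - n * v (Fin.last n).castSucc := by
  simp [tiltWeight₁, Fin.sum_univ_castSucc (n := n + 1), Fin.sum_univ_castSucc (n := n)]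
  ring

lemma sum_tiltWeight₂ (v : Fin (n + 2) → ℝ) :
    ∑ k, tiltWeight₂ n k * v k
      = ∑ k : Fin (n + 1), v k.castSucc - (n + 1) * v (Fin.last (n + 1)) := by
  simp [tiltWeight₂, Fin.sum_univ_castSucc (n := n + 1)]
  ring

lemma tilt_tilt (V W : X → ℝ) (f : (Fin n → X) → ℝ) (x : Fin (n + 2) → X) :
    tilt W (tilt V f) x = f (fun k => x k.castSucc.castSucc) *
      ∑ k, ∑ l, tiltWeight₁ n k * tiltWeight₂ n l * (V (x k) * W (x l)) := by
  have : ∑ k, ∑ l, tiltWeight₁ n k * tiltWeight₂ n l * (V (x k) * W (x l))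
      = (∑ k, tiltWeight₁ n k * V (x k)) * ∑ l, tiltWeight₂ n l * W (x l) := by
    rw [Finset.sum_mul_sum]
    refine Finset.sum_congr rfl fun k _ => Finset.sum_congr rfl fun l _ => by ring
  rw [this, sum_tiltWeight₁ (fun k => V (x k)), sum_tiltWeight₂ (fun k => W (x k))]
  unfold tilt
  push_cast
  ring

/-- The diagonal part of two successive tilts is a single tilt. -/
lemma tilt_eq_diag (V : X → ℝ) (f : (Fin n → X) → ℝ) (x : Fin (n + 2) → X) :
    tilt V f (fun k => x k.castSucc) = f (fun k => x k.castSucc.castSucc) *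
      ∑ k, tiltWeight₁ n k * tiltWeight₂ n k * V (x k) := by
  have : ∑ k, tiltWeight₁ n k * tiltWeight₂ n k * V (x k) = ∑ k, tiltWeight₁ n k * V (x k) := by
    refine Finset.sum_congr rfl fun k _ => ?_
    induction k using Fin.lastCases with
    | last => simp [tiltWeight₁]
    | cast k => simp [tiltWeight₂]
  rw [this, sum_tiltWeight₁ (fun k => V (x k))]
  rfl

end Tilt

/-! ### Gaussian integration by parts -/

section IBP

lemma integrable_gaussianReal_iff {f : ℝ → ℝ} :
    Integrable f (gaussianReal 0 1) ↔ Integrable (fun x => f x * gaussianPDFReal 0 1 x) := by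
  rw [gaussianReal_of_var_ne_zero _ one_ne_zero,
    integrable_withDensity_iff (measurable_gaussianPDF 0 1)
      (Filter.Eventually.of_forall fun x => gaussianPDF_lt_top)]
  simp only [toReal_gaussianPDF]

lemma integral_gaussianReal_mul_eq {φ φ' : ℝ → ℝ} (hd : ∀ x, HasDerivAt φ (φ' x) x)
    (h0 : Integrable φ (gaussianReal 0 1)) (h1 : Integrable φ' (gaussianReal 0 1))
    (h2 : Integrable (fun x => x * φ x) (gaussianReal 0 1)) :
    ∫ x, x * φ x ∂(gaussianReal 0 1) = ∫ x, φ' x ∂(gaussianReal 0 1) := by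
  have hpdf : ∀ x, HasDerivAt (gaussianPDFReal 0 1) (-(x * gaussianPDFReal 0 1 x)) x := fun x => by
    unfold gaussianPDFReal
    have h : HasDerivAt (fun y : ℝ => -(y - 0) ^ 2 / (2 * ((1 : NNReal) : ℝ))) (-x) x := by
      have := (((hasDerivAt_id x).sub_const 0).pow 2).neg.div_const (2 * ((1 : NNReal) : ℝ))
      refine this.congr_deriv ?_
      simp
      ring
    refine (h.exp.const_mul _).congr_deriv ?_
    ring
  rw [integrable_gaussianReal_iff] at h0 h1 h2
  have key := integral_mul_deriv_eq_deriv_mul_of_integrable (u := φ) (u' := φ')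
    (v := gaussianPDFReal 0 1) (v' := fun x => -(x * gaussianPDFReal 0 1 x))
    (fun x _ => hd x) (fun x _ => hpdf x) (by
      refine h2.neg.congr (Filter.Eventually.of_forall fun x => ?_)
      simp only [Pi.neg_apply, Pi.mul_apply]; ring) h1 h0
  rw [integral_gaussianReal_eq_integral_smul one_ne_zero,
    integral_gaussianReal_eq_integral_smul one_ne_zero]
  simp only [smul_eq_mul]
  have e1 : ∀ x, φ x * -(x * gaussianPDFReal 0 1 x) = -(gaussianPDFReal 0 1 x * (x * φ x)) :=
    fun x => by ring
  simp only [e1, integral_neg, neg_inj] at key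
  rw [key]
  simp only [mul_comm]

variable {ι : Type*} [Fintype ι]

/-- The law of i.i.d. standard Gaussian variables indexed by `ι`. -/
def stdGauss (ι : Type*) [Fintype ι] : Measure (ι → ℝ) := Measure.pi fun _ => gaussianReal 0 1

instance : IsProbabilityMeasure (stdGauss ι) := by unfold stdGauss; infer_instance

variable [DecidableEq ι]

/-- Resampling one coordinate of an i.i.d. Gaussian family does not change its law. -/
lemma measurePreserving_update_stdGauss (e : ι) :
    MeasurePreserving (fun p : (ι → ℝ) × ℝ => Function.update p.1 e p.2)
      ((stdGauss ι).prod (gaussianReal 0 1)) (stdGauss ι) := by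
  have hm : Measurable (fun p : (ι → ℝ) × ℝ => Function.update p.1 e p.2) := by
    refine measurable_pi_iff.2 fun k => ?_
    by_cases h : k = e
    · subst h; simpa using measurable_snd
    · simp only [Function.update_of_ne h]
      exact (measurable_pi_apply k).comp measurable_fst
  refine ⟨hm, ?_⟩
  symm
  refine Measure.pi_eq fun s hs => ?_
  rw [Measure.map_apply hm (MeasurableSet.univ_pi hs)]
  have : (fun p : (ι → ℝ) × ℝ => Function.update p.1 e p.2) ⁻¹' (Set.univ.pi s)
      = (Set.univ.pi (Function.update s e Set.univ)) ×ˢ (s e) := by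
    ext ⟨x, y⟩
    simp only [Set.mem_preimage, Set.mem_pi, Set.mem_univ, true_implies, Set.mem_prod]
    constructor
    · intro h
      refine ⟨fun k => ?_, by simpa using h e⟩
      by_cases hk : k = e
      · subst hk; simp
      · simpa [hk] using h k
    · rintro ⟨h, h'⟩ k
      by_cases hk : k = e
      · subst hk; simpa using h'
      · simpa [hk] using h k
  rw [this, Measure.prod_prod, stdGauss, Measure.pi_pi,
    ← Finset.prod_erase_mul _ _ (Finset.mem_univ e),
    ← Finset.prod_erase_mul Finset.univ (fun i => gaussianReal 0 1 (s i))
      (Finset.mem_univ e)]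
  simp only [Function.update_self, measure_univ, mul_one]
  congr 1
  refine Finset.prod_congr rfl fun k hk => ?_
  rw [Function.update_of_ne (Finset.ne_of_mem_erase hk)]

lemma integral_stdGauss_coord_mul (e : ι) {φ φ' : (ι → ℝ) → ℝ}
    (hd : ∀ g, HasDerivAt (fun s => φ (Function.update g e s)) (φ' g) (g e))
    (h0 : Integrable φ (stdGauss ι)) (h1 : Integrable φ' (stdGauss ι))
    (h2 : Integrable (fun g => g e * φ g) (stdGauss ι)) :
    ∫ g, g e * φ g ∂(stdGauss ι) = ∫ g, φ' g ∂(stdGauss ι) := by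
  have mp := measurePreserving_update_stdGauss (ι := ι) e
  have tr : ∀ {ψ : (ι → ℝ) → ℝ}, Integrable ψ (stdGauss ι) →
      Integrable (fun p : (ι → ℝ) × ℝ => ψ (Function.update p.1 e p.2))
        ((stdGauss ι).prod (gaussianReal 0 1)) ∧
      ∫ g, ψ g ∂(stdGauss ι)
        = ∫ g, ∫ s, ψ (Function.update g e s) ∂(gaussianReal 0 1) ∂(stdGauss ι) := by
    intro ψ hψ
    have hi : Integrable (fun p : (ι → ℝ) × ℝ => ψ (Function.update p.1 e p.2))
        ((stdGauss ι).prod (gaussianReal 0 1)) := mp.integrable_comp_of_integrable hψ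
    refine ⟨hi, ?_⟩
    have hmap := integral_map (μ := (stdGauss ι).prod (gaussianReal 0 1))
      (φ := fun p : (ι → ℝ) × ℝ => Function.update p.1 e p.2)
      mp.measurable.aemeasurable (f := ψ) (by rw [mp.map_eq]; exact hψ.aestronglyMeasurable)
    rw [mp.map_eq] at hmap
    rw [hmap, integral_prod _ hi]
  rw [(tr h2).2, (tr h1).2]
  refine integral_congr_ae ?_
  filter_upwards [(tr h0).1.prod_right_ae, (tr h1).1.prod_right_ae, (tr h2).1.prod_right_ae]
    with g i0 i1 i2
  simp only [Function.update_self] at i2 ⊢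
  refine integral_gaussianReal_mul_eq (fun s => ?_) i0 i1 i2
  have := hd (Function.update g e s)
  simpa using this

end IBP

/-! ### Interpolation between Gaussian Hamiltonians -/

section Path

/-- Along the interpolation the coefficient of a Gaussian variable either grows from `0` to `1`,
or decreases from `1` to `0`, or does not change. With `sin` and `cos` the path is smooth up to
its end points `0` and `π / 2`. -/
def pathCoef (τ : SignType) (θ : ℝ) : ℝ :=
  match τ with
  | .pos => Real.sin θ
  | .neg => Real.cos θ
  | .zero => 1

/-- The derivative of `pathCoef`. -/
def pathCoefDeriv (τ : SignType) (θ : ℝ) : ℝ :=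
  match τ with
  | .pos => Real.cos θ
  | .neg => -Real.sin θ
  | .zero => 0

lemma hasDerivAt_pathCoef (τ : SignType) (θ : ℝ) :
    HasDerivAt (pathCoef τ) (pathCoefDeriv τ θ) θ := by
  cases τ
  · exact hasDerivAt_const _ _
  · exact Real.hasDerivAt_cos θ
  · exact Real.hasDerivAt_sin θ

lemma pathCoef_mul_deriv (τ : SignType) (θ : ℝ) :
    pathCoefDeriv τ θ * pathCoef τ θ = (2 * Real.sin θ * Real.cos θ) * ((τ : ℝ) / 2) := by
  cases τ <;> simp [pathCoef, pathCoefDeriv] <;> ring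

lemma abs_pathCoefDeriv_le (τ : SignType) (θ : ℝ) : |pathCoefDeriv τ θ| ≤ 1 := by
  cases τ <;> simp [pathCoefDeriv, Real.abs_sin_le_one, Real.abs_cos_le_one]

variable {X ι : Type*} [Fintype ι]

/-- The interpolating Hamiltonian: a Gaussian part with coefficients `A`, each of which changes
along the path as prescribed by `τ`, and a deterministic part. -/
def pathHam (A : ι → X → ℝ) (τ : ι → SignType) (b₀ b₁ : X → ℝ) (θ : ℝ) (g : ι → ℝ) (x : X) : ℝ :=
  ∑ e, pathCoef (τ e) θ * g e * A e x + Real.sin θ ^ 2 * b₁ x + b₀ x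

variable [Fintype X] {n : ℕ}

/-- Expectation over the Gaussian variables of the replica average along the path. -/
def pathAvg (A : ι → X → ℝ) (τ : ι → SignType) (b₀ b₁ : X → ℝ) (θ : ℝ) (f : (Fin n → X) → ℝ) : ℝ :=
  ∫ g, replicaAvg (pathHam A τ b₀ b₁ θ g) f ∂(stdGauss ι)

/-- The generator of the interpolation: the derivative of `pathAvg` on `f` is, up to the speed
`2 sin θ cos θ`, `pathAvg` on `pathGen f`. -/
def pathGen (A : ι → X → ℝ) (τ : ι → SignType) (b₁ : X → ℝ) (f : (Fin n → X) → ℝ)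
    (x : Fin (n + 2) → X) : ℝ :=
  ∑ e, (τ e : ℝ) / 2 * tilt (A e) (tilt (A e) f) x + tilt b₁ f (fun k => x k.castSucc)

lemma continuous_replicaAvg [Nonempty X] {Y : Type*} [TopologicalSpace Y] {H : Y → X → ℝ}
    (hH : ∀ x, Continuous fun y => H y x) (f : (Fin n → X) → ℝ) :
    Continuous fun y => replicaAvg (H y) f := by
  unfold replicaAvg gibbsProb
  refine continuous_finsetSum _ fun x _ => continuous_const.mul (continuous_finsetProd _ fun k _ =>
    (Real.continuous_exp.comp (hH _)).div (continuous_finsetSum _ fun y _ =>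
      Real.continuous_exp.comp (hH _)) fun y => ?_)
  exact (Finset.sum_pos (fun _ _ => Real.exp_pos _) Finset.univ_nonempty).ne'

omit [Fintype X] in
lemma continuous_pathHam (A : ι → X → ℝ) (τ : ι → SignType) (b₀ b₁ : X → ℝ) (θ : ℝ) (x : X) :
    Continuous fun g => pathHam A τ b₀ b₁ θ g x := by
  unfold pathHam; fun_prop

lemma exists_abs_le {Y : Type*} [Fintype Y] (f : Y → ℝ) : ∃ C, 0 ≤ C ∧ ∀ y, |f y| ≤ C :=
  ⟨∑ y, |f y|, Finset.sum_nonneg fun _ _ => abs_nonneg _,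
    fun y => Finset.single_le_sum (f := fun y => |f y|) (fun _ _ => abs_nonneg _)
      (Finset.mem_univ y)⟩

lemma integrable_of_continuous_of_le {Y : Type*} [TopologicalSpace Y] [MeasurableSpace Y]
    [OpensMeasurableSpace Y] {μ : Measure Y} [IsFiniteMeasure μ]
    {φ : Y → ℝ} (hc : Continuous φ) {C : ℝ} (hC : ∀ y, |φ y| ≤ C) : Integrable φ μ :=
  Integrable.of_bound hc.aestronglyMeasurable C (Filter.Eventually.of_forall hC)

variable [Nonempty X]

lemma integrable_replicaAvg {Y : Type*} [TopologicalSpace Y] [MeasurableSpace Y]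
    [OpensMeasurableSpace Y] {μ : Measure Y} [IsFiniteMeasure μ] {H : Y → X → ℝ}
    (hH : ∀ x, Continuous fun y => H y x) (f : (Fin n → X) → ℝ) :
    Integrable (fun y => replicaAvg (H y) f) μ := by
  obtain ⟨C, -, hC⟩ := exists_abs_le f
  exact integrable_of_continuous_of_le (continuous_replicaAvg hH f)
    fun y => abs_replicaAvg_le_of_le _ hC

lemma integrable_abs_coord (e : ι) : Integrable (fun g : ι → ℝ => |g e|) (stdGauss ι) := by
  have : Integrable (fun x : ℝ => x) (gaussianReal 0 1) :=
    (memLp_id_gaussianReal' (μ := 0) (v := 1) 1 (by simp)).integrable le_rfl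
  exact ((measurePreserving_eval (fun _ : ι => gaussianReal 0 1) e).integrable_comp_of_integrable
    this).abs

lemma integrable_coord_mul_replicaAvg {H : (ι → ℝ) → X → ℝ}
    (hH : ∀ x, Continuous fun y => H y x) (f : (Fin n → X) → ℝ) (e : ι) :
    Integrable (fun g => g e * replicaAvg (H g) f) (stdGauss ι) := by
  obtain ⟨C, -, hC⟩ := exists_abs_le f
  refine ((integrable_abs_coord e).mul_const C).mono'
    ((continuous_apply e).mul (continuous_replicaAvg hH f)).aestronglyMeasurable
    (Filter.Eventually.of_forall fun g => ?_)
  rw [Real.norm_eq_abs, abs_mul]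
  exact mul_le_mul_of_nonneg_left (abs_replicaAvg_le_of_le _ hC) (abs_nonneg _)

omit [Fintype X] [Nonempty X] in
lemma tilt_add (V W : X → ℝ) (f : (Fin n → X) → ℝ) (x : Fin (n + 1) → X) :
    tilt (fun y => V y + W y) f x = tilt V f x + tilt W f x := by
  simp [tilt, Finset.sum_add_distrib]; ring

omit [Fintype X] [Nonempty X] in
lemma tilt_const_mul (c : ℝ) (V : X → ℝ) (f : (Fin n → X) → ℝ) (x : Fin (n + 1) → X) :
    tilt (fun y => c * V y) f x = c * tilt V f x := by
  simp only [tilt, ← Finset.mul_sum]; ring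

omit [Fintype X] [Nonempty X] in
lemma tilt_sum (V : ι → X → ℝ) (f : (Fin n → X) → ℝ) (x : Fin (n + 1) → X) :
    tilt (fun y => ∑ e, V e y) f x = ∑ e, tilt (V e) f x := by
  simp only [tilt, ← Finset.mul_sum, Finset.sum_sub_distrib]
  rw [Finset.sum_comm]

omit [Fintype X] [Nonempty X] in
lemma hasDerivAt_pathHam (A : ι → X → ℝ) (τ : ι → SignType) (b₀ b₁ : X → ℝ) (θ : ℝ)
    (g : ι → ℝ) (x : X) :
    HasDerivAt (fun r => pathHam A τ b₀ b₁ r g x)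
      (∑ e, pathCoefDeriv (τ e) θ * g e * A e x + (2 * Real.sin θ * Real.cos θ) * b₁ x) θ := by
  unfold pathHam
  refine ((HasDerivAt.fun_sum fun e _ =>
    (((hasDerivAt_pathCoef (τ e) θ).mul_const _).mul_const _)).add ?_).add_const _
  have := ((Real.hasDerivAt_sin θ).pow 2).mul_const (b₁ x)
  refine this.congr_deriv ?_
  simp

omit [Fintype X] [Nonempty X] in
lemma hasDerivAt_pathHam_update [DecidableEq ι] (A : ι → X → ℝ) (τ : ι → SignType) (b₀ b₁ : X → ℝ)
    (θ : ℝ) (g : ι → ℝ) (e : ι) (x : X) :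
    HasDerivAt (fun s => pathHam A τ b₀ b₁ θ (Function.update g e s) x)
      (pathCoef (τ e) θ * A e x) (g e) := by
  unfold pathHam
  refine HasDerivAt.add_const _ (HasDerivAt.add_const _ ?_)
  have h : ∀ k ∈ (Finset.univ : Finset ι),
      HasDerivAt (fun s => pathCoef (τ k) θ * Function.update g e s k * A k x)
        (if k = e then pathCoef (τ e) θ * A e x else 0) (g e) := fun k _ => by
    split_ifs with hk
    · subst hk
      simp only [Function.update_self]
      simpa using ((hasDerivAt_id (g k)).const_mul (pathCoef (τ k) θ)).mul_const (A k x)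
    · simp only [Function.update_of_ne hk]
      exact hasDerivAt_const _ _
  simpa using HasDerivAt.fun_sum h

/-- The derivative along the interpolation, by Gaussian integration by parts. -/
theorem hasDerivAt_pathAvg (A : ι → X → ℝ) (τ : ι → SignType) (b₀ b₁ : X → ℝ)
    (f : (Fin n → X) → ℝ) (θ : ℝ) :
    HasDerivAt (fun r => pathAvg A τ b₀ b₁ r f)
      (2 * Real.sin θ * Real.cos θ * pathAvg A τ b₀ b₁ θ (pathGen A τ b₁ f)) θ := by
  classical
  set V : ℝ → (ι → ℝ) → X → ℝ := fun r g x =>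
    ∑ e, pathCoefDeriv (τ e) r * g e * A e x + (2 * Real.sin r * Real.cos r) * b₁ x with hV
  have hcont := fun r x => continuous_pathHam A τ b₀ b₁ r x
  choose C hC0 hC using fun e => exists_abs_le (tilt (A e) f)
  obtain ⟨C', hC0', hC'⟩ := exists_abs_le (tilt b₁ f)
  have hF' : ∀ r g, replicaAvg (pathHam A τ b₀ b₁ r g) (tilt (V r g) f)
      = ∑ e, pathCoefDeriv (τ e) r * (g e * replicaAvg (pathHam A τ b₀ b₁ r g) (tilt (A e) f))
        + 2 * Real.sin r * Real.cos r * replicaAvg (pathHam A τ b₀ b₁ r g) (tilt b₁ f) := by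
    intro r g
    have : tilt (V r g) f = fun x => ∑ e, (pathCoefDeriv (τ e) r * g e) * tilt (A e) f x
        + 2 * Real.sin r * Real.cos r * tilt b₁ f x := by
      ext x
      simp only [hV]
      rw [tilt_add, tilt_sum, tilt_const_mul]
      congr 1
      refine Finset.sum_congr rfl fun e _ => tilt_const_mul _ _ _ _
    rw [this, replicaAvg_add, replicaAvg_sum, replicaAvg_const_mul]
    congr 1
    refine Finset.sum_congr rfl fun e _ => ?_
    rw [replicaAvg_const_mul, mul_assoc]
  have hint : ∀ r e, Integrable
      (fun g => g e * replicaAvg (pathHam A τ b₀ b₁ r g) (tilt (A e) f)) (stdGauss ι) :=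
    fun r e => integrable_coord_mul_replicaAvg (hcont r) _ e
  have hint' : ∀ r {m : ℕ} (F : (Fin m → X) → ℝ), Integrable
      (fun g => replicaAvg (pathHam A τ b₀ b₁ r g) F) (stdGauss ι) :=
    fun r m F => integrable_replicaAvg (hcont r) _
  have main := (hasDerivAt_integral_of_dominated_loc_of_deriv_le (μ := stdGauss ι) (x₀ := θ)
    (s := Set.univ) Filter.univ_mem
    (F := fun r g => replicaAvg (pathHam A τ b₀ b₁ r g) f)
    (F' := fun r g => replicaAvg (pathHam A τ b₀ b₁ r g) (tilt (V r g) f))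
    (bound := fun g => ∑ e, |g e| * C e + 2 * C')
    (Filter.Eventually.of_forall fun r => (continuous_replicaAvg (hcont r) f).aestronglyMeasurable)
    (hint' θ f)
    (by
      simp only [hF']
      exact ((integrable_finsetSum _ fun e _ => (hint θ e).const_mul _).add
        ((hint' θ _).const_mul _)).aestronglyMeasurable)
    (Filter.Eventually.of_forall fun g r _ => by
      rw [Real.norm_eq_abs, hF']
      refine (abs_add_le _ _).trans (add_le_add ((Finset.abs_sum_le_sum_abs _ _).trans
        (Finset.sum_le_sum fun e _ => ?_)) ?_)
      · rw [abs_mul, abs_mul]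
        refine (mul_le_of_le_one_left (by positivity) (abs_pathCoefDeriv_le _ _)).trans ?_
        exact mul_le_mul_of_nonneg_left (abs_replicaAvg_le_of_le _ (hC e)) (abs_nonneg _)
      · rw [abs_mul]
        refine mul_le_mul ?_ (abs_replicaAvg_le_of_le _ hC') (abs_nonneg _) zero_le_two
        rw [mul_assoc, abs_mul, abs_mul, abs_two]
        have h1 := Real.abs_sin_le_one r
        have h2 := Real.abs_cos_le_one r
        nlinarith [abs_nonneg (Real.sin r), abs_nonneg (Real.cos r)])
    ((integrable_finsetSum _ fun e _ => (integrable_abs_coord e).mul_const _).add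
      (integrable_const _))
    (Filter.Eventually.of_forall fun g r _ =>
      hasDerivAt_replicaAvg (fun x => hasDerivAt_pathHam A τ b₀ b₁ r g x) f)).2
  refine main.congr_deriv ?_
  simp only [hF']
  rw [integral_add (integrable_finsetSum _ fun e _ => (hint θ e).const_mul _)
    ((hint' θ _).const_mul _), integral_finsetSum _ fun e _ => (hint θ e).const_mul _]
  have ibp : ∀ e, ∫ g, g e * replicaAvg (pathHam A τ b₀ b₁ θ g) (tilt (A e) f) ∂(stdGauss ι)
      = pathCoef (τ e) θ * pathAvg A τ b₀ b₁ θ (tilt (A e) (tilt (A e) f)) := by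
    intro e
    have hd : ∀ g, HasDerivAt
        (fun s => replicaAvg (pathHam A τ b₀ b₁ θ (Function.update g e s)) (tilt (A e) f))
        (pathCoef (τ e) θ * replicaAvg (pathHam A τ b₀ b₁ θ g) (tilt (A e) (tilt (A e) f)))
        (g e) := fun g => by
      have := hasDerivAt_replicaAvg (fun x => hasDerivAt_pathHam_update A τ b₀ b₁ θ g e x)
        (tilt (A e) f)
      refine this.congr_deriv ?_
      rw [Function.update_eq_self, ← replicaAvg_const_mul]
      congr 1
      ext x
      rw [tilt_const_mul]
    rw [integral_stdGauss_coord_mul e hd (hint' θ _) ((hint' θ _).const_mul _) (hint θ e),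
      integral_const_mul]
    rfl
  simp only [integral_const_mul, ibp]
  have hg : pathAvg A τ b₀ b₁ θ (pathGen A τ b₁ f)
      = ∑ e, (τ e : ℝ) / 2 * pathAvg A τ b₀ b₁ θ (tilt (A e) (tilt (A e) f))
        + pathAvg A τ b₀ b₁ θ (tilt b₁ f) := by
    unfold pathAvg pathGen
    simp only [replicaAvg_add, replicaAvg_sum, replicaAvg_const_mul]
    rw [integral_add (integrable_finsetSum _ fun e _ => (hint' θ _).const_mul _)
      (hint' θ (fun x : Fin (n + 2) → X => tilt b₁ f fun k => x k.castSucc)),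
      integral_finsetSum _ fun e _ => (hint' θ _).const_mul _]
    simp only [integral_const_mul]
    congr 1
    refine integral_congr_ae (Filter.Eventually.of_forall fun g => ?_)
    exact replicaAvg_castSucc _ _
  rw [hg, mul_add, Finset.mul_sum]
  congr 1
  refine Finset.sum_congr rfl fun e _ => ?_
  rw [← mul_assoc, pathCoef_mul_deriv, mul_assoc]

end Path

/-! ### Factorization of the Gibbs measure at a decoupled site -/

section Factor

variable {X A J : Type*} [Fintype X] [Fintype A] [Fintype J] [DecidableEq J] {n : ℕ}

lemma replicaAvg_eq_div (H : X → ℝ) (f : (Fin n → X) → ℝ) :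
    replicaAvg H f
      = (∑ x, f x * ∏ k, Real.exp (H (x k))) / ∑ x : Fin n → X, ∏ k, Real.exp (H (x k)) := by
  rw [sum_prod_replicas (fun _ a => Real.exp (H a)), Finset.sum_div]
  unfold replicaAvg gibbsProb
  refine Finset.sum_congr rfl fun x _ => ?_
  rw [Finset.prod_div_distrib, mul_div_assoc]

/-- Replacing the spins of all replicas at the site `i`. -/
def setSite (i : J) (x : Fin n → J → A) (ε : Fin n → A) : Fin n → J → A :=
  fun k => Function.update (x k) i (ε k)

lemma sum_setSite (i : J) (F : (Fin n → J → A) → ℝ) :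
    ∑ x, ∑ ε, F (setSite i x ε) = (Fintype.card (Fin n → A) : ℝ) * ∑ x, F x := by
  have hinv : Function.Involutive (fun y : (Fin n → J → A) × (Fin n → A) =>
      ((setSite i y.1 y.2, fun k => y.1 k i) : (Fin n → J → A) × (Fin n → A))) := by
    rintro ⟨x, ε⟩
    refine Prod.ext (funext fun k => ?_) (funext fun k => ?_) <;> simp [setSite]
  have h1 : ∑ x, ∑ ε, F (setSite i x ε)
      = ∑ y : (Fin n → J → A) × (Fin n → A), F (hinv.toPerm _ y).1 := by
    rw [Fintype.sum_prod_type]; rfl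
  rw [h1, Equiv.sum_comp (hinv.toPerm _) (fun y => F y.1), Fintype.sum_prod_type]
  simp [Finset.mul_sum]

/-- A function of the replicas that does not see the spins at the site `i`. -/
def FreeOfSite (i : J) (f : (Fin n → J → A) → ℝ) : Prop := ∀ x ε, f (setSite i x ε) = f x

/-- If the spin at the site `i` does not interact with the others, a function of its replicas is
independent of the functions of the other spins. -/
lemma replicaAvg_mul_of_decoupled [Nonempty A] (i : J) {H H₁ : (J → A) → ℝ} {H₂ : A → ℝ}
    (hH : ∀ σ, H σ = H₁ σ + H₂ (σ i)) (hH₁ : ∀ σ a, H₁ (Function.update σ i a) = H₁ σ)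
    (ψ : (Fin n → A) → ℝ) {f : (Fin n → J → A) → ℝ} (hf : FreeOfSite i f) :
    replicaAvg H (fun x => ψ (fun k => x k i) * f x) = replicaAvg H₂ ψ * replicaAvg H₁ f := by
  have key : ∀ (ψ : (Fin n → A) → ℝ) (f : (Fin n → J → A) → ℝ), FreeOfSite i f →
      (Fintype.card (Fin n → A) : ℝ) * ∑ x, (ψ (fun k => x k i) * f x) * ∏ k, Real.exp (H (x k))
        = (∑ ε, ψ ε * ∏ k, Real.exp (H₂ (ε k))) * ∑ x, f x * ∏ k, Real.exp (H₁ (x k)) := by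
    intro ψ f hf
    rw [← sum_setSite i, Finset.sum_mul_sum, Finset.sum_comm]
    refine Finset.sum_congr rfl fun ε _ => Finset.sum_congr rfl fun x _ => ?_
    rw [hf]
    simp only [setSite, hH, hH₁, Function.update_self, Real.exp_add, Finset.prod_mul_distrib]
    ring
  have hc : (Fintype.card (Fin n → A) : ℝ) ≠ 0 := by exact_mod_cast Fintype.card_ne_zero
  have k1 := key ψ f hf
  have k2 := key (fun _ => 1) (fun _ => 1) (fun _ _ => rfl)
  simp only [one_mul] at k2
  rw [replicaAvg_eq_div, replicaAvg_eq_div, replicaAvg_eq_div, ← mul_div_mul_left _ _ hc, k1, k2,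
    mul_div_mul_comm]

end Factor

/-! ### The cavity interpolation -/

instance (S : ℕ) : Nonempty (Spin S) := ⟨⟨0, by simp⟩⟩

lemma Spin.abs_toReal_le {S : ℕ} (a : Spin S) : |a.toReal| ≤ S := by
  have h := Finset.mem_Icc.1 a.2
  unfold Spin.toReal
  rw [abs_le]
  exact ⟨by exact_mod_cast h.1, by exact_mod_cast h.2⟩

lemma integral_stdGauss_option {ι : Type*} [Fintype ι] (F : (ι → ℝ) → ℝ → ℝ) :
    ∫ g, F (fun e => g (some e)) (g none) ∂(stdGauss (Option ι))
      = ∫ y, F y.1 y.2 ∂((stdGauss ι).prod (gaussianReal 0 1)) := by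
  have h : MeasurePreserving (MeasurableEquiv.piOptionEquivProd (fun _ : Option ι => ℝ)).symm
      ((stdGauss ι).prod (gaussianReal 0 1)) (stdGauss (Option ι)) :=
    ⟨MeasurableEquiv.measurable _,
      Measure.pi_map_piOptionEquivProd (fun _ : Option ι => gaussianReal 0 1)⟩
  rw [← h.integral_comp']
  rfl

/-- The Hamiltonian of the decoupled spin. -/
def siteHam (P : Params) (z : ℝ) (a : Spin P.S) : ℝ :=
  a.toReal * (P.β * z * √P.q) + P.β ^ 2 / 2 * (P.p - P.q) * a.toReal ^ 2
    + P.D * a.toReal ^ 2 + P.h * a.toReal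

lemma nu0_eq (P : Params) (r : ℕ) (f : (Fin r → ℝ) → ℝ) :
    P.nu0 r f = ∫ z, replicaAvg (siteHam P z) (fun ε => f (fun k => (ε k).toReal))
      ∂(gaussianReal 0 1) := rfl

section Cavity

variable (P : Params) {N n : ℕ} (i : Fin N)

/-- Coefficients of the Gaussian variables of the cavity interpolation at the site `i`: one
variable for each bond, and one more variable `none`, which replaces the interaction of the
spin at `i` with the other spins. -/
def cavityCoef : Option (Bond N) → Config N P.S → ℝ
  | none => fun σ => P.β * √P.q * (σ i).toReal
  | some e => fun σ => P.β / √(N : ℝ) * ((σ e.1.1).toReal * (σ e.1.2).toReal)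

/-- The bonds at `i` are switched on along the path, the variable `none` is switched off. -/
def cavityType : Option (Bond N) → SignType
  | none => .neg
  | some e => if e.1.1 = i ∨ e.1.2 = i then .pos else .zero

lemma pathCoef_cavityType_pi_div_two (e : Bond N) :
    pathCoef (cavityType i (some e)) (Real.pi / 2) = 1 := by
  unfold cavityType
  dsimp only
  split_ifs <;> simp [pathCoef]

lemma pathCoef_cavityType_zero (e : Bond N) :
    pathCoef (cavityType i (some e)) 0 = if e.1.1 = i ∨ e.1.2 = i then 0 else 1 := by
  unfold cavityType
  dsimp only
  split_ifs <;> simp [pathCoef]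

lemma pathCoef_cavityType_none (θ : ℝ) :
    pathCoef (cavityType i none) θ = Real.cos θ := rfl

/-- The deterministic part of the Hamiltonian, with the spin at `i` decoupled. -/
def cavityBase (σ : Config N P.S) : ℝ :=
  P.D * ∑ j, (σ j).toReal ^ 2 + P.h * ∑ j, (σ j).toReal
    + P.β ^ 2 / 2 * (P.p - P.q) * (σ i).toReal ^ 2

/-- The change of the deterministic part along the path. -/
def cavityIncr (σ : Config N P.S) : ℝ := -(P.β ^ 2 / 2 * (P.p - P.q)) * (σ i).toReal ^ 2

/-- The average along the path that couples the spin at the site `i` to the others: at `θ = 0` it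
is independent of them, at `θ = π / 2` the average is `nu`. -/
def cavityAvg (θ : ℝ) (f : (Fin n → Config N P.S) → ℝ) : ℝ :=
  pathAvg (cavityCoef P i) (cavityType i) (cavityBase P i) (cavityIncr P i) θ f

lemma cavityAvg_pi_div_two (f : (Fin n → Config N P.S) → ℝ) :
    cavityAvg P i (Real.pi / 2) f = nu P.β P.D P.h f := by
  unfold cavityAvg pathAvg nu
  have h : ∀ g : Option (Bond N) → ℝ,
      pathHam (cavityCoef P i) (cavityType i) (cavityBase P i) (cavityIncr P i) (Real.pi / 2) g
        = hamiltonian P.β P.D P.h (fun e => g (some e)) := by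
    intro g
    ext σ
    simp only [pathHam, Fintype.sum_option, pathCoef_cavityType_pi_div_two,
      pathCoef_cavityType_none, Real.cos_pi_div_two, Real.sin_pi_div_two, hamiltonian, cavityBase,
      cavityIncr, cavityCoef, Finset.mul_sum]
    have h2 : ∀ e : Bond N, 1 * g (some e) * (P.β / √(N : ℝ) *
        ((σ e.1.1).toReal * (σ e.1.2).toReal))
        = P.β / √(N : ℝ) * (g (some e) * (σ e.1.1).toReal * (σ e.1.2).toReal) := fun e => by ring
    simp only [h2]
    ring
  simp only [h]
  rw [integral_stdGauss_option
    (fun g _ => replicaAvg (hamiltonian P.β P.D P.h g) f)]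
  have := integral_fun_fst (μ := stdGauss (Bond N)) (ν := gaussianReal 0 1)
    (fun g => replicaAvg (hamiltonian P.β P.D P.h g) f)
  rw [this]
  simp
  rfl

/-- The overlap of the replicas `k`, `l`, or the self-overlap if `k = l`, centered at its limit. -/
def dev (x : Fin n → Config N P.S) (k l : Fin n) : ℝ :=
  overlap (x k) (x l) - if k = l then P.p else P.q

/-- The centered overlap without the contribution of the site `i`. -/
def cavityDev (x : Fin n → Config N P.S) (k l : Fin n) : ℝ :=
  dev P x k l - (x k i).toReal * (x l i).toReal / N

lemma sum_bonds_at (v : Fin N → ℝ) :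
    ∑ e : Bond N, (if e.1.1 = i ∨ e.1.2 = i then v e.1.1 * v e.1.2 else 0)
      = v i * (∑ j, v j - v i) := by
  have h1 : ∑ e : Bond N, (if e.1.1 = i ∨ e.1.2 = i then v e.1.1 * v e.1.2 else 0)
      = ∑ a, ∑ b, if a < b then (if a = i ∨ b = i then v a * v b else 0) else 0 := by
    rw [← Fintype.sum_prod_type' (f := fun a b => if a < b then
      (if a = i ∨ b = i then v a * v b else 0) else 0),
      ← Finset.sum_filter (fun e : Fin N × Fin N => e.1 < e.2)
        (fun e => if e.1 = i ∨ e.2 = i then v e.1 * v e.2 else 0)]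
    exact (Finset.sum_subtype _ (fun e => by simp)
      (fun e : Fin N × Fin N => if e.1 = i ∨ e.2 = i then v e.1 * v e.2 else 0)).symm
  have h2 : ∀ a b, (if a < b then (if a = i ∨ b = i then v a * v b else 0) else 0)
      = (if a = i then (if i < b then v i * v b else 0) else 0)
        + (if b = i then (if a < i then v i * v a else 0) else 0) := by
    intro a b
    by_cases ha : a = i
    · subst ha
      by_cases hb : b = a
      · subst hb; simp
      · simp [hb]
    · by_cases hb : b = i
      · subst hb; simp [ha, mul_comm]
      · simp [ha, hb]
  rw [h1]
  simp only [h2, Finset.sum_add_distrib]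
  rw [Finset.sum_comm]
  simp only [Finset.sum_ite_eq', Finset.mem_univ, if_true]
  rw [← Finset.sum_add_distrib]
  have h3 : ∀ j, (if i < j then v i * v j else 0) + (if j < i then v i * v j else 0)
      = v i * v j - if j = i then v i * v i else 0 := by
    intro j
    rcases lt_trichotomy i j with h | h | h
    · simp [h, h.ne', not_lt.2 h.le]
    · subst h; simp
    · simp [h, h.ne, not_lt.2 h.le]
  simp only [h3, Finset.sum_sub_distrib, ← Finset.mul_sum]
  simp
  ring

/-- The generator of the cavity interpolation at the site `i`. -/
def cavityGen (f : (Fin n → Config N P.S) → ℝ) (x : Fin (n + 2) → Config N P.S) : ℝ :=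
  P.β ^ 2 / 2 * (f (fun k => x k.castSucc.castSucc) * ∑ k, ∑ l,
    tiltWeight₁ n k * tiltWeight₂ n l * ((x k i).toReal * (x l i).toReal * cavityDev P i x k l))

/-- The bonds at `i` contribute the overlaps without the site `i`, the variable that fades out
subtracts `q`, and the deterministic part corrects this to `p` for the self-overlaps. -/
lemma pathGen_cavity (hq : 0 ≤ P.q) (f : (Fin n → Config N P.S) → ℝ) :
    pathGen (cavityCoef P i) (cavityType i) (cavityIncr P i) f = cavityGen P i f := by
  have hN : (0 : ℝ) < N := by exact_mod_cast i.pos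
  ext x
  unfold pathGen cavityGen
  rw [tilt_eq_diag]
  simp only [tilt_tilt, Fintype.sum_option]
  set F := f (fun k => x k.castSucc.castSucc)
  set ε : Fin (n + 2) → ℝ := fun k => (x k i).toReal with hε
  have hbond : ∀ k l, ∑ e : Bond N, ((cavityType i (some e) : SignType) : ℝ) / 2
      * (cavityCoef P i (some e) (x k) * cavityCoef P i (some e) (x l))
      = P.β ^ 2 / 2 * (ε k * ε l * (overlap (x k) (x l) - ε k * ε l / N)) := by
    intro k l
    have := sum_bonds_at i (fun j => (x k j).toReal * (x l j).toReal)
    have h2 : ∀ e : Bond N, ((cavityType i (some e) : SignType) : ℝ) / 2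
      * (cavityCoef P i (some e) (x k) * cavityCoef P i (some e) (x l))
      = P.β ^ 2 / (2 * N) * (if e.1.1 = i ∨ e.1.2 = i then
        ((x k e.1.1).toReal * (x l e.1.1).toReal) * ((x k e.1.2).toReal * (x l e.1.2).toReal)
        else 0) := by
      intro e
      have hs : √(N : ℝ) ^ 2 = N := Real.sq_sqrt hN.le
      simp only [cavityType, cavityCoef]
      split_ifs
      · have : (P.β / √(N : ℝ)) * (P.β / √(N : ℝ)) = P.β ^ 2 / N := by
          rw [div_mul_div_comm, ← sq, ← sq, hs]
        simp only [SignType.pos_eq_one, SignType.coe_one]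
        linear_combination (1 / 2 * (((x k e.1.1).toReal * (x l e.1.1).toReal)
          * ((x k e.1.2).toReal * (x l e.1.2).toReal))) * this
      · simp
    simp only [h2, ← Finset.mul_sum, this]
    simp only [overlap, hε]
    field_simp
  have e1 : ∀ e : Bond N, ((cavityType i (some e) : SignType) : ℝ) / 2 * (F * ∑ k, ∑ l,
      tiltWeight₁ n k * tiltWeight₂ n l
        * (cavityCoef P i (some e) (x k) * cavityCoef P i (some e) (x l)))
      = F * ∑ k, ∑ l, tiltWeight₁ n k * tiltWeight₂ n l *
        (((cavityType i (some e) : SignType) : ℝ) / 2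
        * (cavityCoef P i (some e) (x k) * cavityCoef P i (some e) (x l))) := by
    intro e
    simp only [Finset.mul_sum]
    refine Finset.sum_congr rfl fun k _ => Finset.sum_congr rfl fun l _ => by ring
  simp only [e1, ← Finset.mul_sum]
  have e2 : ∑ e : Bond N, ∑ k, ∑ l, tiltWeight₁ n k * tiltWeight₂ n l *
        (((cavityType i (some e) : SignType) : ℝ) / 2
        * (cavityCoef P i (some e) (x k) * cavityCoef P i (some e) (x l)))
      = ∑ k, ∑ l, tiltWeight₁ n k * tiltWeight₂ n l *
        (P.β ^ 2 / 2 * (ε k * ε l * (overlap (x k) (x l) - ε k * ε l / N))) := by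
    rw [Finset.sum_comm]
    refine Finset.sum_congr rfl fun k _ => ?_
    rw [Finset.sum_comm]
    refine Finset.sum_congr rfl fun l _ => ?_
    rw [← Finset.mul_sum, hbond]
  rw [e2]
  have e3 : ∑ k, tiltWeight₁ n k * tiltWeight₂ n k * cavityIncr P i (x k)
      = ∑ k, ∑ l, tiltWeight₁ n k * tiltWeight₂ n l *
        (if k = l then -(P.β ^ 2 / 2 * (P.p - P.q)) * (ε k * ε l) else 0) := by
    refine Finset.sum_congr rfl fun k _ => ?_
    simp only [mul_ite, mul_zero, Finset.sum_ite_eq, Finset.mem_univ, if_true, cavityIncr]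
    simp only [hε]; ring
  rw [e3]
  have e4 : ((cavityType i (none : Option (Bond N)) : SignType) : ℝ) / 2 * (F * ∑ k, ∑ l,
      tiltWeight₁ n k * tiltWeight₂ n l
        * (cavityCoef P i none (x k) * cavityCoef P i none (x l)))
      = F * ∑ k, ∑ l, tiltWeight₁ n k * tiltWeight₂ n l *
        (-(P.β ^ 2 / 2 * P.q) * (ε k * ε l)) := by
    simp only [Finset.mul_sum]
    refine Finset.sum_congr rfl fun k _ => Finset.sum_congr rfl fun l _ => ?_
    simp only [cavityType, cavityCoef, SignType.neg_eq_neg_one, SignType.coe_neg, SignType.coe_one]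
    simp only [hε]
    have hs : √P.q ^ 2 = P.q := Real.sq_sqrt hq
    linear_combination (-(1/2) * F * tiltWeight₁ n k * tiltWeight₂ n l * P.β ^ 2
      * (x k i).toReal * (x l i).toReal) * hs
  rw [e4, ← mul_add, ← mul_add, mul_left_comm]
  congr 1
  rw [Finset.mul_sum, ← Finset.sum_add_distrib, ← Finset.sum_add_distrib]
  refine Finset.sum_congr rfl fun k _ => ?_
  rw [Finset.mul_sum, ← Finset.sum_add_distrib, ← Finset.sum_add_distrib]
  refine Finset.sum_congr rfl fun l _ => ?_
  simp only [cavityDev, dev, hε]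
  split_ifs <;> ring

lemma hasDerivAt_cavityAvg (hq : 0 ≤ P.q) (f : (Fin n → Config N P.S) → ℝ) (θ : ℝ) :
    HasDerivAt (fun r => cavityAvg P i r f)
      (2 * Real.sin θ * Real.cos θ * cavityAvg P i θ (cavityGen P i f)) θ := by
  rw [← pathGen_cavity P i hq]
  exact hasDerivAt_pathAvg _ _ _ _ _ _

/-- At the start of the path the spin at the site `i` is independent of the others. -/
lemma cavityAvg_zero_mul (ψ : (Fin n → ℝ) → ℝ) {f : (Fin n → Config N P.S) → ℝ}
    (hf : FreeOfSite i f) :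
    cavityAvg P i 0 (fun x => ψ (fun k => (x k i).toReal) * f x)
      = P.nu0 n ψ * cavityAvg P i 0 f := by
  set H₁ : (Bond N → ℝ) → Config N P.S → ℝ := fun g σ =>
    ∑ e : Bond N, (if e.1.1 = i ∨ e.1.2 = i then 0 else
      g e * (P.β / √(N : ℝ) * ((σ e.1.1).toReal * (σ e.1.2).toReal)))
    + ∑ j, (if j = i then 0 else P.D * (σ j).toReal ^ 2 + P.h * (σ j).toReal) with hH₁
  have hH : ∀ (g : Option (Bond N) → ℝ) σ,
      pathHam (cavityCoef P i) (cavityType i) (cavityBase P i) (cavityIncr P i) 0 g σ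
        = H₁ (fun e => g (some e)) σ + siteHam P (g none) (σ i) := by
    intro g σ
    simp only [pathHam, Fintype.sum_option, pathCoef_cavityType_zero, pathCoef_cavityType_none,
      Real.cos_zero, Real.sin_zero, cavityBase, cavityIncr, hH₁, siteHam, cavityCoef, ite_mul,
      zero_mul, one_mul]
    have h2 : ∑ j, (if j = i then 0 else P.D * (σ j).toReal ^ 2 + P.h * (σ j).toReal)
        = P.D * ∑ j, (σ j).toReal ^ 2 + P.h * ∑ j, (σ j).toReal
          - (P.D * (σ i).toReal ^ 2 + P.h * (σ i).toReal) := by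
      have : ∀ j, (if j = i then 0 else P.D * (σ j).toReal ^ 2 + P.h * (σ j).toReal)
          = P.D * (σ j).toReal ^ 2 + P.h * (σ j).toReal
            - (if j = i then P.D * (σ i).toReal ^ 2 + P.h * (σ i).toReal else 0) := by
        intro j; split_ifs with h
        · subst h; ring
        · ring
      simp only [this, Finset.sum_sub_distrib, Finset.sum_add_distrib, ← Finset.mul_sum]
      simp
    rw [h2]
    ring
  have hfree : ∀ g σ a, H₁ g (Function.update σ i a) = H₁ g σ := by
    intro g σ a
    simp only [hH₁]
    congr 1
    · refine Finset.sum_congr rfl fun e _ => ?_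
      split_ifs with h
      · rfl
      · push Not at h
        rw [Function.update_of_ne h.1, Function.update_of_ne h.2]
    · refine Finset.sum_congr rfl fun j _ => ?_
      split_ifs with h
      · rfl
      · rw [Function.update_of_ne h]
  have hfac : ∀ (ψ' : (Fin n → Spin P.S) → ℝ) (f' : (Fin n → Config N P.S) → ℝ),
      FreeOfSite i f' → ∀ g : Option (Bond N) → ℝ, replicaAvg
        (pathHam (cavityCoef P i) (cavityType i) (cavityBase P i) (cavityIncr P i) 0 g)
        (fun x => ψ' (fun k => x k i) * f' x)
      = replicaAvg (siteHam P (g none)) ψ' * replicaAvg (H₁ (fun e => g (some e))) f' := by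
    exact fun ψ' f' hf' g => replicaAvg_mul_of_decoupled i (hH g) (hfree _) ψ' hf'
  have hprod : ∀ (ψ' : (Fin n → Spin P.S) → ℝ) (f' : (Fin n → Config N P.S) → ℝ),
      FreeOfSite i f' → cavityAvg P i 0 (fun x => ψ' (fun k => x k i) * f' x)
      = (∫ z, replicaAvg (siteHam P z) ψ' ∂(gaussianReal 0 1))
        * ∫ g, replicaAvg (H₁ g) f' ∂(stdGauss (Bond N)) := by
    intro ψ' f' hf'
    unfold cavityAvg pathAvg
    simp only [hfac ψ' f' hf']
    rw [integral_stdGauss_option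
      (fun g z => replicaAvg (siteHam P z) ψ' * replicaAvg (H₁ g) f')]
    simp only [mul_comm (replicaAvg (siteHam P _) ψ')]
    rw [integral_prod_mul (μ := stdGauss (Bond N)) (ν := gaussianReal 0 1)
      (fun g => replicaAvg (H₁ g) f') (fun z => replicaAvg (siteHam P z) ψ'), mul_comm]
  have h1 := hprod (fun ε => ψ (fun k => (ε k).toReal)) f hf
  have h2 := hprod (fun _ => 1) f hf
  simp only [one_mul, replicaAvg_const, integral_const, probReal_univ, smul_eq_mul] at h2
  rw [h2, nu0_eq]
  exact h1

end Cavity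

/-! ### Integrating the derivative along the interpolation -/

/-- The speed `2 sin θ cos θ` of the interpolation has integral `1`. -/
lemma abs_sub_sub_le_of_hasDerivAt {U G : ℝ → ℝ} {c K : ℝ}
    (hU : ∀ θ, HasDerivAt U (2 * Real.sin θ * Real.cos θ * G θ) θ)
    (hG : ∀ θ ∈ Set.Icc 0 (Real.pi / 2), |G θ - c| ≤ K) {t : ℝ} (ht : t ∈ Set.Icc 0 (Real.pi / 2)) :
    |U t - U 0 - c * Real.sin t ^ 2| ≤ K := by
  have hs : ∀ θ, HasDerivAt (fun r => Real.sin r ^ 2) (2 * Real.sin θ * Real.cos θ) θ := fun θ => by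
    have := (Real.hasDerivAt_sin θ).pow 2
    refine this.congr_deriv ?_
    simp
  have hpi := Real.pi_pos
  have hmem : ∀ {θ}, θ ∈ interior (Set.Icc 0 (Real.pi / 2)) →
      0 ≤ Real.sin θ * Real.cos θ ∧ |G θ - c| ≤ K := by
    intro θ hθ
    have h' := interior_subset hθ
    exact ⟨mul_nonneg (Real.sin_nonneg_of_nonneg_of_le_pi h'.1 (by linarith [h'.2]))
      (Real.cos_nonneg_of_neg_pi_div_two_le_of_le (by linarith [h'.1]) h'.2), hG θ h'⟩
  have mono : ∀ κ : ℝ, (∀ θ, |G θ - c| ≤ K → 0 ≤ G θ - κ) →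
      U 0 - κ * Real.sin 0 ^ 2 ≤ U t - κ * Real.sin t ^ 2 := by
    intro κ hκ
    have hd : ∀ θ, HasDerivAt (fun r => U r - κ * Real.sin r ^ 2)
        (2 * (Real.sin θ * Real.cos θ) * (G θ - κ)) θ := fun θ =>
      ((hU θ).sub ((hs θ).const_mul κ)).congr_deriv (by ring)
    exact monotoneOn_of_deriv_nonneg (convex_Icc 0 (Real.pi / 2))
      (fun θ _ => (hd θ).continuousAt.continuousWithinAt)
      (fun θ _ => (hd θ).differentiableAt.differentiableWithinAt)
      (fun θ hθ => by
        rw [(hd θ).deriv]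
        have := hmem hθ
        exact mul_nonneg (by linarith [this.1]) (hκ θ this.2))
      ⟨le_rfl, by positivity⟩ ht ht.1
  have anti : ∀ κ : ℝ, (∀ θ, |G θ - c| ≤ K → G θ - κ ≤ 0) →
      U t - κ * Real.sin t ^ 2 ≤ U 0 - κ * Real.sin 0 ^ 2 := by
    intro κ hκ
    have hd : ∀ θ, HasDerivAt (fun r => U r - κ * Real.sin r ^ 2)
        (2 * (Real.sin θ * Real.cos θ) * (G θ - κ)) θ := fun θ =>
      ((hU θ).sub ((hs θ).const_mul κ)).congr_deriv (by ring)
    exact antitoneOn_of_deriv_nonpos (convex_Icc 0 (Real.pi / 2))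
      (fun θ _ => (hd θ).continuousAt.continuousWithinAt)
      (fun θ _ => (hd θ).differentiableAt.differentiableWithinAt)
      (fun θ hθ => by
        rw [(hd θ).deriv]
        have := hmem hθ
        exact mul_nonpos_of_nonneg_of_nonpos (by linarith [this.1]) (hκ θ this.2))
      ⟨le_rfl, by positivity⟩ ht ht.1
  have h1 := mono (c - K) fun θ h => by linarith [(abs_le.1 h).1]
  have h2 := anti (c + K) fun θ h => by linarith [(abs_le.1 h).2]
  simp only [Real.sin_zero] at h1 h2
  have hK : 0 ≤ K := (abs_nonneg _).trans (hG t ht)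
  have h3 : K * Real.sin t ^ 2 ≤ K := mul_le_of_le_one_right hK (Real.sin_sq_le_one t)
  rw [abs_le]
  constructor <;> nlinarith

/-- Total mass of the weights of two successive tilts. -/
def tiltMass (n : ℕ) : ℝ := ∑ k : Fin (n + 2), ∑ l : Fin (n + 2), |tiltWeight₁ n k * tiltWeight₂ n l|

lemma tiltMass_nonneg (n : ℕ) : 0 ≤ tiltMass n :=
  Finset.sum_nonneg fun _ _ => Finset.sum_nonneg fun _ _ => abs_nonneg _

lemma abs_sum_tiltWeight_le {n : ℕ} {v : Fin (n + 2) → Fin (n + 2) → ℝ} {C : ℝ}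
    (hv : ∀ k l, |v k l| ≤ C) :
    |∑ k, ∑ l, tiltWeight₁ n k * tiltWeight₂ n l * v k l| ≤ tiltMass n * C := by
  unfold tiltMass
  rw [Finset.sum_mul]
  refine (Finset.abs_sum_le_sum_abs _ _).trans (Finset.sum_le_sum fun k _ => ?_)
  rw [Finset.sum_mul]
  refine (Finset.abs_sum_le_sum_abs _ _).trans (Finset.sum_le_sum fun l _ => ?_)
  rw [abs_mul]
  exact mul_le_mul_of_nonneg_left (hv k l) (abs_nonneg _)

/-! ### The replica-symmetric equations -/

lemma Spin.abs_mul_le {S : ℕ} (a b : Spin S) : |a.toReal * b.toReal| ≤ (S : ℝ) ^ 2 := by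
  rw [abs_mul, sq]
  exact mul_le_mul a.abs_toReal_le b.abs_toReal_le (abs_nonneg _) (Nat.cast_nonneg _)

lemma continuous_siteHam (P : Params) (a : Spin P.S) : Continuous fun z => siteHam P z a := by
  unfold siteHam; fun_prop

lemma abs_nu0_le (P : Params) (r : ℕ) {f : (Fin r → ℝ) → ℝ} {C : ℝ}
    (hf : ∀ ε : Fin r → Spin P.S, |f (fun k => (ε k).toReal)| ≤ C) : |P.nu0 r f| ≤ C := by
  rw [nu0_eq]
  have := norm_integral_le_of_norm_le_const (μ := gaussianReal 0 1)
    (f := fun z => replicaAvg (siteHam P z) (fun ε => f (fun k => (ε k).toReal)))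
    (Filter.Eventually.of_forall fun z => abs_replicaAvg_le_of_le _ hf)
  simpa using this

lemma nu0_comp_injective (P : Params) {r s : ℕ} {i : Fin r → Fin s} (hi : Function.Injective i)
    (f : (Fin r → ℝ) → ℝ) : P.nu0 s (fun ε => f (fun k => ε (i k))) = P.nu0 r f := by
  simp only [nu0_eq]
  refine integral_congr_ae (Filter.Eventually.of_forall fun z => ?_)
  exact replicaAvg_comp_injective (siteHam P z) hi (fun ε => f (fun k => (ε k).toReal))

lemma nu0_prod (P : Params) {r : ℕ} (φ : Fin r → ℝ → ℝ) :
    P.nu0 r (fun ε => ∏ k, φ k (ε k))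
      = ∫ z, ∏ k, ∑ a : Spin P.S, φ k a.toReal * P.gibbs0 z a ∂(gaussianReal 0 1) := by
  unfold Params.nu0
  refine integral_congr_ae (Filter.Eventually.of_forall fun z => ?_)
  simp only [← Finset.prod_mul_distrib]
  exact sum_prod_replicas (fun k a => φ k (Spin.toReal a) * P.gibbs0 z a)

/-- Given the Gaussian variable, the two replicas are independent with the same mean. -/
lemma nu0_overlap_nonneg (P : Params) : 0 ≤ P.nu0 2 (fun ε => ε 0 * ε 1) := by
  have := nu0_prod P (r := 2) (fun _ x => x)
  simp only [Fin.prod_univ_two] at this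
  rw [this]
  exact integral_nonneg fun z => mul_self_nonneg _

/-- The laws of the decoupled spin for two values of `(p, q)` are joined by an interpolation with
two independent Gaussian variables, one fading in and one fading out; the derivative along it is
a combination of `p' - p` and `q' - q`. -/
lemma nu0_lipschitz {S : ℕ} (β D h p q p' q' : ℝ) (hq : 0 ≤ q) (hq' : 0 ≤ q') {n : ℕ}
    {f : (Fin n → ℝ) → ℝ} (hf : ∀ ε : Fin n → Spin S, |f (fun k => (ε k).toReal)| ≤ (S : ℝ) ^ 2) :
    |(Params.mk S β D h p' q').nu0 n f - (Params.mk S β D h p q).nu0 n f|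
      ≤ β ^ 2 * (S : ℝ) ^ 4 * tiltMass n * (|p' - p| + |q' - q|) := by
  set A : Bool → Spin S → ℝ := fun e a => if e then β * √q' * a.toReal else β * √q * a.toReal
    with hA
  set τ : Bool → SignType := fun e => if e then .pos else .neg with hτ
  set b₁ : Spin S → ℝ := fun a => β ^ 2 / 2 * ((p' - q') - (p - q)) * a.toReal ^ 2 with hb₁
  set b₀ : Spin S → ℝ := fun a => β ^ 2 / 2 * (p - q) * a.toReal ^ 2
    + D * a.toReal ^ 2 + h * a.toReal with hb₀
  set F : (Fin n → Spin S) → ℝ := fun ε => f (fun k => (ε k).toReal) with hF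
  have ends : ∀ (θ : ℝ) (e : Bool) (P : Params) (hP : P.S = S), (∀ g,
      pathHam A τ b₀ b₁ θ g = fun a => siteHam P (g e) (hP ▸ a)) →
      pathAvg A τ b₀ b₁ θ F = P.nu0 n f := by
    intro θ e P hP hg
    subst hP
    rw [nu0_eq]
    unfold pathAvg
    have mp := measurePreserving_eval (fun _ : Bool => gaussianReal 0 1) e
    have hc : Continuous fun z => replicaAvg (siteHam P z) F :=
      continuous_replicaAvg (continuous_siteHam P) _
    have := integral_map (μ := stdGauss Bool) mp.measurable.aemeasurable
      (f := fun z => replicaAvg (siteHam P z) F) hc.aestronglyMeasurable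
    rw [stdGauss, mp.map_eq] at this
    rw [this]
    simp only [hg]
    rfl
  have e0 : pathAvg A τ b₀ b₁ 0 F = (Params.mk S β D h p q).nu0 n f := by
    refine ends 0 false _ rfl fun g => ?_
    ext a
    simp [pathHam, siteHam, hA, hτ, hb₀, pathCoef]
    ring
  have e1 : pathAvg A τ b₀ b₁ (Real.pi / 2) F = (Params.mk S β D h p' q').nu0 n f := by
    refine ends (Real.pi / 2) true _ rfl fun g => ?_
    ext a
    simp [pathHam, siteHam, hA, hτ, hb₀, hb₁, pathCoef]
    ring
  have hgen : ∀ x, |pathGen A τ b₁ F x| ≤ β ^ 2 * (S : ℝ) ^ 4 * tiltMass n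
      * (|p' - p| + |q' - q|) := by
    intro x
    have hx : pathGen A τ b₁ F x = F (fun k => x k.castSucc.castSucc) * ∑ k, ∑ l,
        tiltWeight₁ n k * tiltWeight₂ n l * (β ^ 2 / 2 * ((x k).toReal * (x l).toReal
          * if k = l then p' - p else q' - q)) := by
      unfold pathGen
      rw [tilt_eq_diag]
      simp only [tilt_tilt, Fintype.sum_bool]
      have h1 : ∑ k, tiltWeight₁ n k * tiltWeight₂ n k * b₁ (x k)
          = ∑ k, ∑ l, tiltWeight₁ n k * tiltWeight₂ n l * (if k = l then b₁ (x k) else 0) := by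
        refine Finset.sum_congr rfl fun k _ => ?_
        simp
      rw [h1, mul_left_comm, mul_left_comm ((τ false : ℝ) / 2), ← mul_add, ← mul_add]
      congr 1
      rw [Finset.mul_sum, Finset.mul_sum, ← Finset.sum_add_distrib, ← Finset.sum_add_distrib]
      refine Finset.sum_congr rfl fun k _ => ?_
      rw [Finset.mul_sum, Finset.mul_sum, ← Finset.sum_add_distrib, ← Finset.sum_add_distrib]
      refine Finset.sum_congr rfl fun l _ => ?_
      have s1 := Real.sq_sqrt hq
      have s2 := Real.sq_sqrt hq'
      simp only [hA, hτ, hb₁, if_true, Bool.false_eq_true, if_false, SignType.neg_eq_neg_one,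
        SignType.pos_eq_one, SignType.coe_neg, SignType.coe_one]
      by_cases hkl : k = l
      · subst hkl
        simp only [if_true]
        linear_combination (tiltWeight₁ n k * tiltWeight₂ n k * β ^ 2 / 2 * (x k).toReal ^ 2) * s2
          - (tiltWeight₁ n k * tiltWeight₂ n k * β ^ 2 / 2 * (x k).toReal ^ 2) * s1
      · simp only [hkl, if_false]
        linear_combination (tiltWeight₁ n k * tiltWeight₂ n l * β ^ 2 / 2 * (x k).toReal
          * (x l).toReal) * s2 - (tiltWeight₁ n k * tiltWeight₂ n l * β ^ 2 / 2 * (x k).toReal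
          * (x l).toReal) * s1
    rw [hx, abs_mul]
    have hb : ∀ k l, |β ^ 2 / 2 * ((x k).toReal * (x l).toReal
          * if k = l then p' - p else q' - q)| ≤ β ^ 2 * ((S : ℝ) ^ 2 * (|p' - p| + |q' - q|)) := by
      intro k l
      rw [abs_mul, abs_mul, abs_of_nonneg (by positivity : 0 ≤ β ^ 2 / 2)]
      refine mul_le_mul (by linarith [sq_nonneg β]) (mul_le_mul (Spin.abs_mul_le _ _) ?_
        (abs_nonneg _) (by positivity)) (by positivity) (by positivity)
      split_ifs
      · linarith [abs_nonneg (q' - q)]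
      · linarith [abs_nonneg (p' - p)]
    refine (mul_le_mul (hf _) (abs_sum_tiltWeight_le hb) (abs_nonneg _) (by positivity)).trans_eq ?_
    ring
  have := abs_sub_sub_le_of_hasDerivAt (c := 0) (fun θ => hasDerivAt_pathAvg A τ b₀ b₁ F θ)
    (K := β ^ 2 * (S : ℝ) ^ 4 * tiltMass n * (|p' - p| + |q' - q|)) (fun θ _ => by
      rw [sub_zero]
      have := norm_integral_le_of_norm_le_const (μ := stdGauss Bool)
        (f := fun g => replicaAvg (pathHam A τ b₀ b₁ θ g) (pathGen A τ b₁ F))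
        (Filter.Eventually.of_forall fun z => abs_replicaAvg_le_of_le _ hgen)
      unfold pathAvg
      simpa using this) (t := Real.pi / 2) ⟨by positivity, le_rfl⟩
  rw [e0, e1, zero_mul, sub_zero] at this
  exact this

lemma isFixedPoint_q_nonneg {P : Params} (hP : P.IsFixedPoint) : 0 ≤ P.q :=
  hP.2 ▸ nu0_overlap_nonneg P

lemma isFixedPoint_abs_p_le {P : Params} (hP : P.IsFixedPoint) : |P.p| ≤ (P.S : ℝ) ^ 2 := by
  rw [hP.1]
  exact abs_nu0_le P 1 fun ε => by simpa [sq] using Spin.abs_mul_le (ε 0) (ε 0)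

lemma isFixedPoint_abs_q_le {P : Params} (hP : P.IsFixedPoint) : |P.q| ≤ (P.S : ℝ) ^ 2 := by
  rw [hP.2]
  exact abs_nu0_le P 2 fun ε => Spin.abs_mul_le (ε 0) (ε 1)

/-- For small `β` the right-hand sides of the replica-symmetric equations are a contraction of
`(p, q)`, uniformly in `D` and `h`. -/
theorem existsUnique_isFixedPoint {S : ℕ} {β : ℝ} (D h : ℝ)
    (hβ : β ^ 2 * ((S : ℝ) ^ 4 * (tiltMass 1 + tiltMass 2)) ≤ 1 / 4) :
    ∃! pq : ℝ × ℝ, (Params.mk S β D h pq.1 pq.2).IsFixedPoint := by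
  -- negative values of `q` are cut off: a fixed point of `T` has `q ≥ 0`
  set T : ℝ × ℝ → ℝ × ℝ := fun u =>
    ((Params.mk S β D h u.1 (max u.2 0)).nu0 1 (fun ε => ε 0 ^ 2),
      (Params.mk S β D h u.1 (max u.2 0)).nu0 2 (fun ε => ε 0 * ε 1)) with hT
  have hlip : ∀ (n : ℕ) (f : (Fin n → ℝ) → ℝ), tiltMass n ≤ tiltMass 1 + tiltMass 2 →
      (∀ ε : Fin n → Spin S, |f (fun k => (ε k).toReal)| ≤ (S : ℝ) ^ 2) → ∀ u v : ℝ × ℝ,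
      |(Params.mk S β D h u.1 (max u.2 0)).nu0 n f - (Params.mk S β D h v.1 (max v.2 0)).nu0 n f|
        ≤ 1 / 2 * dist u v := by
    intro n f hn hf u v
    refine (nu0_lipschitz β D h v.1 (max v.2 0) u.1 (max u.2 0) (le_max_right _ _)
      (le_max_right _ _) hf).trans ?_
    have h1 : |u.1 - v.1| ≤ dist u v := by
      rw [Prod.dist_eq, ← Real.dist_eq]; exact le_max_left _ _
    have h2 : |max u.2 0 - max v.2 0| ≤ dist u v := by
      refine (abs_max_sub_max_le_abs _ _ _).trans ?_
      rw [Prod.dist_eq, ← Real.dist_eq]; exact le_max_right _ _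
    have h3 : β ^ 2 * (S : ℝ) ^ 4 * tiltMass n ≤ 1 / 4 := by
      refine le_trans ?_ hβ
      rw [mul_assoc]
      gcongr
    calc _ ≤ 1 / 4 * (dist u v + dist u v) := by
          refine mul_le_mul h3 (add_le_add h1 h2) (by positivity) (by norm_num)
      _ = 1 / 2 * dist u v := by ring
  have hc : ContractingWith (1 / 2) T := by
    refine ⟨by rw [← NNReal.coe_lt_coe]; norm_num, LipschitzWith.of_dist_le_mul fun u v => ?_⟩
    have h1 := hlip 1 (fun ε => ε 0 ^ 2) (by linarith [tiltMass_nonneg 2])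
      (fun ε => by simpa [sq] using Spin.abs_mul_le (ε 0) (ε 0)) u v
    have h2 := hlip 2 (fun ε => ε 0 * ε 1) (by linarith [tiltMass_nonneg 1])
      (fun ε => Spin.abs_mul_le (ε 0) (ε 1)) u v
    rw [← Real.dist_eq] at h1 h2
    have : ((1 / 2 : NNReal) : ℝ) = 1 / 2 := by norm_num
    rw [Prod.dist_eq, this]
    exact max_le h1 h2
  have hfix : ∀ u : ℝ × ℝ, (Params.mk S β D h u.1 u.2).IsFixedPoint ↔ Function.IsFixedPt T u := by
    intro u
    constructor
    · intro hu
      have hq := isFixedPoint_q_nonneg hu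
      have : max u.2 0 = u.2 := max_eq_left hq
      refine Prod.ext ?_ ?_
      · simp only [hT, this]; exact hu.1.symm
      · simp only [hT, this]; exact hu.2.symm
    · intro hu
      have h1 : (T u).1 = u.1 := congrArg Prod.fst hu
      have h2 : (T u).2 = u.2 := congrArg Prod.snd hu
      have hq : 0 ≤ u.2 := by rw [← h2]; exact nu0_overlap_nonneg _
      have : max u.2 0 = u.2 := max_eq_left hq
      simp only [hT, this] at h1 h2
      exact ⟨h1.symm, h2.symm⟩
  refine ⟨hc.fixedPoint, (hfix _).2 hc.fixedPoint_isFixedPt, fun u hu => ?_⟩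
  exact hc.fixedPoint_unique ((hfix u).1 hu)

/-! ### Elementary properties of the averages -/

section PathAvgBasic

variable {X ι : Type*} [Fintype ι] [Fintype X] [Nonempty X] {n : ℕ}
  (A : ι → X → ℝ) (τ : ι → SignType) (b₀ b₁ : X → ℝ) (θ : ℝ)

lemma pathAvg_const (c : ℝ) : pathAvg A τ b₀ b₁ θ (fun _ : Fin n → X => c) = c := by
  simp [pathAvg, replicaAvg_const]

lemma pathAvg_add (f g : (Fin n → X) → ℝ) :
    pathAvg A τ b₀ b₁ θ (fun x => f x + g x) = pathAvg A τ b₀ b₁ θ f + pathAvg A τ b₀ b₁ θ g := by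
  unfold pathAvg
  simp only [replicaAvg_add]
  exact integral_add (integrable_replicaAvg (continuous_pathHam A τ b₀ b₁ θ) f)
    (integrable_replicaAvg (continuous_pathHam A τ b₀ b₁ θ) g)

omit [Nonempty X] in
lemma pathAvg_const_mul (c : ℝ) (f : (Fin n → X) → ℝ) :
    pathAvg A τ b₀ b₁ θ (fun x => c * f x) = c * pathAvg A τ b₀ b₁ θ f := by
  unfold pathAvg
  simp only [replicaAvg_const_mul]
  exact integral_const_mul _ _

lemma pathAvg_sum {α : Type*} (s : Finset α) (f : α → (Fin n → X) → ℝ) :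
    pathAvg A τ b₀ b₁ θ (fun x => ∑ a ∈ s, f a x) = ∑ a ∈ s, pathAvg A τ b₀ b₁ θ (f a) := by
  unfold pathAvg
  simp only [replicaAvg_sum]
  exact integral_finsetSum _ fun a _ =>
    integrable_replicaAvg (continuous_pathHam A τ b₀ b₁ θ) (f a)

lemma pathAvg_mono {f g : (Fin n → X) → ℝ} (h : ∀ x, f x ≤ g x) :
    pathAvg A τ b₀ b₁ θ f ≤ pathAvg A τ b₀ b₁ θ g :=
  integral_mono (integrable_replicaAvg (continuous_pathHam A τ b₀ b₁ θ) f)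
    (integrable_replicaAvg (continuous_pathHam A τ b₀ b₁ θ) g) fun _ => replicaAvg_mono _ h

lemma pathAvg_sub (f g : (Fin n → X) → ℝ) :
    pathAvg A τ b₀ b₁ θ (fun x => f x - g x) = pathAvg A τ b₀ b₁ θ f - pathAvg A τ b₀ b₁ θ g := by
  have := pathAvg_add A τ b₀ b₁ θ (fun x => f x - g x) g
  simp only [sub_add_cancel] at this
  linarith

lemma abs_pathAvg_le_of_le {f g : (Fin n → X) → ℝ} (h : ∀ x, |f x| ≤ g x) :
    |pathAvg A τ b₀ b₁ θ f| ≤ pathAvg A τ b₀ b₁ θ g := by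
  rw [abs_le]
  constructor
  · have := pathAvg_mono A τ b₀ b₁ θ (f := fun x => (-1) * g x) (g := f)
      fun x => by linarith [(abs_le.1 (h x)).1]
    rw [pathAvg_const_mul] at this
    linarith
  · exact pathAvg_mono A τ b₀ b₁ θ fun x => (abs_le.1 (h x)).2

lemma pathAvg_comp_injective {m : ℕ} {i : Fin m → Fin n} (hi : Function.Injective i)
    (f : (Fin m → X) → ℝ) :
    pathAvg A τ b₀ b₁ θ (fun x : Fin n → X => f (x ∘ i)) = pathAvg A τ b₀ b₁ θ f := by
  unfold pathAvg
  refine integral_congr_ae (Filter.Eventually.of_forall fun g => ?_)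
  exact replicaAvg_comp_injective _ hi f

end PathAvgBasic

section NuBasic

variable {N S n : ℕ} (β D h : ℝ)

lemma nu_eq_pathAvg (f : (Fin n → Config N S) → ℝ) :
    nu β D h f = pathAvg (fun (e : Bond N) (σ : Config N S) =>
        β / √(N : ℝ) * ((σ e.1.1).toReal * (σ e.1.2).toReal)) (fun _ => 0)
      (fun σ => D * ∑ i, (σ i).toReal ^ 2 + h * ∑ i, (σ i).toReal) (fun _ => 0) 0 f := by
  unfold nu pathAvg
  refine integral_congr_ae (Filter.Eventually.of_forall fun g => ?_)
  have : pathHam (fun (e : Bond N) (σ : Config N S) =>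
        β / √(N : ℝ) * ((σ e.1.1).toReal * (σ e.1.2).toReal)) (fun _ => 0)
      (fun σ => D * ∑ i, (σ i).toReal ^ 2 + h * ∑ i, (σ i).toReal) (fun _ => 0) 0 g
      = hamiltonian β D h g := by
    ext σ
    simp only [pathHam, hamiltonian, Finset.mul_sum]
    rw [mul_zero, add_zero, ← add_assoc]
    congr 2
    refine Finset.sum_congr rfl fun e _ => ?_
    change 1 * _ * _ = _
    ring
  dsimp only
  rw [this]
  rfl

lemma nu_const (c : ℝ) : nu β D h (fun _ : Fin n → Config N S => c) = c := by
  rw [nu_eq_pathAvg, pathAvg_const]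

lemma nu_add (f g : (Fin n → Config N S) → ℝ) :
    nu β D h (fun x => f x + g x) = nu β D h f + nu β D h g := by
  simp only [nu_eq_pathAvg, pathAvg_add]

lemma nu_sub (f g : (Fin n → Config N S) → ℝ) :
    nu β D h (fun x => f x - g x) = nu β D h f - nu β D h g := by
  simp only [nu_eq_pathAvg, pathAvg_sub]

lemma nu_const_mul (c : ℝ) (f : (Fin n → Config N S) → ℝ) :
    nu β D h (fun x => c * f x) = c * nu β D h f := by
  simp only [nu_eq_pathAvg, pathAvg_const_mul]

lemma nu_sum {α : Type*} (s : Finset α) (f : α → (Fin n → Config N S) → ℝ) :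
    nu β D h (fun x => ∑ a ∈ s, f a x) = ∑ a ∈ s, nu β D h (f a) := by
  simp only [nu_eq_pathAvg, pathAvg_sum]

lemma nu_mono {f g : (Fin n → Config N S) → ℝ} (hfg : ∀ x, f x ≤ g x) :
    nu β D h f ≤ nu β D h g := by
  simp only [nu_eq_pathAvg]; exact pathAvg_mono _ _ _ _ _ hfg

lemma nu_nonneg {f : (Fin n → Config N S) → ℝ} (hf : ∀ x, 0 ≤ f x) : 0 ≤ nu β D h f := by
  rw [← nu_const (N := N) (S := S) (n := n) β D h 0]
  exact nu_mono β D h hf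

lemma abs_nu_le_of_le {f g : (Fin n → Config N S) → ℝ} (hfg : ∀ x, |f x| ≤ g x) :
    |nu β D h f| ≤ nu β D h g := by
  simp only [nu_eq_pathAvg]; exact abs_pathAvg_le_of_le _ _ _ _ _ hfg

lemma nu_comp_injective {m : ℕ} {i : Fin m → Fin n} (hi : Function.Injective i)
    (f : (Fin m → Config N S) → ℝ) :
    nu β D h (fun x : Fin n → Config N S => f (x ∘ i)) = nu β D h f := by
  simp only [nu_eq_pathAvg]; exact pathAvg_comp_injective _ _ _ _ _ hi f

end NuBasic

/-! ### Smallness of `β` -/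

/-- The bound on `β` in terms of the largest spin: the cavity estimates need
`β ^ 2 * smallConst S ≤ 1 / 4`. The summands serve, in this order, the bound `β ≤ 1`, the
contraction property of the replica-symmetric equations, the positivity of `M₁`, `M₂`, `M₃`, and
the bound for the moments of the overlaps. -/
def smallConst (S : ℕ) : ℝ :=
  1 + (S : ℝ) ^ 4 * (tiltMass 1 + tiltMass 2) + 16 * (S : ℝ) ^ 4
    + 128 * (S : ℝ) ^ 4 * tiltMass 2 * Real.exp (2 * (S : ℝ) ^ 4 * tiltMass 4)

/-- The high-temperature regime, with a solution of the replica-symmetric equations. -/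
structure Params.Admissible (P : Params) : Prop where
  one_le_S : 1 ≤ P.S
  small : P.β ^ 2 * smallConst P.S ≤ 1 / 4
  fix : P.IsFixedPoint

namespace Params.Admissible

variable {P : Params} (hP : P.Admissible)
include hP

lemma one_le_S' : (1 : ℝ) ≤ P.S := by exact_mod_cast hP.one_le_S

lemma q_nonneg : 0 ≤ P.q := isFixedPoint_q_nonneg hP.fix

lemma small_of_le {c : ℝ} (hc : c ≤ smallConst P.S) : P.β ^ 2 * c ≤ 1 / 4 :=
  (mul_le_mul_of_nonneg_left hc (sq_nonneg _)).trans hP.small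

lemma sq_beta_le_one : P.β ^ 2 ≤ 1 := by
  have := hP.small_of_le (c := 1) (by
    unfold smallConst
    have := tiltMass_nonneg 1
    have := tiltMass_nonneg 2
    have h3 : 0 ≤ (P.S : ℝ) ^ 4 * (tiltMass 1 + tiltMass 2) := by positivity
    have h4 : 0 ≤ 128 * (P.S : ℝ) ^ 4 * tiltMass 2
      * Real.exp (2 * (P.S : ℝ) ^ 4 * tiltMass 4) := by positivity
    have h5 : 0 ≤ 16 * (P.S : ℝ) ^ 4 := by positivity
    linarith)
  linarith

end Params.Admissible

/-! ### Pointwise bounds -/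

section Bounds

variable {P : Params} {N n : ℕ}

lemma abs_overlap_le {S : ℕ} (σ τ : Config N S) : |overlap σ τ| ≤ (S : ℝ) ^ 2 := by
  unfold overlap
  rcases Nat.eq_zero_or_pos N with h | h
  · subst h; simp
  · have hN : (0 : ℝ) < N := by exact_mod_cast h
    rw [abs_div, abs_of_pos hN, div_le_iff₀ hN]
    refine (Finset.abs_sum_le_sum_abs _ _).trans
      ((Finset.sum_le_sum fun i _ => Spin.abs_mul_le (σ i) (τ i)).trans_eq ?_)
    simp [mul_comm]

/-- The limit of the overlap of the replicas `k`, `l`. -/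
def limOverlap (P : Params) (k l : Fin n) : ℝ := if k = l then P.p else P.q

lemma abs_limOverlap_le (hP : P.Admissible) (k l : Fin n) :
    |limOverlap P k l| ≤ (P.S : ℝ) ^ 2 := by
  unfold limOverlap
  split_ifs
  · exact isFixedPoint_abs_p_le hP.fix
  · exact isFixedPoint_abs_q_le hP.fix

lemma dev_eq (x : Fin n → Config N P.S) (k l : Fin n) :
    dev P x k l = overlap (x k) (x l) - limOverlap P k l := rfl

lemma abs_dev_le (hP : P.Admissible) (x : Fin n → Config N P.S) (k l : Fin n) :
    |dev P x k l| ≤ 2 * (P.S : ℝ) ^ 2 := by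
  rw [dev_eq]
  refine (abs_sub _ _).trans ?_
  linarith [abs_overlap_le (x k) (x l), abs_limOverlap_le hP k l]

lemma abs_cavityDev_sub_dev_le (i : Fin N) (x : Fin n → Config N P.S) (k l : Fin n) :
    |cavityDev P i x k l - dev P x k l| ≤ (P.S : ℝ) ^ 2 * (1 / N) := by
  unfold cavityDev
  rw [sub_sub_cancel_left, abs_neg, abs_div, Nat.abs_cast, mul_one_div]
  gcongr
  exact Spin.abs_mul_le _ _

lemma one_div_card_le_one (i : Fin N) : (1 : ℝ) / N ≤ 1 := by
  have : (1 : ℝ) ≤ N := by exact_mod_cast i.pos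
  rw [div_le_one (by linarith)]; exact this

lemma abs_cavityDev_le (hP : P.Admissible) (i : Fin N) (x : Fin n → Config N P.S) (k l : Fin n) :
    |cavityDev P i x k l| ≤ 3 * (P.S : ℝ) ^ 2 := by
  have h1 := abs_cavityDev_sub_dev_le i x k l
  have h2 := abs_dev_le hP x k l
  have h3 : (P.S : ℝ) ^ 2 * (1 / N) ≤ (P.S : ℝ) ^ 2 :=
    mul_le_of_le_one_right (by positivity) (one_div_card_le_one i)
  rw [abs_le] at *
  constructor <;> linarith [h1.1, h1.2, h2.1, h2.2]

lemma freeOfSite_cavityDev (i : Fin N) (k l : Fin n) :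
    FreeOfSite i (fun x : Fin n → Config N P.S => cavityDev P i x k l) := by
  intro x ε
  have hN : (N : ℝ) ≠ 0 := by exact_mod_cast i.pos.ne'
  have : ∀ y : Fin n → Config N P.S, cavityDev P i y k l
      = (∑ j ∈ Finset.univ.erase i, (y k j).toReal * (y l j).toReal) / N - limOverlap P k l := by
    intro y
    unfold cavityDev
    rw [dev_eq, overlap, ← Finset.sum_erase_add _ _ (Finset.mem_univ i)]
    field_simp
    ring
  change cavityDev P i (setSite i x ε) k l = cavityDev P i x k l
  rw [this, this]
  congr 2
  refine Finset.sum_congr rfl fun j hj => ?_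
  simp only [setSite, Function.update_of_ne (Finset.ne_of_mem_erase hj)]

lemma abs_cavityGen_le (i : Fin N) {f : (Fin n → Config N P.S) → ℝ}
    (x : Fin (n + 2) → Config N P.S) {C : ℝ} (hC : ∀ k l, |cavityDev P i x k l| ≤ C) :
    |cavityGen P i f x| ≤ P.β ^ 2 / 2 * (|f (fun k => x k.castSucc.castSucc)|
      * (tiltMass n * ((P.S : ℝ) ^ 2 * C))) := by
  unfold cavityGen
  rw [abs_mul, abs_mul, abs_of_nonneg (by positivity : 0 ≤ P.β ^ 2 / 2)]
  gcongr
  refine abs_sum_tiltWeight_le fun k l => ?_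
  rw [abs_mul]
  exact mul_le_mul (Spin.abs_mul_le _ _) (hC k l) (abs_nonneg _) (by positivity)

end Bounds

/-! ### Comparison of the averages along the cavity path -/

section Gronwall

variable {P : Params} {N n : ℕ}

/-- The constant in the comparison of the averages along the cavity path. -/
def pathConst (S n : ℕ) : ℝ := Real.exp (2 * (S : ℝ) ^ 4 * tiltMass n)

lemma pathConst_pos (S n : ℕ) : 0 < pathConst S n := Real.exp_pos _

lemma cavityAvg_castSucc (i : Fin N) (θ : ℝ) (f : (Fin n → Config N P.S) → ℝ) :
    cavityAvg P i θ (fun x : Fin (n + 2) → Config N P.S => f (fun k => x k.castSucc.castSucc))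
      = cavityAvg P i θ f :=
  pathAvg_comp_injective _ _ _ _ _ (i := fun k : Fin n => k.castSucc.castSucc)
    ((Fin.castSucc_injective _).comp (Fin.castSucc_injective _)) f

lemma cavityAvg_nonneg (i : Fin N) (θ : ℝ) {f : (Fin n → Config N P.S) → ℝ} (hf : ∀ x, 0 ≤ f x) :
    0 ≤ cavityAvg P i θ f := by
  have := pathAvg_mono (cavityCoef P i) (cavityType i) (cavityBase P i) (cavityIncr P i) θ hf
  rwa [pathAvg_const] at this

/-- The averages of a nonnegative function along the path are controlled by `nu`, uniformly in
the size of the system (Gronwall). -/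
lemma cavityAvg_le_nu (hP : P.Admissible) (i : Fin N) {f : (Fin n → Config N P.S) → ℝ}
    (hf : ∀ x, 0 ≤ f x) {θ : ℝ} (hθ : θ ∈ Set.Icc 0 (Real.pi / 2)) :
    cavityAvg P i θ f ≤ pathConst P.S n * nu P.β P.D P.h f := by
  set C : ℝ := 2 * (P.S : ℝ) ^ 4 * tiltMass n with hC
  have hC0 : 0 ≤ C := by have := tiltMass_nonneg n; positivity
  have hgen : ∀ t, |cavityAvg P i t (cavityGen P i f)| ≤ C * cavityAvg P i t f := by
    intro t
    rw [← cavityAvg_castSucc i t f]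
    refine (abs_pathAvg_le_of_le (g := fun x => C * f (fun k => x k.castSucc.castSucc))
      _ _ _ _ _ fun x => ?_).trans_eq (pathAvg_const_mul _ _ _ _ _ _ _)
    refine (abs_cavityGen_le i x (abs_cavityDev_le hP i x)).trans ?_
    rw [abs_of_nonneg (hf _), hC]
    have h1 := hP.sq_beta_le_one
    have h2 : 0 ≤ f (fun k => x k.castSucc.castSucc) * (tiltMass n * (P.S : ℝ) ^ 4) := by
      have := tiltMass_nonneg n
      have := hf (fun k => x k.castSucc.castSucc)
      positivity
    nlinarith
  have hd : ∀ t, HasDerivAt (fun r => Real.exp (C * Real.sin r ^ 2) * cavityAvg P i r f)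
      (2 * (Real.sin t * Real.cos t) * Real.exp (C * Real.sin t ^ 2)
        * (C * cavityAvg P i t f + cavityAvg P i t (cavityGen P i f))) t := by
    intro t
    have h1 := ((((Real.hasDerivAt_sin t).pow 2).const_mul C).exp).mul
      (hasDerivAt_cavityAvg P i hP.q_nonneg f t)
    refine h1.congr_deriv ?_
    simp
    ring
  have hpi := Real.pi_pos
  have hmono : MonotoneOn (fun r => Real.exp (C * Real.sin r ^ 2) * cavityAvg P i r f)
      (Set.Icc 0 (Real.pi / 2)) :=
    monotoneOn_of_deriv_nonneg (convex_Icc 0 (Real.pi / 2))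
      (fun t _ => (hd t).continuousAt.continuousWithinAt)
      (fun t _ => (hd t).differentiableAt.differentiableWithinAt)
      (fun t ht => by
        rw [(hd t).deriv]
        have h' := interior_subset ht
        have h1 : 0 ≤ Real.sin t * Real.cos t :=
          mul_nonneg (Real.sin_nonneg_of_nonneg_of_le_pi h'.1 (by linarith [h'.2]))
            (Real.cos_nonneg_of_neg_pi_div_two_le_of_le (by linarith [h'.1]) h'.2)
        have h2 := (abs_le.1 (hgen t)).1
        exact mul_nonneg (by positivity) (by linarith))
  have := hmono hθ ⟨by positivity, le_rfl⟩ hθ.2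
  simp only [Real.sin_pi_div_two, one_pow, mul_one, cavityAvg_pi_div_two] at this
  refine le_trans ?_ this
  refine le_mul_of_one_le_left (cavityAvg_nonneg i θ hf) ?_
  rw [Real.one_le_exp_iff]
  positivity

lemma abs_cavityAvg_le (hP : P.Admissible) (i : Fin N) {f g : (Fin n → Config N P.S) → ℝ}
    (hfg : ∀ x, |f x| ≤ g x) {θ : ℝ} (hθ : θ ∈ Set.Icc 0 (Real.pi / 2)) :
    |cavityAvg P i θ f| ≤ pathConst P.S n * nu P.β P.D P.h g :=
  (abs_pathAvg_le_of_le _ _ _ _ _ hfg).trans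
    (cavityAvg_le_nu hP i (fun x => (abs_nonneg _).trans (hfg x)) hθ)

end Gronwall

/-! ### Moments of the overlaps -/

section Moments

/-- Effect of the removal of one site on a power, in terms of a lower even power. -/
lemma abs_pow_sub_pow_le_even {a b δ c B : ℝ} {j m : ℕ} (hm : 2 * j + 1 ≤ m) (hc : 0 ≤ c)
    (hB : 1 ≤ B) (ha : |a| + c ≤ B) (hδ0 : 0 ≤ δ) (hδ1 : δ ≤ 1) (hab : |b - a| ≤ c * δ) :
    |b ^ m - a ^ m| ≤ (c * m * B ^ m * 4 ^ j * (1 + c) ^ (2 * j)) * (δ * (a ^ (2 * j) + δ ^ j)) := by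
  have hcδ : c * δ ≤ c := mul_le_of_le_one_right hc hδ1
  have hcδ0 : 0 ≤ c * δ := mul_nonneg hc hδ0
  set M := |a| + c * δ with hM
  have hM0 : 0 ≤ M := by positivity
  have hMB : M ≤ B := by linarith
  have hb : |b| ≤ M := by
    have := abs_add_le a (b - a)
    rw [add_sub_cancel] at this
    linarith
  have h1 := abs_pow_sub_pow_le b a m
  have h2 : max |b| |a| ≤ M := max_le hb (by linarith)
  have h3 : max |b| |a| ^ (m - 1) ≤ M ^ (m - 1) :=
    pow_le_pow_left₀ (le_max_of_le_left (abs_nonneg _)) h2 _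
  have h4 : M ^ (m - 1) ≤ B ^ m * M ^ (2 * j) := by
    obtain ⟨d, rfl⟩ := Nat.exists_eq_add_of_le hm
    have : 2 * j + 1 + d - 1 = d + 2 * j := by omega
    rw [this, pow_add]
    refine mul_le_mul_of_nonneg_right ?_ (by positivity)
    exact (pow_le_pow_left₀ hM0 hMB d).trans (pow_le_pow_right₀ hB (by omega))
  have h5 : M ^ (2 * j) ≤ 4 ^ j * (1 + c) ^ (2 * j) * (a ^ (2 * j) + δ ^ j) := by
    have e1 : M ^ 2 ≤ 4 * ((1 + c) ^ 2 * max (a ^ 2) δ) := by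
      have g1 : |a| ^ 2 ≤ max (a ^ 2) δ := by rw [sq_abs]; exact le_max_left _ _
      have g2 : (c * δ) ^ 2 ≤ c ^ 2 * max (a ^ 2) δ := by
        rw [mul_pow]
        refine mul_le_mul_of_nonneg_left ?_ (sq_nonneg _)
        refine le_trans ?_ (le_max_right _ _)
        nlinarith
      have g3 : 0 ≤ max (a ^ 2) δ := le_max_of_le_right hδ0
      have g4 : M ^ 2 ≤ 2 * (|a| ^ 2 + (c * δ) ^ 2) := by
        rw [hM]; nlinarith [sq_nonneg (|a| - c * δ)]
      have g5 : 0 ≤ c * max (a ^ 2) δ := mul_nonneg hc g3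
      have g6 : 0 ≤ c ^ 2 * max (a ^ 2) δ := mul_nonneg (sq_nonneg c) g3
      nlinarith
    have e2 : max (a ^ 2) δ ^ j ≤ a ^ (2 * j) + δ ^ j := by
      rw [pow_mul]
      rcases max_cases (a ^ 2) δ with h | h
      · rw [h.1]; linarith [pow_nonneg hδ0 j]
      · rw [h.1]; linarith [pow_nonneg (sq_nonneg a) j]
    calc M ^ (2 * j) = (M ^ 2) ^ j := pow_mul _ _ _
      _ ≤ (4 * ((1 + c) ^ 2 * max (a ^ 2) δ)) ^ j := pow_le_pow_left₀ (sq_nonneg _) e1 _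
      _ = 4 ^ j * (1 + c) ^ (2 * j) * max (a ^ 2) δ ^ j := by
          rw [mul_pow, mul_pow, ← pow_mul]; ring
      _ ≤ _ := mul_le_mul_of_nonneg_left e2 (by positivity)
  have hE : 0 ≤ a ^ (2 * j) + δ ^ j := by
    have : 0 ≤ a ^ (2 * j) := by rw [pow_mul]; positivity
    positivity
  calc |b ^ m - a ^ m| ≤ |b - a| * m * max |b| |a| ^ (m - 1) := h1
    _ ≤ (c * δ) * m * (B ^ m * (4 ^ j * (1 + c) ^ (2 * j) * (a ^ (2 * j) + δ ^ j))) := by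
        refine mul_le_mul (mul_le_mul_of_nonneg_right hab (Nat.cast_nonneg _)) ?_ (by positivity)
          (by positivity)
        exact h3.trans (h4.trans (mul_le_mul_of_nonneg_left h5 (by positivity)))
    _ = _ := by ring

variable {P : Params}

lemma dev_comp {N m n : ℕ} {i : Fin m → Fin n} (hi : Function.Injective i)
    (x : Fin n → Config N P.S) (k l : Fin m) : dev P (x ∘ i) k l = dev P x (i k) (i l) := by
  simp [dev, hi.eq_iff]

lemma cavityDev_comp {N m n : ℕ} {i : Fin m → Fin n} (hi : Function.Injective i) (a : Fin N)
    (x : Fin n → Config N P.S) (k l : Fin m) :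
    cavityDev P a (x ∘ i) k l = cavityDev P a x (i k) (i l) := by
  simp [cavityDev, dev_comp hi]

lemma castSucc_castSucc_injective (n : ℕ) :
    Function.Injective (fun k : Fin n => k.castSucc.castSucc) :=
  (Fin.castSucc_injective _).comp (Fin.castSucc_injective _)

/-- All overlaps of different replicas have the same law, and so do all self-overlaps. -/
lemma nu_dev_eq {N n : ℕ} (φ : ℝ → ℝ) (k l : Fin n) :
    nu P.β P.D P.h (fun x : Fin n → Config N P.S => φ (dev P x k l))
      = nu P.β P.D P.h (fun x : Fin 2 → Config N P.S => φ (dev P x 0 (if k = l then 0 else 1))) := by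
  by_cases h : k = l
  · subst h
    have e1 := nu_comp_injective (N := N) (S := P.S) P.β P.D P.h (i := fun _ : Fin 1 => k)
      (fun _ _ _ => Subsingleton.elim _ _) (fun x => φ (dev P x 0 0))
    have e2 := nu_comp_injective (N := N) (S := P.S) P.β P.D P.h (i := fun _ : Fin 1 => (0 : Fin 2))
      (fun _ _ _ => Subsingleton.elim _ _) (fun x => φ (dev P x 0 0))
    simp only [dev_comp (fun _ _ _ => Subsingleton.elim _ _)] at e1 e2
    simp only [if_true]
    exact e1.trans e2.symm
  · have hi : Function.Injective ![k, l] := by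
      intro a b hab
      fin_cases a <;> fin_cases b <;> simp_all [eq_comm]
    have e1 := nu_comp_injective (N := N) (S := P.S) P.β P.D P.h hi (fun x => φ (dev P x 0 1))
    simp only [h, if_false]
    rw [← e1]
    simp only [dev_comp hi]
    rfl

/-- The even moments of the centered overlap and self-overlap. -/
def devMoment (P : Params) (N j : ℕ) (l : Fin 2) : ℝ :=
  nu P.β P.D P.h (fun x : Fin 2 → Config N P.S => dev P x 0 l ^ (2 * j))

lemma devMoment_nonneg (P : Params) (N j : ℕ) (l : Fin 2) : 0 ≤ devMoment P N j l :=
  nu_nonneg _ _ _ fun x => by rw [pow_mul]; positivity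

lemma nu_dev_pow_le {N n : ℕ} (j : ℕ) (k l : Fin n) :
    nu P.β P.D P.h (fun x : Fin n → Config N P.S => dev P x k l ^ (2 * j))
      ≤ devMoment P N j 0 + devMoment P N j 1 := by
  rw [nu_dev_eq (fun y => y ^ (2 * j))]
  have h0 := devMoment_nonneg P N j 0
  have h1 := devMoment_nonneg P N j 1
  split_ifs
  · exact le_add_of_nonneg_right h1
  · exact le_add_of_nonneg_left h0

/-- An overlap as an average over the sites. -/
lemma dev_eq_sum {N n : ℕ} (hN : 1 ≤ N) (x : Fin n → Config N P.S) (k l : Fin n) :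
    dev P x k l = 1 / (N : ℝ) * ∑ i, ((x k i).toReal * (x l i).toReal - limOverlap P k l) := by
  have : (N : ℝ) ≠ 0 := by exact_mod_cast (by omega : N ≠ 0)
  rw [dev_eq, overlap, Finset.sum_sub_distrib]
  simp
  field_simp

lemma nu_dev_mul {N n : ℕ} (hN : 1 ≤ N) (k l : Fin n) (W : (Fin n → Config N P.S) → ℝ) :
    nu P.β P.D P.h (fun x => dev P x k l * W x)
      = 1 / (N : ℝ) * ∑ i, nu P.β P.D P.h (fun x =>
        ((x k i).toReal * (x l i).toReal - limOverlap P k l) * W x) := by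
  rw [← nu_sum, ← nu_const_mul]
  congr 1
  ext x
  rw [dev_eq_sum hN, mul_assoc, Finset.sum_mul]

lemma abs_average_le {N : ℕ} (hN : 1 ≤ N) {a : Fin N → ℝ} {C : ℝ} (ha : ∀ i, |a i| ≤ C) :
    |1 / (N : ℝ) * ∑ i, a i| ≤ C := by
  have hN' : (0 : ℝ) < N := by exact_mod_cast hN
  rw [abs_mul, abs_of_pos (by positivity), one_div, inv_mul_le_iff₀ hN']
  refine (Finset.abs_sum_le_sum_abs _ _).trans ((Finset.sum_le_sum fun i _ => ha i).trans_eq ?_)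
  simp

lemma nu0_site (hP : P.Admissible) {n : ℕ} (k l : Fin n) :
    P.nu0 n (fun ε => ε k * ε l - limOverlap P k l) = 0 := by
  have hs : ∀ c, P.nu0 n (fun ε => ε k * ε l - c) = P.nu0 n (fun ε => ε k * ε l) - c := by
    intro c
    simp only [nu0_eq]
    have h := integrable_replicaAvg (μ := gaussianReal 0 1) (continuous_siteHam P)
      (fun ε : Fin n → Spin P.S => (ε k).toReal * (ε l).toReal)
    have e : ∀ z, replicaAvg (siteHam P z)
        (fun ε : Fin n → Spin P.S => (ε k).toReal * (ε l).toReal - c)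
        = replicaAvg (siteHam P z) (fun ε : Fin n → Spin P.S => (ε k).toReal * (ε l).toReal)
          - c := by
      intro z
      have := replicaAvg_add (siteHam P z)
        (fun ε : Fin n → Spin P.S => (ε k).toReal * (ε l).toReal - c) (fun _ => c)
      simp only [sub_add_cancel, replicaAvg_const] at this
      linarith
    simp only [e]
    rw [integral_sub h (integrable_const _)]
    simp
  rw [hs]
  unfold limOverlap
  split_ifs with h
  · subst h
    have := nu0_comp_injective P (i := fun _ : Fin 1 => k)
      (fun _ _ _ => Subsingleton.elim _ _) (fun ε => ε 0 ^ 2)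
    simp only [sq] at this
    rw [this, hP.fix.1]
    simp [sq]
  · have hi : Function.Injective ![k, l] := by
      intro a b hab
      fin_cases a <;> fin_cases b <;> simp_all [eq_comm]
    have := nu0_comp_injective P hi (fun ε => ε 0 * ε 1)
    simp only [Matrix.cons_val_zero, Matrix.cons_val_one] at this
    rw [this, ← hP.fix.2, sub_self]

lemma abs_site_le (hP : P.Admissible) {N n : ℕ} (i : Fin N) (k l : Fin n)
    (x : Fin n → Config N P.S) :
    |(x k i).toReal * (x l i).toReal - limOverlap P k l| ≤ 2 * (P.S : ℝ) ^ 2 := by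
  refine (abs_sub _ _).trans ?_
  linarith [Spin.abs_mul_le (x k i) (x l i), abs_limOverlap_le hP k l]

lemma FreeOfSite.pow {N n : ℕ} {i : Fin N} {f : (Fin n → Config N P.S) → ℝ} (hf : FreeOfSite i f)
    (m : ℕ) : FreeOfSite i (fun x => f x ^ m) := fun x ε => by
  change f _ ^ m = f x ^ m
  rw [hf]

/-- The first-order cavity expansion of a function that is centered at the start of the path. -/
lemma abs_nu_site_le (hP : P.Admissible) {N n : ℕ} (i : Fin N) (k l : Fin n)
    {f : (Fin n → Config N P.S) → ℝ} (hf : FreeOfSite i f) {K : ℝ}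
    (hK : ∀ θ ∈ Set.Icc 0 (Real.pi / 2), |cavityAvg P i θ (cavityGen P i (fun x =>
      ((x k i).toReal * (x l i).toReal - limOverlap P k l) * f x))| ≤ K) :
    |nu P.β P.D P.h (fun x =>
      ((x k i).toReal * (x l i).toReal - limOverlap P k l) * f x)| ≤ K := by
  have h1 := abs_sub_sub_le_of_hasDerivAt (c := 0) (K := K)
    (fun θ => hasDerivAt_cavityAvg P i hP.q_nonneg (fun x =>
      ((x k i).toReal * (x l i).toReal - limOverlap P k l) * f x) θ)
    (fun θ hθ => by rw [sub_zero]; exact hK θ hθ) (t := Real.pi / 2)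
    ⟨by positivity, le_rfl⟩
  have h2 := cavityAvg_zero_mul P i (fun ε => ε k * ε l - limOverlap P k l) hf
  rw [nu0_site hP, zero_mul] at h2
  rw [cavityAvg_pi_div_two, h2] at h1
  simpa using h1

lemma abs_cavityGen_site_le (hP : P.Admissible) {N n : ℕ} (i : Fin N) (k l : Fin n)
    {f : (Fin n → Config N P.S) → ℝ} (x : Fin (n + 2) → Config N P.S) {C : ℝ}
    (hC : ∀ a b, |f (fun k => x k.castSucc.castSucc) * cavityDev P i x a b| ≤ C) :
    |cavityGen P i (fun x => ((x k i).toReal * (x l i).toReal - limOverlap P k l) * f x) x|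
      ≤ P.β ^ 2 * (P.S : ℝ) ^ 4 * tiltMass n * C := by
  set y := f (fun k => x k.castSucc.castSucc) with hy
  set ψ : ℝ := ((x k.castSucc.castSucc i).toReal * (x l.castSucc.castSucc i).toReal
    - limOverlap P k l) with hψ
  have hψb : |ψ| ≤ 2 * (P.S : ℝ) ^ 2 := abs_site_le hP i k l (fun k => x k.castSucc.castSucc)
  have e5 : cavityGen P i (fun x => ((x k i).toReal * (x l i).toReal - limOverlap P k l) * f x) x
      = P.β ^ 2 / 2 * (ψ * ∑ a, ∑ b, tiltWeight₁ n a * tiltWeight₂ n b *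
        ((x a i).toReal * (x b i).toReal * (y * cavityDev P i x a b))) := by
    unfold cavityGen
    congr 1
    rw [mul_assoc]
    congr 1
    rw [Finset.mul_sum]
    refine Finset.sum_congr rfl fun a _ => ?_
    rw [Finset.mul_sum]
    refine Finset.sum_congr rfl fun b _ => ?_
    ring
  rw [e5, abs_mul, abs_mul, abs_of_nonneg (by positivity : 0 ≤ P.β ^ 2 / 2)]
  have h6 := abs_sum_tiltWeight_le (n := n) (C := (P.S : ℝ) ^ 2 * C)
    (v := fun a b => (x a i).toReal * (x b i).toReal * (y * cavityDev P i x a b)) fun a b => by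
      rw [abs_mul]
      exact mul_le_mul (Spin.abs_mul_le _ _) (hC a b) (abs_nonneg _) (by positivity)
  have h7 := mul_le_mul_of_nonneg_left (mul_le_mul hψb h6 (abs_nonneg _) (by positivity))
    (by positivity : 0 ≤ P.β ^ 2 / 2)
  refine h7.trans_eq ?_
  ring

/-- One factor of the moment of order `2 * j + 2` is written as an average over the sites. At the
start of the cavity path at a site, the contribution of this site has mean zero, and the derivative
along the path is a small multiple of a moment of the same order; removing the site from the other
factors costs a factor `1 / N` and two orders of the moment. The small multiple is absorbed into
the left-hand side. -/
lemma devMoment_succ_le (hP : P.Admissible) (j : ℕ) : ∃ K : ℝ, 0 ≤ K ∧ ∀ N : ℕ, 1 ≤ N →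
    devMoment P N (j + 1) 0 + devMoment P N (j + 1) 1
      ≤ K * (1 / N * (devMoment P N j 0 + devMoment P N j 1 + (1 / N) ^ j)) := by
  set s : ℝ := (P.S : ℝ) with hs
  have hs1 : 1 ≤ s := hP.one_le_S'
  have hs2 : 1 ≤ s ^ 2 := one_le_pow₀ hs1
  set B : ℝ := 3 * s ^ 2 with hB
  set κ : ℕ → ℝ := fun m => s ^ 2 * m * B ^ m * 4 ^ j * (1 + s ^ 2) ^ (2 * j) with hκ
  have hκ0 : ∀ m, 0 ≤ κ m := fun m => by simp only [hκ, hB]; positivity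
  set T : ℝ := tiltMass 2 with hT
  have hT0 : 0 ≤ T := tiltMass_nonneg 2
  set G : ℝ := 2 * P.β ^ 2 * s ^ 4 * T * pathConst P.S 4 with hG
  have hG0 : 0 ≤ G := by have := pathConst_pos P.S 4; positivity
  -- `32 = 2 * 16`: two kinds of overlaps, and a sum over the pairs of `2 + 2` replicas
  have hGs : 32 * G ≤ 1 / 2 := by
    have := hP.small_of_le (c := 128 * s ^ 4 * T * pathConst P.S 4) (by
      unfold smallConst
      have := tiltMass_nonneg 1
      have h3 : 0 ≤ s ^ 4 * (tiltMass 1 + T) := by positivity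
      have h5 : 0 ≤ 16 * s ^ 4 := by positivity
      rw [← hs, ← hT]
      unfold pathConst
      rw [← hs]
      linarith)
    rw [hG]; linarith
  refine ⟨2 * (4 * s ^ 2 * κ (2 * j + 1) + 32 * G * κ (2 * j + 2)), by
    have := hκ0 (2 * j + 1); have := hκ0 (2 * j + 2); positivity, fun N hN => ?_⟩
  set δ : ℝ := 1 / (N : ℝ) with hδ
  have hδ0 : 0 ≤ δ := by positivity
  have hδ1 : δ ≤ 1 := by
    have : (1 : ℝ) ≤ N := by exact_mod_cast hN
    rw [hδ, div_le_one (by linarith)]; exact this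
  set U : ℝ := devMoment P N j 0 + devMoment P N j 1 with hU
  set U' : ℝ := devMoment P N (j + 1) 0 + devMoment P N (j + 1) 1 with hU'
  have hpow : ∀ {n : ℕ} (i : Fin N) (x : Fin n → Config N P.S) (k l : Fin n) {m : ℕ},
      2 * j + 1 ≤ m → |cavityDev P i x k l ^ m - dev P x k l ^ m|
        ≤ κ m * (δ * (dev P x k l ^ (2 * j) + δ ^ j)) := by
    intro n i x k l m hm
    refine abs_pow_sub_pow_le_even hm (by positivity) (by rw [hB]; linarith) ?_ hδ0 hδ1
      (abs_cavityDev_sub_dev_le i x k l)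
    have := abs_dev_le hP x k l
    rw [hB]; linarith
  have hnuE : ∀ {n : ℕ} (k l : Fin n), nu P.β P.D P.h (fun x : Fin n → Config N P.S =>
      δ * (dev P x k l ^ (2 * j) + δ ^ j)) ≤ δ * (U + δ ^ j) := by
    intro n k l
    rw [nu_const_mul, nu_add, nu_const]
    exact mul_le_mul_of_nonneg_left (by linarith [nu_dev_pow_le (P := P) (N := N) j k l]) hδ0
  have hnuC : ∀ (i : Fin N) (a b : Fin 4), nu P.β P.D P.h (fun x : Fin 4 → Config N P.S =>
      cavityDev P i x a b ^ (2 * j + 2)) ≤ U' + κ (2 * j + 2) * (δ * (U + δ ^ j)) := by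
    intro i a b
    have h1 := nu_mono (N := N) (S := P.S) P.β P.D P.h (n := 4)
      (f := fun x => cavityDev P i x a b ^ (2 * j + 2))
      (g := fun x => dev P x a b ^ (2 * (j + 1))
        + κ (2 * j + 2) * (δ * (dev P x a b ^ (2 * j) + δ ^ j))) fun x => by
      have := (abs_le.1 (hpow i x a b (m := 2 * j + 2) (by omega))).2
      have e6 : 2 * (j + 1) = 2 * j + 2 := by ring
      rw [e6]; linarith
    rw [nu_add, nu_const_mul (c := κ (2 * j + 2))] at h1
    have h2 := nu_dev_pow_le (P := P) (N := N) (j + 1) a b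
    have h3 := mul_le_mul_of_nonneg_left (hnuE a b) (hκ0 (2 * j + 2))
    linarith
  -- the bound for one overlap
  have main : ∀ l : Fin 2, devMoment P N (j + 1) l
      ≤ 2 * s ^ 2 * κ (2 * j + 1) * (δ * (U + δ ^ j))
        + 16 * G * (U' + κ (2 * j + 2) * (δ * (U + δ ^ j))) := by
    intro l
    have e1 : devMoment P N (j + 1) l = 1 / (N : ℝ) * ∑ i, nu P.β P.D P.h
        (fun x : Fin 2 → Config N P.S =>
          ((x 0 i).toReal * (x l i).toReal - limOverlap P 0 l) * dev P x 0 l ^ (2 * j + 1)) := by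
      rw [← nu_dev_mul hN]
      unfold devMoment
      congr 1
      ext x
      ring
    rw [e1]
    refine (le_abs_self _).trans (abs_average_le hN fun i => ?_)
    set ψ : (Fin 2 → Config N P.S) → ℝ := fun x =>
      (x 0 i).toReal * (x l i).toReal - limOverlap P 0 l with hψ
    have hψb : ∀ x, |ψ x| ≤ 2 * s ^ 2 := abs_site_le hP i 0 l
    have e2 : nu P.β P.D P.h (fun x : Fin 2 → Config N P.S => ψ x * dev P x 0 l ^ (2 * j + 1))
        = nu P.β P.D P.h (fun x : Fin 2 → Config N P.S =>
            ψ x * (dev P x 0 l ^ (2 * j + 1) - cavityDev P i x 0 l ^ (2 * j + 1)))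
          + nu P.β P.D P.h (fun x : Fin 2 → Config N P.S =>
            ψ x * cavityDev P i x 0 l ^ (2 * j + 1)) := by
      rw [← nu_add]
      congr 1
      ext x
      ring
    rw [e2]
    refine (abs_add_le _ _).trans (add_le_add ?_ ?_)
    · refine (abs_nu_le_of_le (g := fun x => (2 * s ^ 2 * κ (2 * j + 1))
        * (δ * (dev P x 0 l ^ (2 * j) + δ ^ j))) _ _ _ fun x => ?_).trans ?_
      · rw [abs_mul, abs_sub_comm (dev P x 0 l ^ (2 * j + 1)), mul_assoc (2 * s ^ 2)]
        exact mul_le_mul (hψb x) (hpow i x 0 l le_rfl) (abs_nonneg _) (by positivity)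
      · rw [nu_const_mul]
        exact mul_le_mul_of_nonneg_left (hnuE 0 l)
          (by have := hκ0 (2 * j + 1); positivity)
    · refine abs_nu_site_le hP i 0 l ((freeOfSite_cavityDev i 0 l).pow _) fun θ hθ => ?_
      set V : (Fin 4 → Config N P.S) → ℝ := fun x =>
        ∑ a, ∑ b, cavityDev P i x a b ^ (2 * j + 2) with hV
      have heven : ∀ (y : ℝ), 0 ≤ y ^ (2 * j + 2) := fun y => by
        rw [show 2 * j + 2 = 2 * (j + 1) by ring, pow_mul]; positivity
      have hVge : ∀ x a b, cavityDev P i x a b ^ (2 * j + 2) ≤ V x := by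
        intro x a b
        refine le_trans ?_ (Finset.single_le_sum (f := fun a => ∑ b, cavityDev P i x a b ^ (2*j+2))
          (fun a _ => Finset.sum_nonneg fun b _ => heven _) (Finset.mem_univ a))
        exact Finset.single_le_sum (f := fun b => cavityDev P i x a b ^ (2*j+2))
          (fun b _ => heven _) (Finset.mem_univ b)
      have hgen : ∀ x, |cavityGen P i (fun x => ψ x * cavityDev P i x 0 l ^ (2 * j + 1)) x|
          ≤ (2 * P.β ^ 2 * s ^ 4 * T) * V x := by
        intro x
        set y : ℝ := cavityDev P i (fun k : Fin 2 => x k.castSucc.castSucc) 0 l with hy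
        have hyV : y ^ (2 * j + 2) ≤ V x := by
          have : y = cavityDev P i x (Fin.castSucc (Fin.castSucc (0 : Fin 2)))
              l.castSucc.castSucc := cavityDev_comp (castSucc_castSucc_injective 2) i x 0 l
          rw [this]
          exact hVge _ _ _
        have hc : ∀ a b, |y ^ (2 * j + 1) * cavityDev P i x a b| ≤ 2 * V x := by
          intro a b
          have h1 := hVge x a b
          set w := cavityDev P i x a b
          rw [abs_mul, abs_pow]
          have h2 : |y| ^ (2 * j + 1) * |w| ≤ |y| ^ (2 * j + 2) + |w| ^ (2 * j + 2) := by
            rcases le_total |y| |w| with h | h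
            · have : |y| ^ (2 * j + 1) * |w| ≤ |w| ^ (2 * j + 1) * |w| := by gcongr
              rw [← pow_succ] at this
              have := pow_nonneg (abs_nonneg y) (2 * j + 2)
              linarith
            · have : |y| ^ (2 * j + 1) * |w| ≤ |y| ^ (2 * j + 1) * |y| := by gcongr
              rw [← pow_succ] at this
              have := pow_nonneg (abs_nonneg w) (2 * j + 2)
              linarith
          have e3 : |y| ^ (2 * j + 2) = y ^ (2 * j + 2) := by
            rw [show 2 * j + 2 = 2 * (j + 1) by ring, pow_mul, sq_abs, ← pow_mul]
          have e4 : |w| ^ (2 * j + 2) = w ^ (2 * j + 2) := by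
            rw [show 2 * j + 2 = 2 * (j + 1) by ring, pow_mul, sq_abs, ← pow_mul]
          linarith
        refine (abs_cavityGen_site_le hP i 0 l (f := fun x => cavityDev P i x 0 l ^ (2 * j + 1)) x
          hc).trans_eq ?_
        ring
      refine (abs_cavityAvg_le hP i hgen hθ).trans ?_
      rw [nu_const_mul]
      have hnuV : nu P.β P.D P.h V ≤ 16 * (U' + κ (2 * j + 2) * (δ * (U + δ ^ j))) := by
        simp only [hV, nu_sum]
        refine (Finset.sum_le_sum fun a _ => Finset.sum_le_sum fun b _ => hnuC i a b).trans_eq ?_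
        simp
        ring
      calc pathConst P.S (2 + 2) * ((2 * P.β ^ 2 * s ^ 4 * T) * nu P.β P.D P.h V)
          = G * nu P.β P.D P.h V := by rw [hG]; ring
        _ ≤ G * (16 * (U' + κ (2 * j + 2) * (δ * (U + δ ^ j)))) :=
            mul_le_mul_of_nonneg_left hnuV hG0
        _ = _ := by ring
  have m0 := main 0
  have m1 := main 1
  have hU'0 : 0 ≤ U' := add_nonneg (devMoment_nonneg _ _ _ _) (devMoment_nonneg _ _ _ _)
  have hsum : U' ≤ 2 * (2 * s ^ 2 * κ (2 * j + 1) * (δ * (U + δ ^ j))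
        + 16 * G * (U' + κ (2 * j + 2) * (δ * (U + δ ^ j)))) := by rw [hU'] at *; linarith
  nlinarith

/-- The overlaps fluctuate on the scale `1 / √N`: iteration of `devMoment_succ_le`. -/
lemma exists_devMoment_le (hP : P.Admissible) (j : ℕ) : ∃ K : ℝ, 0 ≤ K ∧ ∀ N : ℕ, 1 ≤ N →
    devMoment P N j 0 + devMoment P N j 1 ≤ K * (1 / N) ^ j := by
  induction j with
  | zero =>
    refine ⟨2, by norm_num, fun N _ => ?_⟩
    simp [devMoment, nu_const]
    norm_num
  | succ j ih =>
    obtain ⟨K, hK0, hK⟩ := ih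
    obtain ⟨L, hL0, hL⟩ := devMoment_succ_le hP j
    refine ⟨L * (K + 1), by positivity, fun N hN => (hL N hN).trans ?_⟩
    have h := hK N hN
    calc L * (1 / N * (devMoment P N j 0 + devMoment P N j 1 + (1 / N) ^ j))
        ≤ L * (1 / N * (K * (1 / N) ^ j + (1 / N) ^ j)) := by gcongr
      _ = _ := by ring

end Moments

/-! ### Orders of magnitude -/

section Order

variable {P : Params} {n : ℕ}

/-- The size of the fluctuations of the overlaps of `n` replicas. Including `1 / √N` makes every
correction term of the cavity method a power of this quantity, as `1 / N ≤ fluct x ^ 2`. -/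
def fluct (P : Params) {N n : ℕ} (x : Fin n → Config N P.S) : ℝ :=
  (√(N : ℝ))⁻¹ + ∑ k, ∑ l, |dev P x k l|

lemma fluct_nonneg {N : ℕ} (x : Fin n → Config N P.S) : 0 ≤ fluct P x :=
  add_nonneg (by positivity) (Finset.sum_nonneg fun _ _ => Finset.sum_nonneg fun _ _ => abs_nonneg _)

lemma inv_sqrt_le_fluct {N : ℕ} (x : Fin n → Config N P.S) : (√(N : ℝ))⁻¹ ≤ fluct P x :=
  le_add_of_nonneg_right
    (Finset.sum_nonneg fun _ _ => Finset.sum_nonneg fun _ _ => abs_nonneg _)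

lemma abs_dev_le_fluct {N : ℕ} (x : Fin n → Config N P.S) (k l : Fin n) :
    |dev P x k l| ≤ fluct P x := by
  have h1 : |dev P x k l| ≤ ∑ b, |dev P x k b| :=
    Finset.single_le_sum (f := fun b => |dev P x k b|) (fun _ _ => abs_nonneg _) (Finset.mem_univ l)
  have h2 : ∑ b, |dev P x k b| ≤ ∑ a, ∑ b, |dev P x a b| :=
    Finset.single_le_sum (f := fun a => ∑ b, |dev P x a b|)
      (fun _ _ => Finset.sum_nonneg fun _ _ => abs_nonneg _) (Finset.mem_univ k)
  have h3 : 0 ≤ (√(N : ℝ))⁻¹ := by positivity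
  unfold fluct
  linarith

lemma one_div_eq_inv_sqrt_sq (N : ℕ) : (1 : ℝ) / N = ((√(N : ℝ))⁻¹) ^ 2 := by
  rw [inv_pow, Real.sq_sqrt (Nat.cast_nonneg _), one_div]

lemma inv_sqrt_le_one (N : ℕ) : (√(N : ℝ))⁻¹ ≤ 1 := by
  rcases Nat.eq_zero_or_pos N with h | h
  · simp [h]
  · refine inv_le_one_of_one_le₀ ?_
    rw [Real.one_le_sqrt]
    exact_mod_cast h

lemma fluct_castSucc_le {N : ℕ} (x : Fin (n + 2) → Config N P.S) :
    fluct P (fun k : Fin n => x k.castSucc.castSucc) ≤ fluct P x := by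
  unfold fluct
  refine add_le_add le_rfl ?_
  have h1 : ∀ k l : Fin n, dev P (fun k : Fin n => x k.castSucc.castSucc) k l
      = dev P x k.castSucc.castSucc l.castSucc.castSucc :=
    fun k l => dev_comp (castSucc_castSucc_injective n) x k l
  simp only [h1]
  have h2 : ∀ g : Fin (n + 2) → ℝ, (∀ a, 0 ≤ g a) →
      ∑ k : Fin n, g k.castSucc.castSucc ≤ ∑ k, g k := by
    intro g hg
    rw [Fin.sum_univ_castSucc, Fin.sum_univ_castSucc]
    linarith [hg (Fin.last n).castSucc, hg (Fin.last (n + 1))]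
  refine (Finset.sum_le_sum fun k _ => h2 (fun l => |dev P x k.castSucc.castSucc l|)
    fun _ => abs_nonneg _).trans ?_
  exact h2 (fun k => ∑ l, |dev P x k l|) fun _ => Finset.sum_nonneg fun _ _ => abs_nonneg _

lemma exists_nu_fluct_pow_le (hP : P.Admissible) (n r : ℕ) : ∃ K : ℝ, 0 ≤ K ∧ ∀ N : ℕ, 1 ≤ N →
    nu P.β P.D P.h (fun x : Fin n → Config N P.S => fluct P x ^ r) ≤ K * (√(N : ℝ))⁻¹ ^ r := by
  obtain ⟨K, hK0, hK⟩ := exists_devMoment_le hP r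
  set c : ℝ := (Fintype.card (Option (Fin n × Fin n)) : ℝ) with hc
  refine ⟨c ^ r * (1 + ∑ _k : Fin n, ∑ _l : Fin n, (1 + K)), by positivity, fun N hN => ?_⟩
  set δ : ℝ := (√(N : ℝ))⁻¹ with hδ
  have hNpos : (0 : ℝ) < N := by exact_mod_cast hN
  have hδ0 : 0 < δ := by positivity
  have hpt : ∀ x : Fin n → Config N P.S, fluct P x ^ r
      ≤ c ^ r * (δ ^ r + ∑ k, ∑ l, |dev P x k l| ^ r) := by
    intro x
    set a : Option (Fin n × Fin n) → ℝ := fun o => o.elim δ fun y => |dev P x y.1 y.2| with ha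
    have ha0 : ∀ o, 0 ≤ a o := by
      rintro (_ | y)
      · exact hδ0.le
      · exact abs_nonneg _
    have e1 : fluct P x = ∑ o, a o := by
      rw [Fintype.sum_option, Fintype.sum_prod_type]; rfl
    have e2 : δ ^ r + ∑ k, ∑ l, |dev P x k l| ^ r = ∑ o, a o ^ r := by
      rw [Fintype.sum_option, Fintype.sum_prod_type]; rfl
    rw [e1, e2]
    have hc1 : 1 ≤ c := by rw [hc]; exact_mod_cast Fintype.card_pos
    rcases r with _ | r
    · simp only [pow_zero, Finset.sum_const, nsmul_eq_mul, mul_one, one_mul]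
      rw [Finset.card_univ, ← hc]
      exact hc1
    · refine (pow_sum_le_card_mul_sum_pow (s := Finset.univ) (f := a) (fun o _ => ha0 o) r).trans ?_
      refine mul_le_mul_of_nonneg_right ?_ (Finset.sum_nonneg fun o _ => pow_nonneg (ha0 o) _)
      rw [Finset.card_univ, ← hc]
      exact pow_le_pow_right₀ hc1 (Nat.le_succ r)
  have hdev : ∀ k l : Fin n, nu P.β P.D P.h (fun x : Fin n → Config N P.S => |dev P x k l| ^ r)
      ≤ (1 + K) * δ ^ r := by
    intro k l
    have h1 := nu_mono (N := N) (S := P.S) P.β P.D P.h (n := n)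
      (f := fun x => |dev P x k l| ^ r)
      (g := fun x => δ ^ r + (δ ^ r)⁻¹ * dev P x k l ^ (2 * r)) fun x => by
        have hp : 0 < δ ^ r := by positivity
        have e : dev P x k l ^ (2 * r) = (|dev P x k l| ^ r) ^ 2 := by
          rw [← pow_mul, mul_comm r 2, pow_mul, pow_mul, sq_abs]
        rw [e, ← sub_nonneg]
        have : δ ^ r + (δ ^ r)⁻¹ * (|dev P x k l| ^ r) ^ 2 - |dev P x k l| ^ r
            = (δ ^ r)⁻¹ * ((δ ^ r - |dev P x k l| ^ r) ^ 2 + δ ^ r * |dev P x k l| ^ r) := by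
          field_simp; ring
        rw [this]
        positivity
    rw [nu_add, nu_const, nu_const_mul] at h1
    have h2 := (nu_dev_pow_le (P := P) (N := N) r k l).trans (hK N hN)
    rw [one_div_eq_inv_sqrt_sq, ← hδ] at h2
    have h3 : (δ ^ r)⁻¹ * nu P.β P.D P.h (fun x : Fin n → Config N P.S => dev P x k l ^ (2 * r))
        ≤ (δ ^ r)⁻¹ * (K * (δ ^ 2) ^ r) := mul_le_mul_of_nonneg_left h2 (by positivity)
    have h4 : (δ ^ r)⁻¹ * (K * (δ ^ 2) ^ r) = K * δ ^ r := by
      rw [← pow_mul, mul_comm 2 r, pow_mul]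
      field_simp
    linarith
  refine (nu_mono _ _ _ hpt).trans ?_
  rw [nu_const_mul, nu_add, nu_const, nu_sum, mul_assoc, add_mul, one_mul]
  refine mul_le_mul_of_nonneg_left (add_le_add le_rfl ?_) (by positivity)
  rw [Finset.sum_mul]
  refine Finset.sum_le_sum fun k _ => ?_
  rw [nu_sum, Finset.sum_mul]
  exact Finset.sum_le_sum fun l _ => hdev k l

/-- A family of functions of `n` replicas, depending on the size of the system and on a site, is
bounded by the `r`-th power of the fluctuations of the overlaps. -/
def FluctOrder (P : Params) (n r : ℕ) (f : ∀ N, Fin N → (Fin n → Config N P.S) → ℝ) : Prop :=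
  ∃ C : ℝ, 0 ≤ C ∧ ∀ N i x, |f N i x| ≤ C * fluct P x ^ r

/-- A family of numbers, depending on the size of the system and on a site, is of order
`N ^ (-r / 2)`. -/
def SizeOrder (r : ℕ) (a : ∀ N, Fin N → ℝ) : Prop :=
  ∃ C : ℝ, 0 ≤ C ∧ ∀ N i, |a N i| ≤ C * (√(N : ℝ))⁻¹ ^ r

namespace SizeOrder

variable {r : ℕ} {a b : ∀ N, Fin N → ℝ}

lemma add (ha : SizeOrder r a) (hb : SizeOrder r b) : SizeOrder r (fun N i => a N i + b N i) := by
  obtain ⟨C, hC0, hC⟩ := ha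
  obtain ⟨D, hD0, hD⟩ := hb
  refine ⟨C + D, by positivity, fun N i => (abs_add_le _ _).trans ?_⟩
  rw [add_mul]
  exact add_le_add (hC N i) (hD N i)

lemma const_mul (c : ℝ) (ha : SizeOrder r a) : SizeOrder r (fun N i => c * a N i) := by
  obtain ⟨C, hC0, hC⟩ := ha
  refine ⟨|c| * C, by positivity, fun N i => ?_⟩
  rw [abs_mul, mul_assoc]
  exact mul_le_mul_of_nonneg_left (hC N i) (abs_nonneg _)

lemma sub (ha : SizeOrder r a) (hb : SizeOrder r b) : SizeOrder r (fun N i => a N i - b N i) := by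
  have := ha.add (hb.const_mul (-1))
  simpa [sub_eq_add_neg] using this

lemma sum {α : Type*} (s : Finset α) {a : α → ∀ N, Fin N → ℝ} (h : ∀ t ∈ s, SizeOrder r (a t)) :
    SizeOrder r (fun N i => ∑ t ∈ s, a t N i) := by
  classical
  induction s using Finset.induction_on with
  | empty => exact ⟨0, le_rfl, fun N i => by simp⟩
  | insert t s ht ih =>
    simp only [Finset.sum_insert ht]
    exact (h t (Finset.mem_insert_self t s)).add (ih fun u hu => h u (Finset.mem_insert_of_mem hu))

lemma div_size (ha : SizeOrder r a) : SizeOrder (r + 2) (fun N i => 1 / (N : ℝ) * a N i) := by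
  obtain ⟨C, hC0, hC⟩ := ha
  refine ⟨C, hC0, fun N i => ?_⟩
  rw [abs_mul, one_div_eq_inv_sqrt_sq, abs_of_nonneg (by positivity), pow_add]
  have := mul_le_mul_of_nonneg_left (hC N i) (by positivity : 0 ≤ (√(N : ℝ))⁻¹ ^ 2)
  linarith

end SizeOrder

namespace FluctOrder

variable {r s : ℕ} {f g : ∀ N, Fin N → (Fin n → Config N P.S) → ℝ}

lemma add (hf : FluctOrder P n r f) (hg : FluctOrder P n r g) :
    FluctOrder P n r (fun N i x => f N i x + g N i x) := by
  obtain ⟨C, hC0, hC⟩ := hf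
  obtain ⟨D, hD0, hD⟩ := hg
  refine ⟨C + D, by positivity, fun N i x => (abs_add_le _ _).trans ?_⟩
  rw [add_mul]
  exact add_le_add (hC N i x) (hD N i x)

lemma const_mul (c : ℝ) (hf : FluctOrder P n r f) :
    FluctOrder P n r (fun N i x => c * f N i x) := by
  obtain ⟨C, hC0, hC⟩ := hf
  refine ⟨|c| * C, by positivity, fun N i x => ?_⟩
  rw [abs_mul, mul_assoc]
  exact mul_le_mul_of_nonneg_left (hC N i x) (abs_nonneg _)

lemma mul (hf : FluctOrder P n r f) (hg : FluctOrder P n s g) :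
    FluctOrder P n (r + s) (fun N i x => f N i x * g N i x) := by
  obtain ⟨C, hC0, hC⟩ := hf
  obtain ⟨D, hD0, hD⟩ := hg
  refine ⟨C * D, by positivity, fun N i x => ?_⟩
  rw [abs_mul, pow_add, mul_mul_mul_comm]
  exact mul_le_mul (hC N i x) (hD N i x) (abs_nonneg _)
    (mul_nonneg hC0 (pow_nonneg (fluct_nonneg x) _))

lemma prod {α : Type*} (t : Finset α) {f : α → ∀ N, Fin N → (Fin n → Config N P.S) → ℝ}
    (h : ∀ a ∈ t, FluctOrder P n 1 (f a)) :
    FluctOrder P n t.card (fun N i x => ∏ a ∈ t, f a N i x) := by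
  classical
  induction t using Finset.induction_on with
  | empty => exact ⟨1, zero_le_one, fun N i x => by simp⟩
  | insert a t ha ih =>
    simp only [Finset.prod_insert ha, Finset.card_insert_of_notMem ha]
    rw [add_comm]
    exact (h a (Finset.mem_insert_self a t)).mul
      (ih fun u hu => h u (Finset.mem_insert_of_mem hu))

lemma sum {α : Type*} (t : Finset α) {f : α → ∀ N, Fin N → (Fin n → Config N P.S) → ℝ}
    (h : ∀ a ∈ t, FluctOrder P n r (f a)) :
    FluctOrder P n r (fun N i x => ∑ a ∈ t, f a N i x) := by
  classical
  induction t using Finset.induction_on with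
  | empty => exact ⟨0, le_rfl, fun N i x => by simp⟩
  | insert a t ha ih =>
    simp only [Finset.sum_insert ha]
    exact (h a (Finset.mem_insert_self a t)).add
      (ih fun u hu => h u (Finset.mem_insert_of_mem hu))

lemma dev (k l : Fin n) : FluctOrder P n 1 (fun _ _ x => dev P x k l) :=
  ⟨1, zero_le_one, fun N i x => by rw [pow_one, one_mul]; exact abs_dev_le_fluct x k l⟩

lemma cavityDev_sub_dev (k l : Fin n) :
    FluctOrder P n 2 (fun _ i x => cavityDev P i x k l - GhatakSherrington.dev P x k l) := by
  refine ⟨(P.S : ℝ) ^ 2, by positivity, fun N i x => (abs_cavityDev_sub_dev_le i x k l).trans ?_⟩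
  rw [one_div_eq_inv_sqrt_sq]
  gcongr
  exact inv_sqrt_le_fluct x

lemma cavityDev (k l : Fin n) : FluctOrder P n 1 (fun _ i x => cavityDev P i x k l) := by
  have : FluctOrder P n 1
      (fun _ i x => GhatakSherrington.cavityDev P i x k l - GhatakSherrington.dev P x k l) := by
    refine ⟨(P.S : ℝ) ^ 2, by positivity, fun N i x => (abs_cavityDev_sub_dev_le i x k l).trans ?_⟩
    rw [one_div_eq_inv_sqrt_sq, pow_one]
    refine mul_le_mul_of_nonneg_left ?_ (by positivity)
    refine le_trans ?_ (inv_sqrt_le_fluct x)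
    rw [sq]
    exact mul_le_of_le_one_left (by positivity) (inv_sqrt_le_one N)
  simpa using this.add (dev k l)

lemma of_bounded {C : ℝ} (h : ∀ N i x, |f N i x| ≤ C) : FluctOrder P n 0 f :=
  ⟨max C 0, le_max_right _ _, fun N i x => by
    rw [pow_zero, mul_one]; exact (h N i x).trans (le_max_left _ _)⟩

lemma spin_mul (k l : Fin n) :
    FluctOrder P n 0 (fun _ i x => (x k i).toReal * (x l i).toReal) :=
  of_bounded fun _ i x => Spin.abs_mul_le (x k i) (x l i)

lemma castSucc (hf : FluctOrder P n r f) :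
    FluctOrder P (n + 2) r (fun N i x => f N i (fun k => x k.castSucc.castSucc)) := by
  obtain ⟨C, hC0, hC⟩ := hf
  refine ⟨C, hC0, fun N i x => (hC N i _).trans ?_⟩
  gcongr
  · exact fluct_nonneg _
  · exact fluct_castSucc_le x

/-- The generator of the cavity interpolation raises the order by one. -/
lemma gen (hf : FluctOrder P n r f) :
    FluctOrder P (n + 2) (r + 1) (fun N i x => cavityGen P i (f N i) x) := by
  unfold cavityGen
  refine const_mul _ (hf.castSucc.mul (sum _ fun k _ => sum _ fun l _ => const_mul _ ?_))
  have := (spin_mul (P := P) k l).mul (cavityDev k l)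
  rwa [zero_add] at this

lemma cavityAvg_uniform (hP : P.Admissible) (hf : FluctOrder P n r f) :
    ∃ C : ℝ, 0 ≤ C ∧ ∀ N i, ∀ θ ∈ Set.Icc 0 (Real.pi / 2),
      |cavityAvg P i θ (f N i)| ≤ C * (√(N : ℝ))⁻¹ ^ r := by
  obtain ⟨C, hC0, hC⟩ := hf
  obtain ⟨K, hK0, hK⟩ := exists_nu_fluct_pow_le hP n r
  have hp := pathConst_pos P.S n
  refine ⟨pathConst P.S n * (C * K), by positivity, fun N i θ hθ => ?_⟩
  refine (abs_cavityAvg_le hP i (hC N i) hθ).trans ?_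
  rw [nu_const_mul, mul_assoc, mul_assoc]
  gcongr
  exact hK N i.pos

lemma nu (hP : P.Admissible) (hf : FluctOrder P n r f) :
    SizeOrder r (fun N i => nu P.β P.D P.h (f N i)) := by
  obtain ⟨C, hC0, hC⟩ := hf.cavityAvg_uniform hP
  refine ⟨C, hC0, fun N i => ?_⟩
  have := hC N i (Real.pi / 2) ⟨by positivity, le_rfl⟩
  rwa [cavityAvg_pi_div_two] at this

lemma cavityAvg_sub_uniform (hP : P.Admissible) (hf : FluctOrder P n r f) :
    ∃ C : ℝ, 0 ≤ C ∧ ∀ N i, ∀ θ ∈ Set.Icc 0 (Real.pi / 2),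
      |cavityAvg P i θ (f N i) - cavityAvg P i 0 (f N i)| ≤ C * (√(N : ℝ))⁻¹ ^ (r + 1) := by
  obtain ⟨C, hC0, hC⟩ := hf.gen.cavityAvg_uniform hP
  refine ⟨C, hC0, fun N i θ hθ => ?_⟩
  have := abs_sub_sub_le_of_hasDerivAt (c := 0)
    (fun θ => hasDerivAt_cavityAvg P i hP.q_nonneg (f N i) θ)
    (fun θ hθ => by rw [sub_zero]; exact hC N i θ hθ) hθ
  simpa using this

/-- First-order cavity expansion. -/
lemma nu_sub_cavityAvg (hP : P.Admissible) (hf : FluctOrder P n r f) :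
    SizeOrder (r + 1) (fun N i =>
      GhatakSherrington.nu P.β P.D P.h (f N i) - cavityAvg P i 0 (f N i)) := by
  obtain ⟨C, hC0, hC⟩ := hf.cavityAvg_sub_uniform hP
  refine ⟨C, hC0, fun N i => ?_⟩
  have := hC N i (Real.pi / 2) ⟨by positivity, le_rfl⟩
  rwa [cavityAvg_pi_div_two] at this

/-- Second-order cavity expansion. -/
lemma nu_sub_cavityAvg_sub_gen (hP : P.Admissible) (hf : FluctOrder P n r f) :
    SizeOrder (r + 2) (fun N i => GhatakSherrington.nu P.β P.D P.h (f N i)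
      - cavityAvg P i 0 (f N i) - cavityAvg P i 0 (cavityGen P i (f N i))) := by
  obtain ⟨C, hC0, hC⟩ := hf.gen.cavityAvg_sub_uniform hP
  refine ⟨C, hC0, fun N i => ?_⟩
  have := abs_sub_sub_le_of_hasDerivAt (c := cavityAvg P i 0 (cavityGen P i (f N i)))
    (fun θ => hasDerivAt_cavityAvg P i hP.q_nonneg (f N i) θ)
    (fun θ hθ => hC N i θ hθ) (t := Real.pi / 2) ⟨by positivity, le_rfl⟩
  simpa [cavityAvg_pi_div_two] using this

end FluctOrder

end Order

/-! ### The cavity expansion of a product of centered overlaps -/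

section Expansion

variable {P : Params} {n : ℕ} {α : Type*}

/-- The product of the centered overlaps of the pairs `e a`, for `a ∈ s`. -/
def devProd (P : Params) (e : α → Fin n × Fin n) (s : Finset α) {N : ℕ}
    (x : Fin n → Config N P.S) : ℝ := ∏ a ∈ s, dev P x (e a).1 (e a).2

/-- The same product, without the contributions of the site `i`. -/
def cavityProd (P : Params) (e : α → Fin n × Fin n) (s : Finset α) {N : ℕ} (i : Fin N)
    (x : Fin n → Config N P.S) : ℝ := ∏ a ∈ s, cavityDev P i x (e a).1 (e a).2

variable (e : α → Fin n × Fin n)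

lemma fluctOrder_cavityProd (s : Finset α) :
    FluctOrder P n s.card (fun _ i x => cavityProd P e s i x) :=
  FluctOrder.prod s fun a _ => FluctOrder.cavityDev (e a).1 (e a).2

lemma freeOfSite_cavityProd (s : Finset α) {N : ℕ} (i : Fin N) :
    FreeOfSite i (fun x : Fin n → Config N P.S => cavityProd P e s i x) := by
  intro x ε
  exact Finset.prod_congr rfl fun a _ => freeOfSite_cavityDev i (e a).1 (e a).2 x ε

lemma FreeOfSite.mul {N : ℕ} {i : Fin N} {f g : (Fin n → Config N P.S) → ℝ}
    (hf : FreeOfSite i f) (hg : FreeOfSite i g) : FreeOfSite i (fun x => f x * g x) := fun x ε => by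
  change f _ * g _ = f x * g x
  rw [hf, hg]

variable [DecidableEq α]

lemma fluctOrder_devProd_sub (s : Finset α) :
    FluctOrder P n (s.card + 1) (fun _ i x => devProd P e s x - cavityProd P e s i x) := by
  induction s using Finset.induction_on with
  | empty => exact ⟨0, le_rfl, fun N i x => by simp [devProd, cavityProd]⟩
  | insert a s ha ih =>
    rw [Finset.card_insert_of_notMem ha]
    have h1 := (FluctOrder.dev (P := P) (e a).1 (e a).2).mul ih
    have h2 := ((FluctOrder.cavityDev_sub_dev (P := P) (e a).1 (e a).2).const_mul (-1)).mul
      (fluctOrder_cavityProd (P := P) e s)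
    rw [show 1 + (s.card + 1) = s.card + 1 + 1 by ring] at h1
    rw [show 2 + s.card = s.card + 1 + 1 by ring] at h2
    convert h1.add h2 using 4 with N i x
    simp only [devProd, cavityProd, Finset.prod_insert ha]
    ring

/-- First-order expansion of the product in the contributions of one site. -/
lemma fluctOrder_devProd_sub_sub (s : Finset α) :
    FluctOrder P n (s.card + 2) (fun N i x => devProd P e s x - cavityProd P e s i x
      - ∑ a ∈ s, 1 / (N : ℝ) * ((x (e a).1 i).toReal * (x (e a).2 i).toReal
        * cavityProd P e (s.erase a) i x)) := by
  induction s using Finset.induction_on with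
  | empty => exact ⟨0, le_rfl, fun N i x => by simp [devProd, cavityProd]⟩
  | insert a s ha ih =>
    rw [Finset.card_insert_of_notMem ha]
    have h1 := (FluctOrder.cavityDev (P := P) (e a).1 (e a).2).mul ih
    have h2 := ((FluctOrder.cavityDev_sub_dev (P := P) (e a).1 (e a).2).const_mul (-1)).mul
      (fluctOrder_devProd_sub (P := P) e s)
    rw [show 1 + (s.card + 2) = s.card + 1 + 2 by ring] at h1
    rw [show 2 + (s.card + 1) = s.card + 1 + 2 by ring] at h2
    convert h1.add h2 using 4 with N i x
    have hsum : ∑ b ∈ s, 1 / (N : ℝ) * ((x (e b).1 i).toReal * (x (e b).2 i).toReal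
        * cavityProd P e ((insert a s).erase b) i x)
        = cavityDev P i x (e a).1 (e a).2 * ∑ b ∈ s, 1 / (N : ℝ) * ((x (e b).1 i).toReal
          * (x (e b).2 i).toReal * cavityProd P e (s.erase b) i x) := by
      rw [Finset.mul_sum]
      refine Finset.sum_congr rfl fun b hb => ?_
      have hab : a ≠ b := fun h => ha (h ▸ hb)
      rw [Finset.erase_insert_of_ne hab]
      simp only [cavityProd]
      rw [Finset.prod_insert (fun h => ha (Finset.mem_of_mem_erase h))]
      ring
    rw [Finset.sum_insert ha, Finset.erase_insert ha, hsum]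
    simp only [devProd, cavityProd, Finset.prod_insert ha]
    have : cavityDev P i x (e a).1 (e a).2 - dev P x (e a).1 (e a).2
        = - (1 / (N : ℝ) * ((x (e a).1 i).toReal * (x (e a).2 i).toReal)) := by
      unfold cavityDev; ring
    rw [this]
    have h3 : dev P x (e a).1 (e a).2 = cavityDev P i x (e a).1 (e a).2
        + (1 / (N : ℝ) * ((x (e a).1 i).toReal * (x (e a).2 i).toReal)) := by
      unfold cavityDev; ring
    rw [h3]
    ring

end Expansion

/-! ### Approximate linear relations between moments -/

section Relation

variable {P : Params} {n : ℕ} {α : Type*} [DecidableEq α]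

/-- The covariance, for the decoupled spins of `n` replicas, of the products of two spins. -/
def siteCov (P : Params) {n : ℕ} (k l a b : Fin n) : ℝ :=
  P.nu0 n (fun ε => (ε k * ε l - limOverlap P k l) * (ε a * ε b))

lemma limOverlap_comp {m n : ℕ} {i : Fin m → Fin n} (hi : Function.Injective i) (k l : Fin m) :
    limOverlap P (i k) (i l) = limOverlap P k l := by
  simp [limOverlap, hi.eq_iff]

/-- The centered product of the spins of two replicas at a site. -/
def siteDev (P : Params) {N : ℕ} (i : Fin N) (k l : Fin n) (x : Fin n → Config N P.S) : ℝ :=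
  (x k i).toReal * (x l i).toReal - limOverlap P k l

lemma fluctOrder_siteDev (hP : P.Admissible) (k l : Fin n) :
    FluctOrder P n 0 (fun _ i x => siteDev P i k l x) :=
  FluctOrder.of_bounded fun _ i x => abs_site_le hP i k l x

/-- The effect of the coupling of a site on the product of its centered spins with a function of
the other sites. -/
lemma cavityAvg_zero_gen {N : ℕ} (i : Fin N) (k l : Fin n) {f : (Fin n → Config N P.S) → ℝ}
    (hf : FreeOfSite i f) :
    cavityAvg P i 0 (cavityGen P i (fun x => siteDev P i k l x * f x))
      = P.β ^ 2 / 2 * ∑ a, ∑ b, tiltWeight₁ n a * tiltWeight₂ n b *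
        (siteCov P k.castSucc.castSucc l.castSucc.castSucc a b
          * cavityAvg P i 0 (fun x => f (fun k => x k.castSucc.castSucc) * cavityDev P i x a b)) := by
  have hfree : FreeOfSite i
      (fun x : Fin (n + 2) → Config N P.S => f (fun k => x k.castSucc.castSucc)) := fun x ε => hf _ _
  have h1 : cavityGen P i (fun x => siteDev P i k l x * f x) = fun x => P.β ^ 2 / 2 * ∑ a, ∑ b,
      tiltWeight₁ n a * tiltWeight₂ n b * ((siteDev P i k l (fun k => x k.castSucc.castSucc)
        * ((x a i).toReal * (x b i).toReal))
        * (f (fun k => x k.castSucc.castSucc) * cavityDev P i x a b)) := by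
    ext x
    unfold cavityGen
    congr 1
    rw [Finset.mul_sum]
    refine Finset.sum_congr rfl fun a _ => ?_
    rw [Finset.mul_sum]
    refine Finset.sum_congr rfl fun b _ => ?_
    ring
  rw [h1]
  unfold cavityAvg
  rw [pathAvg_const_mul, pathAvg_sum]
  congr 1
  refine Finset.sum_congr rfl fun a _ => ?_
  rw [pathAvg_sum]
  refine Finset.sum_congr rfl fun b _ => ?_
  rw [pathAvg_const_mul]
  congr 1
  have := cavityAvg_zero_mul P i (n := n + 2) (fun ε => (ε k.castSucc.castSucc * ε l.castSucc.castSucc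
    - limOverlap P k l) * (ε a * ε b)) (hfree.mul (freeOfSite_cavityDev i a b))
  unfold cavityAvg at this
  unfold siteCov
  rw [limOverlap_comp (castSucc_castSucc_injective n)]
  exact this

variable (e : α → Fin n × Fin n)

/-- The relation for one site: the product is expanded to first order in the contributions of the
site, and the average to second order along the cavity path. The zeroth order vanishes, as the
site is centered at the start of the path. The two first-order terms are the ones subtracted here:
the coupling to the other sites, and the contribution of the site to a factor of the product. -/
lemma sizeOrder_moment_relation_site (hP : P.Admissible) (k l : Fin n) (s : Finset α) :
    SizeOrder (s.card + 2) (fun N i =>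
      nu P.β P.D P.h (fun x : Fin n → Config N P.S => siteDev P i k l x * devProd P e s x)
      - P.β ^ 2 / 2 * ∑ a, ∑ b, tiltWeight₁ n a * tiltWeight₂ n b *
        (siteCov P k.castSucc.castSucc l.castSucc.castSucc a b
          * nu P.β P.D P.h (fun x : Fin (n + 2) → Config N P.S =>
            devProd P e s (fun k => x k.castSucc.castSucc) * dev P x a b))
      - ∑ a ∈ s, 1 / (N : ℝ) * (siteCov P k l (e a).1 (e a).2
          * nu P.β P.D P.h (fun x : Fin n → Config N P.S => devProd P e (s.erase a) x))) := by
  -- the contribution of the coupling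
  have h1 := ((fluctOrder_siteDev hP k l).mul
    (fluctOrder_cavityProd (P := P) e s)).nu_sub_cavityAvg_sub_gen hP
  rw [zero_add] at h1
  have h1' : SizeOrder (s.card + 2) (fun N i => nu P.β P.D P.h (fun x : Fin n → Config N P.S =>
      siteDev P i k l x * cavityProd P e s i x) - P.β ^ 2 / 2 * ∑ a, ∑ b,
        tiltWeight₁ n a * tiltWeight₂ n b *
        (siteCov P k.castSucc.castSucc l.castSucc.castSucc a b
          * cavityAvg P i 0 (fun x => cavityProd P e s i (fun k => x k.castSucc.castSucc)
            * cavityDev P i x a b))) := by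
    convert h1 using 3 with N i
    rw [cavityAvg_zero_gen i k l (freeOfSite_cavityProd e s i)]
    have := cavityAvg_zero_mul P i (n := n) (fun ε => ε k * ε l - limOverlap P k l)
      (freeOfSite_cavityProd (P := P) e s i)
    rw [nu0_site hP, zero_mul] at this
    have h0 : cavityAvg P i 0 (fun x => siteDev P i k l x * cavityProd P e s i x) = 0 := this
    rw [h0, sub_zero]
  -- the averages on the right-hand side
  have h2 : ∀ a b : Fin (n + 2), SizeOrder (s.card + 2) (fun N i =>
      cavityAvg P i 0 (fun x : Fin (n + 2) → Config N P.S =>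
        cavityProd P e s i (fun k => x k.castSucc.castSucc) * cavityDev P i x a b)
      - nu P.β P.D P.h (fun x : Fin (n + 2) → Config N P.S =>
            devProd P e s (fun k => x k.castSucc.castSucc) * dev P x a b)) := by
    intro a b
    have g1 := ((fluctOrder_cavityProd (P := P) e s).castSucc.mul
      (FluctOrder.cavityDev (P := P) a b)).nu_sub_cavityAvg hP
    have g2 := (((fluctOrder_devProd_sub (P := P) e s).castSucc.mul
      (FluctOrder.dev (P := P) a b))).nu hP
    have g3 := ((fluctOrder_cavityProd (P := P) e s).castSucc.mul
      (FluctOrder.cavityDev_sub_dev (P := P) a b)).nu hP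
    have g4 := (g3.sub g1).sub g2
    convert g4 using 3 with N i
    have e1 : nu P.β P.D P.h (fun x : Fin (n + 2) → Config N P.S =>
        (devProd P e s (fun k => x k.castSucc.castSucc)
          - cavityProd P e s i (fun k => x k.castSucc.castSucc)) * dev P x a b)
        = nu P.β P.D P.h (fun x : Fin (n + 2) → Config N P.S =>
            devProd P e s (fun k => x k.castSucc.castSucc) * dev P x a b)
          - nu P.β P.D P.h (fun x : Fin (n + 2) → Config N P.S =>
            cavityProd P e s i (fun k => x k.castSucc.castSucc) * dev P x a b) := by
      rw [← nu_sub]; congr 1; ext x; ring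
    have e2 : nu P.β P.D P.h (fun x : Fin (n + 2) → Config N P.S =>
        cavityProd P e s i (fun k => x k.castSucc.castSucc)
          * (cavityDev P i x a b - dev P x a b))
        = nu P.β P.D P.h (fun x : Fin (n + 2) → Config N P.S =>
            cavityProd P e s i (fun k => x k.castSucc.castSucc) * cavityDev P i x a b)
          - nu P.β P.D P.h (fun x : Fin (n + 2) → Config N P.S =>
            cavityProd P e s i (fun k => x k.castSucc.castSucc) * dev P x a b) := by
      rw [← nu_sub]; congr 1; ext x; ring
    rw [e1, e2]
    ring
  -- the contribution of the site to the product
  have h3 : ∀ a ∈ s, SizeOrder (s.card + 2) (fun N i => 1 / (N : ℝ) *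
      (nu P.β P.D P.h (fun x : Fin n → Config N P.S => siteDev P i k l x
        * ((x (e a).1 i).toReal * (x (e a).2 i).toReal) * cavityProd P e (s.erase a) i x)
      - siteCov P k l (e a).1 (e a).2
          * nu P.β P.D P.h (fun x : Fin n → Config N P.S => devProd P e (s.erase a) x))) := by
    intro a ha
    have hcard : (s.erase a).card + 1 = s.card := Finset.card_erase_add_one ha
    rw [← hcard]
    refine SizeOrder.div_size ?_
    have g1 := (((fluctOrder_siteDev hP k l).mul (FluctOrder.spin_mul (P := P) (e a).1 (e a).2)).mul
      (fluctOrder_cavityProd (P := P) e (s.erase a))).nu_sub_cavityAvg hP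
    have g2 := (fluctOrder_cavityProd (P := P) e (s.erase a)).nu_sub_cavityAvg hP
    have g3 := (fluctOrder_devProd_sub (P := P) e (s.erase a)).nu hP
    rw [zero_add, zero_add] at g1
    have g4 := (g1.sub (g2.const_mul (siteCov P k l (e a).1 (e a).2))).sub
      (g3.const_mul (siteCov P k l (e a).1 (e a).2))
    convert g4 using 3 with N i
    have := cavityAvg_zero_mul P i (n := n)
      (fun ε => (ε k * ε l - limOverlap P k l) * (ε (e a).1 * ε (e a).2))
      (freeOfSite_cavityProd (P := P) e (s.erase a) i)
    have h0 : cavityAvg P i 0 (fun x => siteDev P i k l x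
        * ((x (e a).1 i).toReal * (x (e a).2 i).toReal) * cavityProd P e (s.erase a) i x)
        = siteCov P k l (e a).1 (e a).2 * cavityAvg P i 0 (fun x =>
          cavityProd P e (s.erase a) i x) := this
    rw [h0, nu_sub]
    ring
  have h4 := ((fluctOrder_siteDev hP k l).mul (fluctOrder_devProd_sub_sub (P := P) e s)).nu hP
  rw [zero_add] at h4
  have h5 := ((h4.add h1').add (SizeOrder.sum s h3)).add
    ((SizeOrder.sum Finset.univ fun a _ => SizeOrder.sum Finset.univ fun b _ =>
      (h2 a b).const_mul (tiltWeight₁ n a * tiltWeight₂ n b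
        * siteCov P k.castSucc.castSucc l.castSucc.castSucc a b)).const_mul (P.β ^ 2 / 2))
  convert h5 using 3 with N i
  have e1 : nu P.β P.D P.h (fun x : Fin n → Config N P.S => siteDev P i k l x
      * (devProd P e s x - cavityProd P e s i x - ∑ a ∈ s, 1 / (N : ℝ) *
        ((x (e a).1 i).toReal * (x (e a).2 i).toReal * cavityProd P e (s.erase a) i x)))
      = nu P.β P.D P.h (fun x : Fin n → Config N P.S => siteDev P i k l x * devProd P e s x)
        - nu P.β P.D P.h (fun x : Fin n → Config N P.S => siteDev P i k l x * cavityProd P e s i x)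
        - ∑ a ∈ s, 1 / (N : ℝ) * nu P.β P.D P.h (fun x : Fin n → Config N P.S => siteDev P i k l x
        * ((x (e a).1 i).toReal * (x (e a).2 i).toReal) * cavityProd P e (s.erase a) i x) := by
    simp only [← nu_const_mul]
    rw [← nu_sum, ← nu_sub, ← nu_sub]
    congr 1
    ext x
    rw [mul_sub, mul_sub, Finset.mul_sum]
    congr 1
    refine Finset.sum_congr rfl fun a _ => by ring
  rw [e1]
  simp only [mul_sub, Finset.sum_sub_distrib, mul_assoc]
  ring

/-- The approximate linear relation between the moments: the average over the sites of
`sizeOrder_moment_relation_site`. -/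
lemma exists_moment_relation (hP : P.Admissible) (k l : Fin n) (s : Finset α) :
    ∃ C : ℝ, 0 ≤ C ∧ ∀ N : ℕ, 1 ≤ N →
      |nu P.β P.D P.h (fun x : Fin n → Config N P.S => devProd P e s x * dev P x k l)
      - P.β ^ 2 / 2 * ∑ a, ∑ b, tiltWeight₁ n a * tiltWeight₂ n b *
        (siteCov P k.castSucc.castSucc l.castSucc.castSucc a b
          * nu P.β P.D P.h (fun x : Fin (n + 2) → Config N P.S =>
            devProd P e s (fun k => x k.castSucc.castSucc) * dev P x a b))
      - ∑ a ∈ s, 1 / (N : ℝ) * (siteCov P k l (e a).1 (e a).2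
          * nu P.β P.D P.h (fun x : Fin n → Config N P.S => devProd P e (s.erase a) x))|
      ≤ C * (√(N : ℝ))⁻¹ ^ (s.card + 2) := by
  obtain ⟨C, hC0, hC⟩ := sizeOrder_moment_relation_site e hP k l s
  refine ⟨C, hC0, fun N hN => ?_⟩
  have hN' : (N : ℝ) ≠ 0 := by exact_mod_cast (by omega : N ≠ 0)
  have h1 := abs_average_le hN (hC N)
  convert h1 using 2
  rw [Finset.sum_sub_distrib, Finset.sum_sub_distrib, mul_sub, mul_sub]
  have h2 : nu P.β P.D P.h (fun x : Fin n → Config N P.S => devProd P e s x * dev P x k l)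
      = 1 / (N : ℝ) * ∑ i, nu P.β P.D P.h (fun x : Fin n → Config N P.S =>
        siteDev P i k l x * devProd P e s x) := by
    have := nu_dev_mul hN k l (fun x : Fin n → Config N P.S => devProd P e s x)
    simp only [mul_comm (dev P _ k l)] at this
    exact this
  rw [h2]
  have h3 : ∀ c : ℝ, 1 / (N : ℝ) * ∑ _i : Fin N, c = c := fun c => by
    simp; field_simp
  rw [h3, h3]

end Relation

/-! ### Covariances of the decoupled spins -/

section SiteCov

variable (P : Params)

lemma integrable_replicaAvg_siteHam {n : ℕ} (f : (Fin n → Spin P.S) → ℝ) :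
    Integrable (fun z => replicaAvg (siteHam P z) f) (gaussianReal 0 1) :=
  integrable_replicaAvg (continuous_siteHam P) f

lemma nu0_add {n : ℕ} (f g : (Fin n → ℝ) → ℝ) :
    P.nu0 n (fun ε => f ε + g ε) = P.nu0 n f + P.nu0 n g := by
  simp only [nu0_eq, replicaAvg_add]
  exact integral_add (integrable_replicaAvg_siteHam P _) (integrable_replicaAvg_siteHam P _)

lemma nu0_const_mul {n : ℕ} (c : ℝ) (f : (Fin n → ℝ) → ℝ) :
    P.nu0 n (fun ε => c * f ε) = c * P.nu0 n f := by
  simp only [nu0_eq, replicaAvg_const_mul]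
  exact integral_const_mul _ _

lemma nu0_sub {n : ℕ} (f g : (Fin n → ℝ) → ℝ) :
    P.nu0 n (fun ε => f ε - g ε) = P.nu0 n f - P.nu0 n g := by
  have := nu0_add P f (fun ε => (-1) * g ε)
  rw [nu0_const_mul] at this
  simpa [sub_eq_add_neg] using this

/-- The moment of order four of the decoupled spin of one replica. -/
def mom4 : ℝ := P.nu0 1 fun ε => ε 0 ^ 4

/-- The moment of order four of the decoupled spins of two replicas, of degrees `3` and `1`. -/
def mom31 : ℝ := P.nu0 2 fun ε => ε 0 ^ 3 * ε 1

/-- The moment of order four of the decoupled spins of two replicas, of degrees `2` and `2`. -/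
def mom22 : ℝ := P.nu0 2 fun ε => ε 0 ^ 2 * ε 1 ^ 2

/-- The moment of order four of the decoupled spins of three replicas. -/
def mom211 : ℝ := P.nu0 3 fun ε => ε 0 ^ 2 * ε 1 * ε 2

/-- The moment of order four of the decoupled spins of four replicas. -/
def mom1111 : ℝ := P.nu0 4 fun ε => ε 0 * ε 1 * ε 2 * ε 3

variable {n : ℕ}

lemma nu0_mom4 (k : Fin n) : P.nu0 n (fun ε => ε k ^ 4) = mom4 P :=
  nu0_comp_injective P (i := fun _ : Fin 1 => k) (fun _ _ _ => Subsingleton.elim _ _)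
    (fun ε => ε 0 ^ 4)

lemma nu0_mom31 {k l : Fin n} (h : k ≠ l) : P.nu0 n (fun ε => ε k ^ 3 * ε l) = mom31 P := by
  have hi : Function.Injective ![k, l] := by
    intro a b hab; fin_cases a <;> fin_cases b <;> simp_all [eq_comm]
  exact nu0_comp_injective P hi (fun ε => ε 0 ^ 3 * ε 1)

lemma nu0_mom22 {k l : Fin n} (h : k ≠ l) : P.nu0 n (fun ε => ε k ^ 2 * ε l ^ 2) = mom22 P := by
  have hi : Function.Injective ![k, l] := by
    intro a b hab; fin_cases a <;> fin_cases b <;> simp_all [eq_comm]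
  exact nu0_comp_injective P hi (fun ε => ε 0 ^ 2 * ε 1 ^ 2)

lemma nu0_mom211 {k l a : Fin n} (h₁ : k ≠ l) (h₂ : k ≠ a) (h₃ : l ≠ a) :
    P.nu0 n (fun ε => ε k ^ 2 * ε l * ε a) = mom211 P := by
  have hi : Function.Injective ![k, l, a] := by
    intro a b hab; fin_cases a <;> fin_cases b <;> simp_all [eq_comm]
  exact nu0_comp_injective P hi (fun ε => ε 0 ^ 2 * ε 1 * ε 2)

lemma nu0_mom1111 {k l a b : Fin n} (h₁ : k ≠ l) (h₂ : k ≠ a) (h₃ : k ≠ b) (h₄ : l ≠ a)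
    (h₅ : l ≠ b) (h₆ : a ≠ b) : P.nu0 n (fun ε => ε k * ε l * ε a * ε b) = mom1111 P := by
  have hi : Function.Injective ![k, l, a, b] := by
    intro a b hab; fin_cases a <;> fin_cases b <;> simp_all [eq_comm]
  exact nu0_comp_injective P hi (fun ε => ε 0 * ε 1 * ε 2 * ε 3)

variable {P}

lemma nu0_mul (hP : P.Admissible) (k l : Fin n) :
    P.nu0 n (fun ε => ε k * ε l) = limOverlap P k l := by
  have h := nu0_site hP k l
  have h2 := nu0_sub P (fun ε : Fin n → ℝ => ε k * ε l) (fun _ => limOverlap P k l)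
  have h3 : P.nu0 n (fun _ => limOverlap P k l) = limOverlap P k l := by
    simp [nu0_eq, replicaAvg_const]
  rw [h, h3] at h2
  linarith

lemma siteCov_eq (hP : P.Admissible) (k l a b : Fin n) :
    siteCov P k l a b = P.nu0 n (fun ε => ε k * ε l * (ε a * ε b))
      - limOverlap P k l * limOverlap P a b := by
  unfold siteCov
  simp only [sub_mul]
  rw [nu0_sub, nu0_const_mul, nu0_mul hP]

lemma cD_eq : P.cD = mom4 P - mom22 P := by
  unfold Params.cD
  rw [← nu0_mom4 P (0 : Fin 2), ← nu0_mom22 P (k := (0 : Fin 2)) (l := 1) (by decide), ← nu0_sub]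
  congr 1; ext ε; ring

lemma cE_eq : P.cE = mom31 P - mom211 P := by
  unfold Params.cE
  rw [← nu0_mom31 P (k := (0 : Fin 3)) (l := 2) (by decide),
    ← nu0_mom211 P (k := (1 : Fin 3)) (l := 0) (a := 2) (by decide) (by decide) (by decide),
    ← nu0_sub]
  congr 1; ext ε; ring

lemma cF_eq : P.cF = mom22 P - mom211 P := by
  unfold Params.cF
  rw [← nu0_mom22 P (k := (0 : Fin 3)) (l := 2) (by decide),
    ← nu0_mom211 P (k := (2 : Fin 3)) (l := 0) (a := 1) (by decide) (by decide) (by decide),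
    ← nu0_sub]
  congr 1; ext ε; ring

lemma cG_eq : P.cG = mom211 P - mom1111 P := by
  unfold Params.cG
  rw [← nu0_mom211 P (k := (0 : Fin 4)) (l := 2) (a := 3) (by decide) (by decide) (by decide),
    ← nu0_mom1111 P (k := (0 : Fin 4)) (l := 1) (a := 2) (b := 3) (by decide) (by decide)
      (by decide) (by decide) (by decide) (by decide), ← nu0_sub]
  congr 1; ext ε; ring

lemma cA_eq : P.cA = mom22 P - 2 * mom211 P + mom1111 P := by
  have h : P.cA = P.nu0 4 (fun ε => ε 0 ^ 2 * ε 1 ^ 2) - P.nu0 4 (fun ε => ε 0 ^ 2 * ε 1 * ε 3)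
      - P.nu0 4 (fun ε => ε 1 ^ 2 * ε 0 * ε 2) + P.nu0 4 (fun ε => ε 0 * ε 1 * ε 2 * ε 3) := by
    rw [← nu0_sub, ← nu0_sub, ← nu0_add]
    unfold Params.cA
    congr 1; ext ε; ring
  rw [h, nu0_mom22 P (by decide), nu0_mom211 P (by decide) (by decide) (by decide),
    nu0_mom211 P (by decide) (by decide) (by decide), nu0_mom1111 P (by decide) (by decide)
      (by decide) (by decide) (by decide) (by decide)]
  ring

lemma cI3_eq (hP : P.Admissible) : P.cI3 = mom1111 P - P.q * P.q := by
  unfold Params.cI3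
  simp only [sub_mul]
  rw [nu0_sub, nu0_const_mul, nu0_mul hP]
  simp only [← mul_assoc]
  rw [nu0_mom1111 P (by decide) (by decide) (by decide) (by decide) (by decide) (by decide)]
  rfl

lemma cI5_eq (hP : P.Admissible) : P.cI5 = mom211 P - P.q * P.p := by
  unfold Params.cI5
  rw [← nu0_mom211 P (k := (2 : Fin 3)) (l := 0) (a := 1) (by decide) (by decide) (by decide)]
  have h2 := nu0_mul hP (2 : Fin 3) 2
  have e : limOverlap P (2 : Fin 3) 2 = P.p := if_pos rfl
  rw [e] at h2
  conv_rhs => rw [← h2]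
  rw [← nu0_const_mul, ← nu0_sub]
  congr 1; ext ε; ring

lemma cK3_eq (hP : P.Admissible) : P.cK3 = mom211 P - P.p * P.q := by
  unfold Params.cK3
  rw [← nu0_mom211 P (k := (0 : Fin 3)) (l := 1) (a := 2) (by decide) (by decide) (by decide)]
  have h2 := nu0_mul hP (1 : Fin 3) 2
  have e : limOverlap P (1 : Fin 3) 2 = P.q := if_neg (by decide)
  rw [e] at h2
  conv_rhs => rw [← h2]
  rw [← nu0_const_mul, ← nu0_sub]
  congr 1; ext ε; ring

lemma cK4_eq (hP : P.Admissible) : P.cK4 = mom22 P - P.p * P.p := by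
  unfold Params.cK4
  rw [← nu0_mom22 P (k := (0 : Fin 2)) (l := 1) (by decide)]
  have h2 := nu0_mul hP (1 : Fin 2) 1
  have e : limOverlap P (1 : Fin 2) 1 = P.p := if_pos rfl
  rw [e] at h2
  conv_rhs => arg 2; arg 2; rw [← h2]
  rw [← nu0_const_mul, ← nu0_sub]
  congr 1; ext ε; ring

lemma cF_sub_cG : P.cF - P.cG = P.cA := by rw [cF_eq, cG_eq, cA_eq]; ring

lemma cI5_eq_cK3 (hP : P.Admissible) : P.cI5 = P.cK3 := by rw [cI5_eq hP, cK3_eq hP]; ring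

/-- Indicator of the equality of two replicas. -/
def ind {γ : Type*} [DecidableEq γ] (k a : γ) : ℝ := if a = k then 1 else 0

lemma siteCov_of_ne (hP : P.Admissible) {k l : Fin n} (hkl : k ≠ l) {a b : Fin n} (hab : a ≠ b) :
    siteCov P k l a b = P.cI3 + P.cG * ((ind k a + ind l a) + (ind k b + ind l b))
      + P.cA * (ind k a * ind l b + ind l a * ind k b) := by
  rw [siteCov_eq hP, cI3_eq hP, cG_eq, cA_eq]
  simp only [limOverlap, hkl, hab, if_false]
  unfold ind
  by_cases h1 : a = k
  · subst h1
    by_cases h2 : b = l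
    · subst h2
      have := nu0_mom22 P hab
      simp only [hkl, hkl.symm, if_true, if_false]
      rw [← this]
      have e : ∀ ε : Fin n → ℝ, ε a * ε b * (ε a * ε b) = ε a ^ 2 * ε b ^ 2 := fun ε => by ring
      simp only [e]
      rw [this]; ring
    · have := nu0_mom211 P hkl hab (Ne.symm h2)
      have e : ∀ ε : Fin n → ℝ, ε a * ε l * (ε a * ε b) = ε a ^ 2 * ε l * ε b := fun ε => by ring
      simp only [hkl, hab.symm, h2, if_true, if_false, e]
      rw [this]; ring
  · by_cases h2 : b = k
    · subst h2
      by_cases h3 : a = l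
      · subst h3
        have := nu0_mom22 P hab
        have e : ∀ ε : Fin n → ℝ, ε b * ε a * (ε a * ε b) = ε a ^ 2 * ε b ^ 2 := fun ε => by ring
        simp only [hab, hkl, if_true, if_false, e]
        rw [this]; ring
      · have := nu0_mom211 P hkl (Ne.symm hab) (Ne.symm h3)
        have e : ∀ ε : Fin n → ℝ, ε b * ε l * (ε a * ε b) = ε b ^ 2 * ε l * ε a := fun ε => by ring
        simp only [hab, hkl, h3, if_true, if_false, e]
        rw [this]; ring
    · by_cases h3 : a = l
      · subst h3
        have := nu0_mom211 P (Ne.symm hkl) hab (Ne.symm h2)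
        have e : ∀ ε : Fin n → ℝ, ε k * ε a * (ε a * ε b) = ε a ^ 2 * ε k * ε b := fun ε => by ring
        simp only [hab.symm, h1, h2, if_true, if_false, e]
        rw [this]; ring
      · by_cases h4 : b = l
        · subst h4
          have := nu0_mom211 P (Ne.symm hkl) (Ne.symm hab) (Ne.symm h1)
          have e : ∀ ε : Fin n → ℝ, ε k * ε b * (ε a * ε b) = ε b ^ 2 * ε k * ε a :=
            fun ε => by ring
          simp only [hab, h1, h2, if_true, if_false, e]
          rw [this]; ring
        · have := nu0_mom1111 P hkl (Ne.symm h1) (Ne.symm h2) (Ne.symm h3) (Ne.symm h4) hab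
          have e : ∀ ε : Fin n → ℝ, ε k * ε l * (ε a * ε b) = ε k * ε l * ε a * ε b :=
            fun ε => by ring
          simp only [h1, h2, h3, h4, if_false, e]
          rw [this]; ring

lemma siteCov_diag_right (hP : P.Admissible) {k l : Fin n} (hkl : k ≠ l) (a : Fin n) :
    siteCov P k l a a = P.cI5 + P.cE * (ind k a + ind l a) := by
  rw [siteCov_eq hP, cI5_eq hP, cE_eq]
  simp only [limOverlap, hkl, if_false, if_true]
  unfold ind
  by_cases h1 : a = k
  · subst h1
    have := nu0_mom31 P hkl
    have e : ∀ ε : Fin n → ℝ, ε a * ε l * (ε a * ε a) = ε a ^ 3 * ε l := fun ε => by ring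
    simp only [hkl, if_true, if_false, e]
    rw [this]; ring
  · by_cases h2 : a = l
    · subst h2
      have := nu0_mom31 P (Ne.symm hkl)
      have e : ∀ ε : Fin n → ℝ, ε k * ε a * (ε a * ε a) = ε a ^ 3 * ε k := fun ε => by ring
      simp only [h1, if_true, if_false, e]
      rw [this]; ring
    · have := nu0_mom211 P h1 h2 hkl
      have e : ∀ ε : Fin n → ℝ, ε k * ε l * (ε a * ε a) = ε a ^ 2 * ε k * ε l := fun ε => by ring
      simp only [h1, h2, if_false, e]
      rw [this]; ring

lemma siteCov_diag_left (hP : P.Admissible) (k : Fin n) {a b : Fin n} (hab : a ≠ b) :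
    siteCov P k k a b = P.cK3 + P.cE * (ind k a + ind k b) := by
  have h : siteCov P k k a b = siteCov P a b k k := by
    rw [siteCov_eq hP, siteCov_eq hP, mul_comm (limOverlap P k k)]
    congr 2
    ext ε; ring
  rw [h, siteCov_diag_right hP hab, cI5_eq_cK3 hP]
  simp only [ind, eq_comm]

lemma siteCov_diag (hP : P.Admissible) (k a : Fin n) :
    siteCov P k k a a = P.cK4 + P.cD * ind k a := by
  rw [siteCov_eq hP, cK4_eq hP, cD_eq]
  simp only [limOverlap, if_true]
  unfold ind
  by_cases h1 : a = k
  · subst h1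
    have e : ∀ ε : Fin n → ℝ, ε a * ε a * (ε a * ε a) = ε a ^ 4 := fun ε => by ring
    simp only [if_true, e]
    rw [nu0_mom4]; ring
  · have e : ∀ ε : Fin n → ℝ, ε k * ε k * (ε a * ε a) = ε a ^ 2 * ε k ^ 2 := fun ε => by ring
    simp only [h1, if_false, e]
    rw [nu0_mom22 P h1]; ring

end SiteCov

/-! ### Positivity of the normalizing constants -/

section Positivity

variable {P : Params}

lemma abs_nu0_quad_le {n : ℕ} {f : (Fin n → ℝ) → ℝ} (k l a b : Fin n)
    (hf : ∀ ε, f ε = ε k * ε l * (ε a * ε b)) : |P.nu0 n f| ≤ (P.S : ℝ) ^ 4 := by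
  refine abs_nu0_le P n fun ε => ?_
  rw [hf, abs_mul]
  calc _ ≤ (P.S : ℝ) ^ 2 * (P.S : ℝ) ^ 2 :=
        mul_le_mul (Spin.abs_mul_le _ _) (Spin.abs_mul_le _ _) (abs_nonneg _) (by positivity)
    _ = _ := by ring

lemma abs_mom_le : |mom4 P| ≤ (P.S : ℝ) ^ 4 ∧ |mom31 P| ≤ (P.S : ℝ) ^ 4 ∧
    |mom22 P| ≤ (P.S : ℝ) ^ 4 ∧ |mom211 P| ≤ (P.S : ℝ) ^ 4 ∧ |mom1111 P| ≤ (P.S : ℝ) ^ 4 :=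
  ⟨abs_nu0_quad_le 0 0 0 0 fun ε => by ring, abs_nu0_quad_le 0 0 0 1 fun ε => by ring,
    abs_nu0_quad_le 0 0 1 1 fun ε => by ring, abs_nu0_quad_le 0 0 1 2 fun ε => by ring,
    abs_nu0_quad_le 0 1 2 3 fun ε => by ring⟩

lemma Params.Admissible.sixteen_mul_le (hP : P.Admissible) :
    16 * (P.β ^ 2 * (P.S : ℝ) ^ 4) ≤ 1 / 4 := by
  have := hP.small_of_le (c := 16 * (P.S : ℝ) ^ 4) (by
    unfold smallConst
    have := tiltMass_nonneg 1
    have := tiltMass_nonneg 2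
    have h3 : 0 ≤ (P.S : ℝ) ^ 4 * (tiltMass 1 + tiltMass 2) := by positivity
    have h4 : 0 ≤ 128 * (P.S : ℝ) ^ 4 * tiltMass 2
      * Real.exp (2 * (P.S : ℝ) ^ 4 * tiltMass 4) := by positivity
    linarith)
  linarith

lemma abs_beta_sq_mul_le {x c : ℝ} (hx : |x| ≤ c * (P.S : ℝ) ^ 4) :
    |P.β ^ 2 * x| ≤ c * (P.β ^ 2 * (P.S : ℝ) ^ 4) := by
  rw [abs_mul, abs_of_nonneg (sq_nonneg P.β)]
  calc P.β ^ 2 * |x| ≤ P.β ^ 2 * (c * (P.S : ℝ) ^ 4) :=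
        mul_le_mul_of_nonneg_left hx (sq_nonneg _)
    _ = _ := by ring

lemma M3_pos (hP : P.Admissible) : 0 < P.M3 := by
  obtain ⟨h4, h31, h22, h211, h1⟩ := abs_mom_le (P := P)
  have hs := hP.sixteen_mul_le
  have h := abs_beta_sq_mul_le (P := P) (x := P.cF - P.cG) (c := 4) (by
    rw [cF_eq, cG_eq]; rw [abs_le] at *
    constructor <;> linarith [h22.1, h22.2, h211.1, h211.2, h1.1, h1.2])
  unfold Params.M3
  linarith [(abs_le.1 h).2]

lemma M1_pos (hP : P.Admissible) : 0 < P.M1 := by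
  obtain ⟨h4, h31, h22, h211, h1⟩ := abs_mom_le (P := P)
  have hs := hP.sixteen_mul_le
  have h := abs_beta_sq_mul_le (P := P) (x := P.cF - 3 * P.cG) (c := 8) (by
    rw [cF_eq, cG_eq]; rw [abs_le] at *
    constructor <;> linarith [h22.1, h22.2, h211.1, h211.2, h1.1, h1.2])
  have h0 : 0 ≤ P.β ^ 2 * (P.S : ℝ) ^ 4 := by positivity
  unfold Params.M1
  linarith [(abs_le.1 h).2]

lemma M2_pos (hP : P.Admissible) : 0 < P.M2 := by
  obtain ⟨h4, h31, h22, h211, h1⟩ := abs_mom_le (P := P)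
  have hs := hP.sixteen_mul_le
  have h := abs_beta_sq_mul_le (P := P) (x := P.cD) (c := 2) (by
    rw [cD_eq]; rw [abs_le] at *
    constructor <;> linarith [h22.1, h22.2, h4.1, h4.2])
  have h0 : 0 ≤ P.β ^ 2 * (P.S : ℝ) ^ 4 := by positivity
  unfold Params.M2
  linarith [(abs_le.1 h).2]

lemma M_pos (hP : P.Admissible) : 0 < P.M := by
  have := M1_pos hP
  have := M2_pos hP
  unfold Params.M
  positivity

end Positivity

/-! ### The linear equations for the limiting covariances -/

section Covariances

variable {P : Params}

lemma A2sq_eq (hP : P.Admissible) : P.M3 * P.A2sq = P.cA := by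
  have h3 := (M3_pos hP).ne'
  have e : 1 - P.β ^ 2 * P.cA = P.M3 := by unfold Params.M3; rw [cF_sub_cG]
  unfold Params.A2sq
  rw [e]
  field_simp

lemma A1sq_eq (hP : P.Admissible) :
    P.M1 * P.A1sq - P.β ^ 2 / 2 * P.cE * P.C1sq = P.cG * (1 + P.β ^ 2 * P.A2sq) := by
  have h3 := (M3_pos hP).ne'
  have hM := (M_pos hP).ne'
  have e : 1 - P.β ^ 2 * P.cA = P.M3 := by unfold Params.M3; rw [cF_sub_cG]
  have e2 : 1 + P.β ^ 2 * P.A2sq = 1 / P.M3 := by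
    unfold Params.A2sq; rw [e]; field_simp; rw [← e]; ring
  rw [e2]
  unfold Params.A1sq Params.C1sq
  field_simp
  unfold Params.M Params.M1 Params.M2 Params.M3
  ring

lemma C1sq_eq (hP : P.Admissible) :
    P.M2 * P.C1sq + 2 * P.β ^ 2 * P.cE * P.A1sq = P.cE * (1 + P.β ^ 2 * P.A2sq) := by
  have h3 := (M3_pos hP).ne'
  have hM := (M_pos hP).ne'
  have e : 1 - P.β ^ 2 * P.cA = P.M3 := by unfold Params.M3; rw [cF_sub_cG]
  have e2 : 1 + P.β ^ 2 * P.A2sq = 1 / P.M3 := by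
    unfold Params.A2sq; rw [e]; field_simp; rw [← e]; ring
  rw [e2]
  unfold Params.A1sq Params.C1sq
  field_simp
  unfold Params.M Params.M1 Params.M2 Params.M3
  ring

lemma C1sq_eq' (hP : P.Admissible) :
    P.M1 * P.C1sq - P.β ^ 2 / 2 * P.cE * P.B1sq = P.cE := by
  have hM := (M_pos hP).ne'
  unfold Params.B1sq Params.C1sq
  field_simp
  unfold Params.M Params.M1 Params.M2
  ring

lemma B1sq_eq (hP : P.Admissible) :
    P.M2 * P.B1sq + 2 * P.β ^ 2 * P.cE * P.C1sq = P.cD := by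
  have hM := (M_pos hP).ne'
  unfold Params.B1sq Params.C1sq
  field_simp
  unfold Params.M Params.M1 Params.M2
  ring

/-- The covariance `C₀` of a self-overlap and an overlap without common replica occurs in the
linear system for the covariances with a given self-overlap, and in the one for the covariances
with a given overlap. Its definition solves the first system; by this identity it solves the second
one, too. -/
lemma M_mul_C0sq (hP : P.Admissible) :
    P.M * P.C0sq = P.M1 * (P.β ^ 2 * (P.cK3 * P.A2sq
        + (P.cE - P.cK3) * (2 * P.A1sq) + P.cK4 * P.C1sq) + P.cK3)
      - P.β ^ 2 * P.cE * (P.β ^ 2 * (P.cI3 * P.A2sq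
        + (2 * P.cG - P.cI3) * (2 * P.A1sq) + P.cI5 * P.C1sq) + P.cI3) := by
  have hM := (M_pos hP).ne'
  have h3 := (M3_pos hP).ne'
  have e : 1 - P.β ^ 2 * P.cA = P.M3 := by unfold Params.M3; rw [cF_sub_cG]
  unfold Params.C0sq Params.A2sq Params.A1sq Params.C1sq Params.B1sq
  rw [e, cI5_eq_cK3 hP, ← cF_sub_cG]
  field_simp
  unfold Params.M Params.M1 Params.M2 Params.M3
  ring

lemma M_mul_A0sq (hP : P.Admissible) :
    P.M * P.A0sq = P.M2 * (P.β ^ 2 * (P.cI3 * P.A2sq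
        + (2 * P.cG - P.cI3) * (2 * P.A1sq) + P.cI5 * P.C1sq) + P.cI3)
      + P.β ^ 2 * P.cE * (P.β ^ 2 * (P.cK3 * P.A2sq
        + (P.cE - P.cK3) * (2 * P.A1sq) + P.cK4 * P.C1sq) + P.cK3) := by
  have hM := (M_pos hP).ne'
  unfold Params.A0sq
  field_simp
  ring

lemma A0sq_eq (hP : P.Admissible) :
    P.M1 * P.A0sq - P.β ^ 2 * P.cE * P.C0sq = P.β ^ 2 * (P.cI3 * P.A2sq
      + (2 * P.cG - P.cI3) * (2 * P.A1sq) + P.cI5 * P.C1sq) + P.cI3 := by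
  have hM : P.M = P.M1 * P.M2 + P.β ^ 4 * P.cE ^ 2 := rfl
  refine mul_left_cancel₀ (M_pos hP).ne' ?_
  linear_combination P.M1 * M_mul_A0sq hP - P.β ^ 2 * P.cE * M_mul_C0sq hP
    - (P.β ^ 2 * (P.cI3 * P.A2sq + (2 * P.cG - P.cI3) * (2 * P.A1sq) + P.cI5 * P.C1sq)
      + P.cI3) * hM

lemma C0sq_eq (hP : P.Admissible) :
    P.M2 * P.C0sq + P.β ^ 2 * P.cE * P.A0sq = P.β ^ 2 * (P.cK3 * P.A2sq
      + (P.cE - P.cK3) * (2 * P.A1sq) + P.cK4 * P.C1sq) + P.cK3 := by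
  have hM : P.M = P.M1 * P.M2 + P.β ^ 4 * P.cE ^ 2 := rfl
  refine mul_left_cancel₀ (M_pos hP).ne' ?_
  linear_combination P.M2 * M_mul_C0sq hP + P.β ^ 2 * P.cE * M_mul_A0sq hP
    - (P.β ^ 2 * (P.cK3 * P.A2sq + (P.cE - P.cK3) * (2 * P.A1sq) + P.cK4 * P.C1sq)
      + P.cK3) * hM

lemma C0sq_eq' (hP : P.Admissible) :
    P.M1 * P.C0sq - P.β ^ 2 * P.cE * P.B0sq = P.β ^ 2 * ((2 * P.cG - P.cI3) * P.C1sq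
      + 1 / 2 * P.cI5 * P.B1sq) + P.cI5 := by
  have hM := (M_pos hP).ne'
  unfold Params.C0sq Params.B0sq
  generalize P.C1sq = c1
  generalize P.B1sq = b1
  field_simp
  unfold Params.M
  ring

lemma B0sq_eq (hP : P.Admissible) :
    P.M2 * P.B0sq + P.β ^ 2 * P.cE * P.C0sq = P.β ^ 2 * ((P.cE - P.cK3) * P.C1sq
      + 1 / 2 * P.cK4 * P.B1sq) + P.cK4 := by
  have hM := (M_pos hP).ne'
  unfold Params.C0sq Params.B0sq
  generalize P.C1sq = c1
  generalize P.B1sq = b1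
  field_simp
  unfold Params.M
  ring

end Covariances

/-! ### The linear system for the moments of overlaps -/

section WeightedSums

variable {n : ℕ}

lemma sum_tiltWeight_mul (g : Fin (n + 2) → Fin (n + 2) → ℝ) :
    ∑ a, ∑ b, tiltWeight₁ n a * tiltWeight₂ n b * g a b
      = ∑ a : Fin n, ∑ b : Fin n, g a.castSucc.castSucc b.castSucc.castSucc
        + ∑ a : Fin n, g a.castSucc.castSucc (Fin.last n).castSucc
        - (n + 1) * ∑ a : Fin n, g a.castSucc.castSucc (Fin.last (n + 1))
        - n * ∑ b : Fin n, g (Fin.last n).castSucc b.castSucc.castSucc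
        - n * g (Fin.last n).castSucc (Fin.last n).castSucc
        + n * (n + 1) * g (Fin.last n).castSucc (Fin.last (n + 1)) := by
  have h : ∀ a, ∑ b, tiltWeight₁ n a * tiltWeight₂ n b * g a b
      = tiltWeight₁ n a * (∑ b : Fin n, g a b.castSucc.castSucc + g a (Fin.last n).castSucc
        - (n + 1) * g a (Fin.last (n + 1))) := fun a => by
    simp only [mul_assoc]
    rw [← Finset.mul_sum, sum_tiltWeight₂, Fin.sum_univ_castSucc]
  simp only [h]
  rw [sum_tiltWeight₁, Finset.sum_sub_distrib, Finset.sum_add_distrib, ← Finset.mul_sum]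
  ring

lemma sum_sum_ite_eq (d : Fin n → ℝ) (f : Fin n → Fin n → ℝ) :
    ∑ a, ∑ b, (if a = b then d a else f a b) = ∑ a, ∑ b, f a b + ∑ a, (d a - f a a) := by
  rw [← Finset.sum_add_distrib]
  refine Finset.sum_congr rfl fun a _ => ?_
  have : ∀ b, (if a = b then d a else f a b) = f a b + if a = b then d a - f a a else 0 := by
    intro b
    by_cases h : a = b
    · subst h; simp
    · simp [h]
  simp only [this]
  rw [Finset.sum_add_distrib]
  simp

/-- The weights of the interpolation, summed against the product of two arrays. The first array is
`x + y (χ a + χ b) + T a b` off the diagonal and `d₀ + d₁ χ a` on it, the second one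
`α₂ a b + α₁ a + α₁ b + α₀` and `σ₁ a + σ₀`; the functions `χ`, `T`, `α₂`, `α₁`, `σ₁` are
understood to vanish at the two additional replicas. -/
lemma sum_tiltWeight_arrays {x y d₀ d₁ : ℝ} {χ : Fin n → ℝ} {T : Fin n → Fin n → ℝ}
    {α₂ : Fin n → Fin n → ℝ} {α₁ σ₁ : Fin n → ℝ} {α₀ σ₀ : ℝ}
    (hT : ∀ a, T a a = 0) (hα : ∀ a, α₂ a a = 0) (hsymm : ∀ a b, α₂ a b = α₂ b a)
    {g : Fin (n + 2) → Fin (n + 2) → ℝ}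
    (h₁ : ∀ a b : Fin n, g a.castSucc.castSucc b.castSucc.castSucc = if a = b
      then (d₀ + d₁ * χ a) * (σ₁ a + σ₀)
      else (x + y * (χ a + χ b) + T a b) * (α₂ a b + α₁ a + α₁ b + α₀))
    (h₂ : ∀ a : Fin n,
      g a.castSucc.castSucc (Fin.last n).castSucc = (x + y * χ a) * (α₁ a + α₀))
    (h₃ : ∀ a : Fin n, g a.castSucc.castSucc (Fin.last (n + 1)) = (x + y * χ a) * (α₁ a + α₀))
    (h₄ : ∀ a : Fin n,
      g (Fin.last n).castSucc a.castSucc.castSucc = (x + y * χ a) * (α₁ a + α₀))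
    (h₅ : g (Fin.last n).castSucc (Fin.last n).castSucc = d₀ * σ₀)
    (h₆ : g (Fin.last n).castSucc (Fin.last (n + 1)) = x * α₀) :
    ∑ a, ∑ b, tiltWeight₁ n a * tiltWeight₂ n b * g a b
      = x * (∑ a, ∑ b, α₂ a b - 2 * ∑ a, α₁ a)
        + 2 * y * ∑ a, χ a * (∑ b, α₂ a b - 2 * α₁ a + ∑ b, α₁ b - α₀)
        + ∑ a, ∑ b, T a b * (α₂ a b + α₁ a + α₁ b + α₀)
        + d₀ * ∑ a, σ₁ a + d₁ * ∑ a, χ a * (σ₁ a + σ₀) := by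
  rw [sum_tiltWeight_mul]
  simp only [h₁, h₂, h₃, h₄, h₅, h₆]
  rw [sum_sum_ite_eq]
  simp only [hT, hα]
  have row : ∀ a, ∑ b, (x + y * (χ a + χ b) + T a b) * (α₂ a b + α₁ a + α₁ b + α₀)
      = (x + y * χ a) * ∑ b, α₂ a b + n * ((x + y * χ a) * (α₁ a + α₀))
        + (x + y * χ a) * ∑ b, α₁ b + y * ∑ b, χ b * α₂ a b + (y * (α₁ a + α₀)) * ∑ b, χ b
        + y * ∑ b, χ b * α₁ b + ∑ b, T a b * (α₂ a b + α₁ a + α₁ b + α₀) := fun a => by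
    have : ∀ b, (x + y * (χ a + χ b) + T a b) * (α₂ a b + α₁ a + α₁ b + α₀)
        = (x + y * χ a) * α₂ a b + (x + y * χ a) * (α₁ a + α₀) + (x + y * χ a) * α₁ b
          + y * (χ b * α₂ a b) + (y * (α₁ a + α₀)) * χ b + y * (χ b * α₁ b)
          + T a b * (α₂ a b + α₁ a + α₁ b + α₀) := fun b => by ring
    simp only [this, Finset.sum_add_distrib, ← Finset.mul_sum, Finset.sum_const,
      Finset.card_univ, Fintype.card_fin, nsmul_eq_mul]
    ring
  simp only [row]
  have hs : ∑ a, ∑ b, χ b * α₂ a b = ∑ a, χ a * ∑ b, α₂ a b := by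
    rw [Finset.sum_comm]
    refine Finset.sum_congr rfl fun a _ => ?_
    rw [Finset.mul_sum]
    exact Finset.sum_congr rfl fun b _ => by rw [hsymm]
  have e1 : ∀ a, (x + y * χ a) * ∑ b, α₂ a b = x * ∑ b, α₂ a b + y * (χ a * ∑ b, α₂ a b) :=
    fun a => by ring
  have e2 : ∀ a, (x + y * χ a) * (α₁ a + α₀)
      = x * α₁ a + x * α₀ + y * (χ a * α₁ a) + (y * α₀) * χ a := fun a => by ring
  have e3 : ∀ a, (x + y * χ a) * ∑ b, α₁ b = x * ∑ b, α₁ b + (y * ∑ b, α₁ b) * χ a :=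
    fun a => by ring
  have e4 : ∀ a, y * (α₁ a + α₀) * ∑ b, χ b = (y * ∑ b, χ b) * α₁ a + y * α₀ * ∑ b, χ b :=
    fun a => by ring
  have e5 : ∀ a, (d₀ + d₁ * χ a) * (σ₁ a + σ₀)
      - (x + y * (χ a + χ a) + 0) * (0 + α₁ a + α₁ a + α₀)
      = d₀ * σ₁ a + d₀ * σ₀ + d₁ * (χ a * (σ₁ a + σ₀)) - (2 * x) * α₁ a - x * α₀
        - (4 * y) * (χ a * α₁ a) - (2 * y * α₀) * χ a := fun a => by ring
  have e6 : ∀ a, χ a * (∑ b, α₂ a b - 2 * α₁ a + ∑ b, α₁ b - α₀)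
      = χ a * ∑ b, α₂ a b - 2 * (χ a * α₁ a) + (∑ b, α₁ b) * χ a - α₀ * χ a := fun a => by ring
  simp only [e1, e2, e3, e4, e5, e6, Finset.sum_add_distrib, Finset.sum_sub_distrib,
    ← Finset.mul_sum, hs, Finset.sum_const, Finset.card_univ, Fintype.card_fin, nsmul_eq_mul]
  ring

end WeightedSums

section LinearSystem

variable {P : Params} {n : ℕ}

/-- The linear operator of the relations between moments, acting on arrays indexed by pairs of
replicas. -/
def relationOp (P : Params) (n : ℕ) :
    (Fin (n + 2) → Fin (n + 2) → ℝ) →ₗ[ℝ] (Fin n → Fin n → ℝ) where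
  toFun Y k l := Y k.castSucc.castSucc l.castSucc.castSucc - P.β ^ 2 / 2 * ∑ a, ∑ b,
    tiltWeight₁ n a * tiltWeight₂ n b
      * (siteCov P k.castSucc.castSucc l.castSucc.castSucc a b * Y a b)
  map_add' Y Z := by
    ext k l
    simp only [Pi.add_apply, mul_add, Finset.sum_add_distrib]
    ring
  map_smul' c Y := by
    ext k l
    simp only [Pi.smul_apply, smul_eq_mul, RingHom.id_apply]
    have : ∀ a b, tiltWeight₁ n a * tiltWeight₂ n b
        * (siteCov P k.castSucc.castSucc l.castSucc.castSucc a b * (c * Y a b))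
        = c * (tiltWeight₁ n a * tiltWeight₂ n b
        * (siteCov P k.castSucc.castSucc l.castSucc.castSucc a b * Y a b)) := fun a b => by ring
    simp only [this, ← Finset.mul_sum]
    ring

/-- An array indexed by pairs of replicas is given by components: `α₂ a b + α₁ a + α₁ b + α₀` off
the diagonal and `σ₁ a + σ₀` on it, where `α₂`, `α₁`, `σ₁` vanish at the last two replicas. -/
structure HasComponents (Y : Fin (n + 2) → Fin (n + 2) → ℝ) (α₂ : Fin n → Fin n → ℝ)
    (α₁ σ₁ : Fin n → ℝ) (α₀ σ₀ : ℝ) : Prop where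
  diag_zero : ∀ a, α₂ a a = 0
  symm : ∀ a b, α₂ a b = α₂ b a
  off : ∀ a b, a ≠ b →
    Y a.castSucc.castSucc b.castSucc.castSucc = α₂ a b + α₁ a + α₁ b + α₀
  diag : ∀ a, Y a.castSucc.castSucc a.castSucc.castSucc = σ₁ a + σ₀
  right : ∀ a, Y a.castSucc.castSucc (Fin.last n).castSucc = α₁ a + α₀
  right' : ∀ a, Y a.castSucc.castSucc (Fin.last (n + 1)) = α₁ a + α₀
  left : ∀ a, Y (Fin.last n).castSucc a.castSucc.castSucc = α₁ a + α₀
  last_diag : Y (Fin.last n).castSucc (Fin.last n).castSucc = σ₀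
  last_off : Y (Fin.last n).castSucc (Fin.last (n + 1)) = α₀

variable {Y : Fin (n + 2) → Fin (n + 2) → ℝ} {α₂ : Fin n → Fin n → ℝ}
    {α₁ σ₁ : Fin n → ℝ} {α₀ σ₀ : ℝ}

lemma castSucc₂_ne_last (a : Fin n) : a.castSucc.castSucc ≠ Fin.last (n + 1) :=
  (Fin.castSucc_lt_last _).ne

lemma castSucc₂_ne_last_castSucc (a : Fin n) : a.castSucc.castSucc ≠ (Fin.last n).castSucc :=
  fun h => (Fin.castSucc_lt_last a).ne (Fin.castSucc_injective _ h)

@[simp] lemma ind_castSucc₂ (k a : Fin n) :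
    ind k.castSucc.castSucc a.castSucc.castSucc = ind k a := by
  simp [ind]

@[simp] lemma ind_castSucc₂_last (k : Fin n) : ind k.castSucc.castSucc (Fin.last (n + 1)) = 0 := by
  simp [ind, (castSucc₂_ne_last k).symm]

@[simp] lemma ind_castSucc₂_last_castSucc (k : Fin n) :
    ind k.castSucc.castSucc (Fin.last n).castSucc = 0 := by
  simp [ind, (castSucc₂_ne_last_castSucc k).symm]

lemma sum_ind_mul {γ : Type*} [Fintype γ] [DecidableEq γ] (k : γ) (v : γ → ℝ) :
    ∑ a, ind k a * v a = v k := by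
  simp [ind]

lemma ind_of_ne {γ : Type*} [DecidableEq γ] {k a : γ} (h : a ≠ k) : ind k a = 0 := if_neg h

lemma relationOp_off (hP : P.Admissible) (hY : HasComponents Y α₂ α₁ σ₁ α₀ σ₀) {k l : Fin n}
    (hkl : k ≠ l) :
    relationOp P n Y k l = (1 - P.β ^ 2 * P.cA) * (α₂ k l + α₁ k + α₁ l + α₀) - P.β ^ 2 *
      (P.cG * ((∑ b, α₂ k b - 2 * α₁ k) + (∑ b, α₂ l b - 2 * α₁ l) + 2 * (∑ b, α₁ b - α₀))
        + P.cI3 * (1 / 2 * ∑ a, ∑ b, α₂ a b - ∑ a, α₁ a)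
        + 1 / 2 * (P.cE * (σ₁ k + σ₁ l + 2 * σ₀) + P.cI5 * ∑ a, σ₁ a)) := by
  have hkl' : k.castSucc.castSucc ≠ l.castSucc.castSucc :=
    fun h => hkl (castSucc_castSucc_injective n h)
  have key := sum_tiltWeight_arrays (x := P.cI3) (y := P.cG) (d₀ := P.cI5) (d₁ := P.cE)
    (χ := fun a => ind k a + ind l a)
    (T := fun a b => P.cA * (ind k a * ind l b + ind l a * ind k b))
    (g := fun a b => siteCov P k.castSucc.castSucc l.castSucc.castSucc a b * Y a b)
    (α₂ := α₂) (α₁ := α₁) (σ₁ := σ₁) (α₀ := α₀) (σ₀ := σ₀)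
    (fun a => by
      by_cases h : a = k
      · subst h; simp [ind_of_ne hkl]
      · simp [ind_of_ne h])
    hY.diag_zero hY.symm
    (fun a b => by
      by_cases h : a = b
      · subst h
        simp only [if_true, siteCov_diag_right hP hkl', ind_castSucc₂, hY.diag]
      · have h' : a.castSucc.castSucc ≠ b.castSucc.castSucc :=
          fun e => h (castSucc_castSucc_injective n e)
        simp only [if_neg h, siteCov_of_ne hP hkl' h', ind_castSucc₂, hY.off _ _ h])
    (fun a => by
      simp only [siteCov_of_ne hP hkl' (castSucc₂_ne_last_castSucc a), ind_castSucc₂,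
        ind_castSucc₂_last_castSucc, hY.right]
      ring)
    (fun a => by
      simp only [siteCov_of_ne hP hkl' (castSucc₂_ne_last a), ind_castSucc₂,
        ind_castSucc₂_last, hY.right']
      ring)
    (fun a => by
      simp only [siteCov_of_ne hP hkl' (castSucc₂_ne_last_castSucc a).symm, ind_castSucc₂,
        ind_castSucc₂_last_castSucc, hY.left]
      ring)
    (by
      simp only [siteCov_diag_right hP hkl', ind_castSucc₂_last_castSucc, hY.last_diag]
      ring)
    (by
      simp only [siteCov_of_ne hP hkl' (Fin.castSucc_lt_last (Fin.last n)).ne,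
        ind_castSucc₂_last_castSucc, ind_castSucc₂_last, hY.last_off]
      ring)
  have hT : ∑ a, ∑ b, P.cA * (ind k a * ind l b + ind l a * ind k b)
      * (α₂ a b + α₁ a + α₁ b + α₀) = 2 * P.cA * (α₂ k l + α₁ k + α₁ l + α₀) := by
    have : ∀ a b, P.cA * (ind k a * ind l b + ind l a * ind k b)
        * (α₂ a b + α₁ a + α₁ b + α₀)
        = ind l b * (P.cA * ind k a * (α₂ a b + α₁ a + α₁ b + α₀))
          + ind k b * (P.cA * ind l a * (α₂ a b + α₁ a + α₁ b + α₀)) := fun a b => by ring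
    simp only [this, Finset.sum_add_distrib, sum_ind_mul]
    have h1 : ∀ a, P.cA * ind k a * (α₂ a l + α₁ a + α₁ l + α₀)
        = ind k a * (P.cA * (α₂ a l + α₁ a + α₁ l + α₀)) := fun a => by ring
    have h2 : ∀ a, P.cA * ind l a * (α₂ a k + α₁ a + α₁ k + α₀)
        = ind l a * (P.cA * (α₂ a k + α₁ a + α₁ k + α₀)) := fun a => by ring
    simp only [h1, h2, sum_ind_mul]
    rw [hY.symm l k]
    ring
  rw [hT] at key
  simp only [add_mul, Finset.sum_add_distrib, sum_ind_mul] at key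
  simp only [relationOp, LinearMap.coe_mk, AddHom.coe_mk]
  rw [key, hY.off k l hkl]
  ring

lemma relationOp_diag (hP : P.Admissible) (hY : HasComponents Y α₂ α₁ σ₁ α₀ σ₀) (k : Fin n) :
    relationOp P n Y k k = (σ₁ k + σ₀) - P.β ^ 2 *
      (1 / 2 * P.cD * (σ₁ k + σ₀) + P.cE * (∑ b, α₂ k b - 2 * α₁ k + ∑ b, α₁ b - α₀)
        + P.cK3 * (1 / 2 * ∑ a, ∑ b, α₂ a b - ∑ a, α₁ a) + 1 / 2 * P.cK4 * ∑ a, σ₁ a) := by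
  have key := sum_tiltWeight_arrays (x := P.cK3) (y := P.cE) (d₀ := P.cK4) (d₁ := P.cD)
    (χ := fun a => ind k a) (T := fun _ _ => 0)
    (g := fun a b => siteCov P k.castSucc.castSucc k.castSucc.castSucc a b * Y a b)
    (α₂ := α₂) (α₁ := α₁) (σ₁ := σ₁) (α₀ := α₀) (σ₀ := σ₀)
    (fun a => rfl) hY.diag_zero hY.symm
    (fun a b => by
      by_cases h : a = b
      · subst h
        simp only [if_true, siteCov_diag hP, ind_castSucc₂, hY.diag]
      · have h' : a.castSucc.castSucc ≠ b.castSucc.castSucc :=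
          fun e => h (castSucc_castSucc_injective n e)
        simp only [if_neg h, siteCov_diag_left hP _ h', ind_castSucc₂, hY.off _ _ h, add_zero])
    (fun a => by
      simp only [siteCov_diag_left hP _ (castSucc₂_ne_last_castSucc a), ind_castSucc₂,
        ind_castSucc₂_last_castSucc, hY.right]
      ring)
    (fun a => by
      simp only [siteCov_diag_left hP _ (castSucc₂_ne_last a), ind_castSucc₂,
        ind_castSucc₂_last, hY.right']
      ring)
    (fun a => by
      simp only [siteCov_diag_left hP _ (castSucc₂_ne_last_castSucc a).symm, ind_castSucc₂,
        ind_castSucc₂_last_castSucc, hY.left]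
      ring)
    (by
      simp only [siteCov_diag hP, ind_castSucc₂_last_castSucc, hY.last_diag]
      ring)
    (by
      simp only [siteCov_diag_left hP _ (Fin.castSucc_lt_last (Fin.last n)).ne,
        ind_castSucc₂_last_castSucc, ind_castSucc₂_last, hY.last_off]
      ring)
  simp only [zero_mul, Finset.sum_const_zero, sum_ind_mul] at key
  simp only [relationOp, LinearMap.coe_mk, AddHom.coe_mk]
  rw [key, hY.diag k]
  ring

end LinearSystem

/-! ### Invertibility of the linear system, and the limiting covariances as its solution -/

section Invertibility

variable {P : Params}

lemma M1_eq : P.M1 = 1 - P.β ^ 2 * P.cA + 2 * P.β ^ 2 * P.cG := by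
  rw [← cF_sub_cG]; unfold Params.M1; ring

lemma M3_eq : P.M3 = 1 - P.β ^ 2 * P.cA := by
  rw [← cF_sub_cG]; rfl

/-- The symmetric arrays, indexed by pairs of `m` replicas, that do not distinguish between the
replicas after the first `n`. -/
def replicaArrays (n m : ℕ) : Submodule ℝ (Fin m → Fin m → ℝ) where
  carrier := {Y | (∀ a b, Y a b = Y b a) ∧
    (∀ a o o' : Fin m, a ≠ o → a ≠ o' → n ≤ (o : ℕ) → n ≤ (o' : ℕ) → Y a o = Y a o') ∧
    ∀ o o' : Fin m, n ≤ (o : ℕ) → n ≤ (o' : ℕ) → Y o o = Y o' o'}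
  add_mem' := by
    rintro Y Z ⟨h1, h2, h3⟩ ⟨h1', h2', h3'⟩
    refine ⟨fun a b => ?_, fun a o o' ha ha' ho ho' => ?_, fun o o' ho ho' => ?_⟩
    · simp only [Pi.add_apply, h1 a b, h1' a b]
    · simp only [Pi.add_apply, h2 a o o' ha ha' ho ho', h2' a o o' ha ha' ho ho']
    · simp only [Pi.add_apply, h3 o o' ho ho', h3' o o' ho ho']
  zero_mem' := ⟨fun _ _ => rfl, fun _ _ _ _ _ _ _ => rfl, fun _ _ _ _ => rfl⟩
  smul_mem' := by
    rintro c Y ⟨h1, h2, h3⟩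
    refine ⟨fun a b => ?_, fun a o o' ha ha' ho ho' => ?_, fun o o' ho ho' => ?_⟩
    · simp only [Pi.smul_apply, h1 a b]
    · simp only [Pi.smul_apply, h2 a o o' ha ha' ho ho']
    · simp only [Pi.smul_apply, h3 o o' ho ho']

lemma exists_hasComponents {n : ℕ} {Y : Fin (n + 2 + 2) → Fin (n + 2 + 2) → ℝ}
    (hY : Y ∈ replicaArrays n (n + 2 + 2)) :
    ∃ α₂ α₁ σ₁ α₀ σ₀, HasComponents Y α₂ α₁ σ₁ α₀ σ₀ ∧
      ∀ o : Fin (n + 2), n ≤ (o : ℕ) → (∀ a, α₂ o a = 0) ∧ α₁ o = 0 ∧ σ₁ o = 0 := by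
  obtain ⟨h1, h2, h3⟩ := hY
  have hl : n ≤ ((Fin.last (n + 2 + 1) : Fin (n + 2 + 2)) : ℕ) := by simp; omega
  have hc : n ≤ (((Fin.last (n + 2)).castSucc : Fin (n + 2 + 2)) : ℕ) := by simp
  have hr : ∀ a : Fin (n + 2), Y a.castSucc.castSucc (Fin.last (n + 2)).castSucc
      = Y a.castSucc.castSucc (Fin.last (n + 2 + 1)) := fun a =>
    h2 _ _ _ (castSucc₂_ne_last_castSucc a) (castSucc₂_ne_last a) hc hl
  have ho0 : ∀ o : Fin (n + 2), n ≤ (o : ℕ) → Y o.castSucc.castSucc (Fin.last (n + 2 + 1))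
      = Y (Fin.last (n + 2)).castSucc (Fin.last (n + 2 + 1)) := fun o ho => by
    rw [h1, h1 (Fin.last (n + 2)).castSucc]
    exact h2 _ _ _ (castSucc₂_ne_last o).symm (Fin.castSucc_lt_last _).ne' (by simpa using ho) hc
  refine ⟨fun a b => if a = b then 0 else Y a.castSucc.castSucc b.castSucc.castSucc
      - (Y a.castSucc.castSucc (Fin.last (n + 2 + 1))
        - Y (Fin.last (n + 2)).castSucc (Fin.last (n + 2 + 1)))
      - (Y b.castSucc.castSucc (Fin.last (n + 2 + 1))
        - Y (Fin.last (n + 2)).castSucc (Fin.last (n + 2 + 1)))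
      - Y (Fin.last (n + 2)).castSucc (Fin.last (n + 2 + 1)),
    fun a => Y a.castSucc.castSucc (Fin.last (n + 2 + 1))
      - Y (Fin.last (n + 2)).castSucc (Fin.last (n + 2 + 1)),
    fun a => Y a.castSucc.castSucc a.castSucc.castSucc
      - Y (Fin.last (n + 2)).castSucc (Fin.last (n + 2)).castSucc,
    Y (Fin.last (n + 2)).castSucc (Fin.last (n + 2 + 1)),
    Y (Fin.last (n + 2)).castSucc (Fin.last (n + 2)).castSucc, ?_, ?_⟩
  · constructor
    · simp
    · intro a b
      by_cases h : a = b
      · subst h; rfl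
      · simp only [if_neg h, if_neg (Ne.symm h)]
        rw [h1 a.castSucc.castSucc b.castSucc.castSucc]; ring
    · intro a b h
      simp only [if_neg h]; ring
    · intro a; ring
    · intro a; rw [hr]; ring
    · intro a; ring
    · intro a; rw [h1, hr]; ring
    · rfl
    · rfl
  · intro o ho
    refine ⟨fun a => ?_, ?_, ?_⟩
    · by_cases h : o = a
      · simp [h]
      · simp only [if_neg h, ho0 o ho]
        have : Y o.castSucc.castSucc a.castSucc.castSucc
            = Y a.castSucc.castSucc (Fin.last (n + 2 + 1)) := by
          rw [h1]
          exact h2 _ _ _ (fun e => h (castSucc_castSucc_injective _ e).symm)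
            (castSucc₂_ne_last a) (by simpa using ho) hl
        rw [this]; ring
    · simp only [ho0 o ho, sub_self]
    · simp only [h3 o.castSucc.castSucc (Fin.last (n + 2)).castSucc (by simpa using ho) hc,
        sub_self]

lemma eq_zero_of_det {a b c d x y : ℝ} (hdet : a * d - b * c ≠ 0) (h₁ : a * x + b * y = 0)
    (h₂ : c * x + d * y = 0) : x = 0 ∧ y = 0 := by
  constructor
  · refine (mul_eq_zero.1 ?_).resolve_left hdet
    linear_combination d * h₁ - b * h₂
  · refine (mul_eq_zero.1 ?_).resolve_left hdet
    linear_combination a * h₂ - c * h₁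

/-- Two replicas outside of the distinguished ones suffice to separate the components of an array:
differences of the equations for different pairs of replicas isolate `α₂`, then `(α₁, σ₁)`, then
`(α₀, σ₀)`, with determinants `M₃`, `M` and `M`. -/
lemma eq_zero_of_relationOp_eq_zero (hP : P.Admissible) {n : ℕ}
    {Y : Fin (n + 2 + 2) → Fin (n + 2 + 2) → ℝ}
    (hY : Y ∈ replicaArrays n (n + 2 + 2)) (h0 : relationOp P (n + 2) Y = 0) : Y = 0 := by
  obtain ⟨α₂, α₁, σ₁, α₀, σ₀, hc, hout⟩ := exists_hasComponents hY
  have hoff : ∀ {k l : Fin (n + 2)}, k ≠ l → _ := fun {k l} hkl =>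
    (relationOp_off hP hc hkl).symm.trans (congrFun (congrFun h0 k) l)
  have hdiag := fun k => (relationOp_diag hP hc k).symm.trans (congrFun (congrFun h0 k) k)
  simp only [Pi.zero_apply] at hoff hdiag
  let u : Fin (n + 2) := ⟨n, by omega⟩
  let v : Fin (n + 2) := ⟨n + 1, by omega⟩
  have huv : u ≠ v := by simp [u, v]
  obtain ⟨hu2, hu1, hus⟩ := hout u (by simp [u])
  obtain ⟨hv2, hv1, hvs⟩ := hout v (by simp [v])
  have h3 : 1 - P.β ^ 2 * P.cA ≠ 0 := by rw [← M3_eq]; exact (M3_pos hP).ne'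
  have hM : P.M ≠ 0 := (M_pos hP).ne'
  have su : ∑ b, α₂ u b = 0 := Finset.sum_eq_zero fun b _ => hu2 b
  have sv : ∑ b, α₂ v b = 0 := Finset.sum_eq_zero fun b _ => hv2 b
  have e2 : ∀ k l, α₂ k l = 0 := by
    intro k l
    by_cases hku : k = u
    · rw [hku]; exact hu2 l
    by_cases hlv : l = v
    · rw [hc.symm, hlv]; exact hv2 k
    by_cases hkl : k = l
    · rw [hkl]; exact hc.diag_zero l
    have a1 := hoff hkl
    have a2 := hoff hku
    have a3 := hoff hlv
    have a4 := hoff huv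
    rw [su, hu1, hus, hc.symm, hu2] at a2
    rw [sv, hv1, hvs, hc.symm, hv2] at a3
    rw [su, hu1, hus, sv, hv1, hvs, hu2] at a4
    refine (mul_eq_zero.1 ?_).resolve_left h3
    linear_combination a1 - a2 - a3 + a4
  simp only [e2, Finset.sum_const_zero] at hoff hdiag
  have e1 : ∀ k, α₁ k = 0 ∧ σ₁ k = 0 := by
    intro k
    by_cases hku : k = u
    · rw [hku]; exact ⟨hu1, hus⟩
    have a2 := hoff hku
    have a4 := hoff huv.symm
    have d1 := hdiag k
    have d2 := hdiag u
    rw [hu1, hus] at a2 a4 d2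
    rw [hv1, hvs] at a4
    refine eq_zero_of_det (a := P.M1) (b := -(P.β ^ 2 / 2 * P.cE)) (c := 2 * P.β ^ 2 * P.cE)
      (d := P.M2) ?_ ?_ ?_
    · convert hM using 1
      unfold Params.M; ring
    · rw [M1_eq]
      linear_combination a2 - a4
    · unfold Params.M2
      linear_combination d1 - d2
  simp only [e1, Finset.sum_const_zero] at hoff hdiag
  obtain ⟨z0, z1⟩ : α₀ = 0 ∧ σ₀ = 0 := by
    refine eq_zero_of_det (a := P.M1) (b := -(P.β ^ 2 * P.cE)) (c := P.β ^ 2 * P.cE)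
      (d := P.M2) ?_ ?_ ?_
    · convert hM using 1
      unfold Params.M; ring
    · rw [M1_eq]
      linear_combination hoff huv
    · unfold Params.M2
      linear_combination hdiag u
  obtain ⟨hs, -, hd⟩ := hY
  have hll := hd (Fin.last (n + 2 + 1)) (Fin.last (n + 2)).castSucc (by simp; omega) (by simp)
  ext a b
  rw [Pi.zero_apply, Pi.zero_apply]
  induction a using Fin.lastCases with
  | last =>
    induction b using Fin.lastCases with
    | last => rw [hll, hc.last_diag, z1]
    | cast b =>
      induction b using Fin.lastCases with
      | last => rw [hs, hc.last_off, z0]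
      | cast b => rw [hs, hc.right', z0, (e1 b).1, add_zero]
  | cast a =>
    induction a using Fin.lastCases with
    | last =>
      induction b using Fin.lastCases with
      | last => rw [hc.last_off, z0]
      | cast b =>
        induction b using Fin.lastCases with
        | last => rw [hc.last_diag, z1]
        | cast b => rw [hc.left, z0, (e1 b).1, add_zero]
    | cast a =>
      induction b using Fin.lastCases with
      | last => rw [hc.right', z0, (e1 a).1, add_zero]
      | cast b =>
        induction b using Fin.lastCases with
        | last => rw [hc.right, z0, (e1 a).1, add_zero]
        | cast b =>
          by_cases h : a = b
          · subst h; rw [hc.diag, z1, (e1 a).2, add_zero]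
          · rw [hc.off _ _ h, e2, z0, (e1 a).1, (e1 b).1]; simp

/-- The linear system is stable: its residuals bound the array. -/
lemma exists_abs_le_of_relationOp (hP : P.Admissible) (n : ℕ) :
    ∃ K : ℝ, 0 ≤ K ∧ ∀ Y ∈ replicaArrays n (n + 2 + 2), ∀ r : ℝ, 0 ≤ r →
      (∀ k l, |relationOp P (n + 2) Y k l| ≤ r) → ∀ a b, |Y a b| ≤ K * r := by
  obtain ⟨K, -, hK⟩ := LinearMap.exists_antilipschitzWith
    ((relationOp P (n + 2)).domRestrict (replicaArrays n (n + 2 + 2))) (by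
      rw [LinearMap.ker_eq_bot']
      rintro ⟨Y, hY⟩ h
      exact Subtype.ext (eq_zero_of_relationOp_eq_zero hP hY h))
  refine ⟨K, K.2, fun Y hY r hr h a b => ?_⟩
  have h1 := hK.le_mul_dist ⟨Y, hY⟩ 0
  rw [map_zero, dist_zero_right, dist_zero_right] at h1
  have h2 : ‖Y a b‖ ≤ ‖Y‖ := (norm_le_pi_norm (Y a) b).trans (norm_le_pi_norm Y a)
  have h3 : ‖relationOp P (n + 2) Y‖ ≤ r :=
    (pi_norm_le_iff_of_nonneg hr).2 fun k => (pi_norm_le_iff_of_nonneg hr).2 fun l => h k l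
  calc |Y a b| ≤ ‖Y‖ := h2
    _ ≤ K * ‖relationOp P (n + 2) Y‖ := h1
    _ ≤ K * r := by gcongr

/-- The covariances of the limiting Gaussian of the pair `(f₁, f₂)` of replicas, with those of all
pairs of replicas. -/
def etaArray (P : Params) {γ : Type*} [DecidableEq γ] (f₁ f₂ a b : γ) : ℝ :=
  if f₁ = f₂ then
    if a = b then P.B1sq * ind f₁ a + P.B0sq else P.C1sq * (ind f₁ a + ind f₁ b) + P.C0sq
  else
    if a = b then P.C1sq * (ind f₁ a + ind f₂ a) + P.C0sq
    else P.A2sq * (ind f₁ a * ind f₂ b + ind f₂ a * ind f₁ b)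
      + P.A1sq * ((ind f₁ a + ind f₂ a) + (ind f₁ b + ind f₂ b)) + P.A0sq

lemma sum_ind {γ : Type*} [Fintype γ] [DecidableEq γ] (k : γ) : ∑ a, ind k a = 1 := by
  simp [ind]

variable {n : ℕ}

lemma hasComponents_etaArray_diag (f : Fin n) :
    HasComponents (etaArray P f.castSucc.castSucc f.castSucc.castSucc) (fun _ _ => 0)
      (fun a => P.C1sq * ind f a) (fun a => P.B1sq * ind f a) P.C0sq P.B0sq where
  diag_zero _ := rfl
  symm _ _ := rfl
  off a b h := by
    have h' : a.castSucc.castSucc ≠ b.castSucc.castSucc :=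
      fun e => h (castSucc_castSucc_injective n e)
    simp only [etaArray, if_true, if_neg h', ind_castSucc₂]; ring
  diag a := by simp only [etaArray, if_true, ind_castSucc₂]
  right a := by
    simp only [etaArray, if_true, if_neg (castSucc₂_ne_last_castSucc a), ind_castSucc₂,
      ind_castSucc₂_last_castSucc]; ring
  right' a := by
    simp only [etaArray, if_true, if_neg (castSucc₂_ne_last a), ind_castSucc₂,
      ind_castSucc₂_last]; ring
  left a := by
    simp only [etaArray, if_true, if_neg (castSucc₂_ne_last_castSucc a).symm, ind_castSucc₂,
      ind_castSucc₂_last_castSucc]; ring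
  last_diag := by
    simp only [etaArray, if_true, ind_castSucc₂_last_castSucc]; ring
  last_off := by
    simp only [etaArray, if_true, if_neg (Fin.castSucc_lt_last (Fin.last n)).ne,
      ind_castSucc₂_last_castSucc, ind_castSucc₂_last]; ring

lemma hasComponents_etaArray_off {f₁ f₂ : Fin n} (hf : f₁ ≠ f₂) :
    HasComponents (etaArray P f₁.castSucc.castSucc f₂.castSucc.castSucc)
      (fun a b => P.A2sq * (ind f₁ a * ind f₂ b + ind f₂ a * ind f₁ b))
      (fun a => P.A1sq * (ind f₁ a + ind f₂ a)) (fun a => P.C1sq * (ind f₁ a + ind f₂ a))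
      P.A0sq P.C0sq := by
  have hf' : f₁.castSucc.castSucc ≠ f₂.castSucc.castSucc :=
    fun h => hf (castSucc_castSucc_injective n h)
  exact {
    diag_zero := fun a => by
      by_cases h : a = f₁
      · subst h; simp [ind_of_ne hf]
      · simp [ind_of_ne h]
    symm := fun a b => by ring
    off := fun a b h => by
      have h' : a.castSucc.castSucc ≠ b.castSucc.castSucc :=
        fun e => h (castSucc_castSucc_injective n e)
      simp only [etaArray, if_neg hf', if_neg h', ind_castSucc₂]; ring
    diag := fun a => by simp only [etaArray, if_true, if_neg hf', ind_castSucc₂]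
    right := fun a => by
      simp only [etaArray, if_neg hf', if_neg (castSucc₂_ne_last_castSucc a), ind_castSucc₂,
        ind_castSucc₂_last_castSucc]; ring
    right' := fun a => by
      simp only [etaArray, if_neg hf', if_neg (castSucc₂_ne_last a), ind_castSucc₂,
        ind_castSucc₂_last]; ring
    left := fun a => by
      simp only [etaArray, if_neg hf', if_neg (castSucc₂_ne_last_castSucc a).symm, ind_castSucc₂,
        ind_castSucc₂_last_castSucc]; ring
    last_diag := by
      simp only [etaArray, if_neg hf', if_true, ind_castSucc₂_last_castSucc]; ring
    last_off := by
      simp only [etaArray, if_neg hf', if_neg (Fin.castSucc_lt_last (Fin.last n)).ne,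
        ind_castSucc₂_last_castSucc, ind_castSucc₂_last]; ring }

/-- The limiting covariances solve the linear system. -/
lemma relationOp_etaArray (hP : P.Admissible) (f₁ f₂ k l : Fin n) :
    relationOp P n (etaArray P f₁.castSucc.castSucc f₂.castSucc.castSucc) k l
      = siteCov P k l f₁ f₂ := by
  by_cases hf : f₁ = f₂
  · subst hf
    have hc := hasComponents_etaArray_diag (P := P) f₁
    by_cases hkl : k = l
    · subst hkl
      rw [relationOp_diag hP hc, siteCov_diag hP]
      simp only [Finset.sum_const_zero, ← Finset.mul_sum, sum_ind]
      have h1 := B1sq_eq hP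
      have h2 := B0sq_eq hP
      have e1 : ind k f₁ = ind f₁ k := by simp only [ind, eq_comm]
      rw [e1]
      unfold Params.M2 at h1 h2
      linear_combination ind f₁ k * h1 + h2
    · rw [relationOp_off hP hc hkl, siteCov_diag_right hP hkl]
      simp only [Finset.sum_const_zero, ← Finset.mul_sum, sum_ind]
      have h1 := C1sq_eq' hP
      have h2 := C0sq_eq' hP
      have e1 : ∀ k, ind k f₁ = ind f₁ k := fun k => by simp only [ind, eq_comm]
      rw [e1, e1]
      rw [M1_eq] at h1 h2
      linear_combination (ind f₁ k + ind f₁ l) * h1 + h2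
  · have hc := hasComponents_etaArray_off (P := P) hf
    have hs : ∀ k, ∑ b, P.A2sq * (ind f₁ k * ind f₂ b + ind f₂ k * ind f₁ b)
        = P.A2sq * (ind f₁ k + ind f₂ k) := fun k => by
      simp only [← Finset.mul_sum, Finset.sum_add_distrib, sum_ind, mul_one]
    have e1 : ∀ f k : Fin n, ind k f = ind f k := fun f k => by simp only [ind, eq_comm]
    by_cases hkl : k = l
    · subst hkl
      rw [relationOp_diag hP hc, siteCov_diag_left hP _ hf]
      simp only [hs]
      simp only [← Finset.mul_sum, Finset.sum_add_distrib, sum_ind]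
      have h1 := C1sq_eq hP
      have h2 := C0sq_eq hP
      rw [e1 f₁, e1 f₂]
      unfold Params.M2 at h1 h2
      linear_combination (ind f₁ k + ind f₂ k) * h1 + h2
    · rw [relationOp_off hP hc hkl, siteCov_of_ne hP hkl hf]
      simp only [hs]
      simp only [← Finset.mul_sum, Finset.sum_add_distrib, sum_ind]
      have h1 := A1sq_eq hP
      have h2 := A0sq_eq hP
      have h3 := A2sq_eq hP
      rw [e1 f₁ k, e1 f₁ l, e1 f₂ k, e1 f₂ l]
      rw [M1_eq] at h1 h2
      rw [M3_eq] at h3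
      linear_combination (ind f₁ k + ind f₂ k + ind f₁ l + ind f₂ l) * h1 + h2
        + (ind f₁ k * ind f₂ l + ind f₂ k * ind f₁ l) * h3

lemma etaArray_mem_replicaArrays {m : ℕ} {f₁ f₂ : Fin m} (h₁ : (f₁ : ℕ) < n) (h₂ : (f₂ : ℕ) < n) :
    etaArray P f₁ f₂ ∈ replicaArrays n m := by
  have hi₁ : ∀ o : Fin m, n ≤ (o : ℕ) → ind f₁ o = 0 :=
    fun o ho => ind_of_ne fun h => by rw [h] at ho; omega
  have hi₂ : ∀ o : Fin m, n ≤ (o : ℕ) → ind f₂ o = 0 :=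
    fun o ho => ind_of_ne fun h => by rw [h] at ho; omega
  refine ⟨fun a b => ?_, fun a o o' ha ha' ho ho' => ?_, fun o o' ho ho' => ?_⟩
  · by_cases h : a = b
    · subst h; rfl
    · simp only [etaArray, if_neg h, if_neg (Ne.symm h)]
      split_ifs <;> ring
  · simp only [etaArray, if_neg ha, if_neg ha', hi₁ o ho, hi₁ o' ho', hi₂ o ho, hi₂ o' ho']
  · simp only [etaArray, if_true, hi₁ o ho, hi₁ o' ho', hi₂ o ho, hi₂ o' ho']

end Invertibility

/-! ### The recursion for the moments of overlaps -/

section Recursion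

variable {P : Params} {n : ℕ} {α : Type*}

lemma relationOp_apply (Y : Fin (n + 2) → Fin (n + 2) → ℝ) (k l : Fin n) :
    relationOp P n Y k l = Y k.castSucc.castSucc l.castSucc.castSucc - P.β ^ 2 / 2 * ∑ a, ∑ b,
      tiltWeight₁ n a * tiltWeight₂ n b
        * (siteCov P k.castSucc.castSucc l.castSucc.castSucc a b * Y a b) := rfl

lemma dev_symm {N : ℕ} (x : Fin n → Config N P.S) (k l : Fin n) : dev P x k l = dev P x l k := by
  unfold dev overlap
  simp only [mul_comm, eq_comm]

lemma devProd_comp {N m : ℕ} {i : Fin n → Fin m} (hi : Function.Injective i)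
    (e : α → Fin n × Fin n) (s : Finset α) (x : Fin m → Config N P.S) :
    devProd P e s (x ∘ i) = devProd P (fun a => (i (e a).1, i (e a).2)) s x := by
  simp only [devProd, dev_comp hi]

/-- Replicas that do not enter a product of overlaps are exchangeable in its moments. -/
lemma nu_devProd_mem_replicaArrays (N : ℕ) {m : ℕ} {e : α → Fin m × Fin m} {s : Finset α}
    (he : ∀ a ∈ s, ((e a).1 : ℕ) < n ∧ ((e a).2 : ℕ) < n) :
    (fun a b => nu P.β P.D P.h
      (fun x : Fin m → Config N P.S => devProd P e s x * dev P x a b)) ∈ replicaArrays n m := by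
  have hswap : ∀ o o' : Fin m, n ≤ (o : ℕ) → n ≤ (o' : ℕ) → ∀ a b : Fin m,
      nu P.β P.D P.h (fun x : Fin m → Config N P.S => devProd P e s x * dev P x a b)
      = nu P.β P.D P.h (fun x : Fin m → Config N P.S => devProd P e s x
        * dev P x (Equiv.swap o o' a) (Equiv.swap o o' b)) := by
    intro o o' ho ho' a b
    rw [← nu_comp_injective P.β P.D P.h (Equiv.swap o o').injective]
    congr 1
    ext x
    rw [devProd_comp (Equiv.swap o o').injective, dev_comp (Equiv.swap o o').injective]
    congr 1
    refine Finset.prod_congr rfl fun c hc => ?_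
    have h : ∀ k : Fin m, (k : ℕ) < n → Equiv.swap o o' k = k := fun k hk =>
      Equiv.swap_apply_of_ne_of_ne (fun h => by rw [h] at hk; omega)
        (fun h => by rw [h] at hk; omega)
    dsimp only
    rw [h _ (he c hc).1, h _ (he c hc).2]
  refine ⟨fun a b => ?_, fun a o o' ha ha' ho ho' => ?_, fun o o' ho ho' => ?_⟩
  · simp only [dev_symm]
  · beta_reduce
    rw [hswap o o' ho ho' a o, Equiv.swap_apply_of_ne_of_ne ha ha', Equiv.swap_apply_left]
  · beta_reduce
    rw [hswap o o' ho ho' o o, Equiv.swap_apply_left]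

variable [DecidableEq α]

/-- Up to a smaller error, the moments of the overlaps satisfy the recursion of the moments of a
Gaussian family with covariances `etaArray / N`. -/
lemma exists_nu_devProd_mul_dev (hP : P.Admissible) (e : α → Fin n × Fin n) (k l : Fin n)
    (s : Finset α) :
    ∃ C : ℝ, 0 ≤ C ∧ ∀ N : ℕ, 1 ≤ N →
      |nu P.β P.D P.h (fun x : Fin n → Config N P.S => devProd P e s x * dev P x k l)
        - 1 / (N : ℝ) * ∑ a ∈ s, etaArray P (e a).1 (e a).2 k l
          * nu P.β P.D P.h (fun x : Fin n → Config N P.S => devProd P e (s.erase a) x)|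
      ≤ C * (√(N : ℝ))⁻¹ ^ (s.card + 2) := by
  obtain ⟨K, hK0, hK⟩ := exists_abs_le_of_relationOp hP n
  -- Two replicas are added, so that the linear system is invertible.
  have hi := castSucc_castSucc_injective n
  have hj := castSucc_castSucc_injective (n + 2)
  set e' : α → Fin (n + 2) × Fin (n + 2) :=
    fun a => ((e a).1.castSucc.castSucc, (e a).2.castSucc.castSucc) with he'
  set e'' : α → Fin (n + 2 + 2) × Fin (n + 2 + 2) :=
    fun a => ((e' a).1.castSucc.castSucc, (e' a).2.castSucc.castSucc) with he''
  choose C hC0 hC using fun k l => exists_moment_relation e' hP k l s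
  refine ⟨K * ∑ k, ∑ l, C k l, mul_nonneg hK0
    (Finset.sum_nonneg fun k _ => Finset.sum_nonneg fun l _ => hC0 k l), fun N hN => ?_⟩
  set Y : Fin (n + 2 + 2) → Fin (n + 2 + 2) → ℝ := fun a b => nu P.β P.D P.h
    (fun x : Fin (n + 2 + 2) → Config N P.S => devProd P e'' s x * dev P x a b) with hY
  set c : α → ℝ := fun a => 1 / (N : ℝ)
    * nu P.β P.D P.h (fun x : Fin n → Config N P.S => devProd P e (s.erase a) x) with hc
  have hYa : ∀ a b, Y a b = nu P.β P.D P.h (fun x : Fin (n + 2 + 2) → Config N P.S =>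
      devProd P e' s (fun k => x k.castSucc.castSucc) * dev P x a b) := fun a b => by
    rw [hY]
    dsimp only
    refine congrArg _ (funext fun x => ?_)
    rw [← devProd_comp hj e' s x]
    rfl
  have hYe : ∀ k l : Fin (n + 2), Y k.castSucc.castSucc l.castSucc.castSucc
      = nu P.β P.D P.h
        (fun x : Fin (n + 2) → Config N P.S => devProd P e' s x * dev P x k l) := fun k l => by
    rw [← nu_comp_injective P.β P.D P.h hj]
    simp only [devProd_comp hj, dev_comp hj]
    rfl
  have hYe' : ∀ k l : Fin n,
      Y k.castSucc.castSucc.castSucc.castSucc l.castSucc.castSucc.castSucc.castSucc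
      = nu P.β P.D P.h
        (fun x : Fin n → Config N P.S => devProd P e s x * dev P x k l) := fun k l => by
    rw [hYe, ← nu_comp_injective P.β P.D P.h hi]
    simp only [devProd_comp hi, dev_comp hi]
    rfl
  have hce : ∀ a, c a = 1 / (N : ℝ)
      * nu P.β P.D P.h (fun x : Fin (n + 2) → Config N P.S => devProd P e' (s.erase a) x) :=
    fun a => by
      simp only [hc]
      rw [← nu_comp_injective P.β P.D P.h hi]
      simp only [devProd_comp hi]
      rfl
  set Δ : Fin (n + 2 + 2) → Fin (n + 2 + 2) → ℝ :=
    Y - ∑ a ∈ s, c a • etaArray P (e'' a).1 (e'' a).2 with hΔ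
  have hmem : Δ ∈ replicaArrays n (n + 2 + 2) := by
    refine Submodule.sub_mem _ (nu_devProd_mem_replicaArrays N fun a _ => ?_)
      (Submodule.sum_mem _ fun a _ => Submodule.smul_mem _ _ (etaArray_mem_replicaArrays ?_ ?_))
    all_goals simp [he'', he']
  have hres : ∀ k l, |relationOp P (n + 2) Δ k l|
      ≤ (∑ k, ∑ l, C k l) * (√(N : ℝ))⁻¹ ^ (s.card + 2) := by
    intro k l
    have h1 : relationOp P (n + 2) Δ k l = relationOp P (n + 2) Y k l
        - ∑ a ∈ s, c a * siteCov P k l (e' a).1 (e' a).2 := by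
      rw [hΔ, map_sub, map_sum]
      simp only [map_smul, Pi.sub_apply, Finset.sum_apply, Pi.smul_apply, smul_eq_mul]
      congr 1
      exact Finset.sum_congr rfl fun a _ => by rw [he'', relationOp_etaArray hP]
    have h2 := hC k l N hN
    have h3 : C k l ≤ ∑ k, ∑ l, C k l :=
      (Finset.single_le_sum (f := fun l => C k l) (fun l _ => hC0 k l) (Finset.mem_univ l)).trans
        (Finset.single_le_sum (f := fun k => ∑ l, C k l)
          (fun k _ => Finset.sum_nonneg fun l _ => hC0 k l) (Finset.mem_univ k))
    have h4 : ∑ a ∈ s, c a * siteCov P k l (e' a).1 (e' a).2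
        = ∑ a ∈ s, 1 / (N : ℝ) * (siteCov P k l (e' a).1 (e' a).2 * nu P.β P.D P.h
          (fun x : Fin (n + 2) → Config N P.S => devProd P e' (s.erase a) x)) :=
      Finset.sum_congr rfl fun a _ => by rw [hce]; ring
    rw [h1, relationOp_apply, h4, hYe]
    simp only [hYa]
    exact h2.trans (mul_le_mul_of_nonneg_right h3 (by positivity))
  have hfin := hK Δ hmem _ (mul_nonneg (Finset.sum_nonneg fun k _ =>
    Finset.sum_nonneg fun l _ => hC0 k l) (by positivity)) hres
    k.castSucc.castSucc.castSucc.castSucc l.castSucc.castSucc.castSucc.castSucc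
  rw [← mul_assoc] at hfin
  refine le_trans (le_of_eq ?_) hfin
  rw [hΔ]
  simp only [Pi.sub_apply, Finset.sum_apply, Pi.smul_apply, smul_eq_mul]
  rw [hYe', Finset.mul_sum]
  congr 2
  refine Finset.sum_congr rfl fun a _ => ?_
  have : etaArray P (e'' a).1 (e'' a).2 k.castSucc.castSucc.castSucc.castSucc
      l.castSucc.castSucc.castSucc.castSucc = etaArray P (e a).1 (e a).2 k l := by
    simp only [he'', he', etaArray, ind_castSucc₂, Fin.castSucc_inj]
  rw [this]
  simp only [hc]
  ring

end Recursion

/-! ### Gaussian families and their moments -/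

section GaussianFamily

open scoped Matrix

variable {ι : Type*} [Fintype ι]

instance : IsGaussian (stdGauss ι) := by
  have h : (stdGaussian (EuclideanSpace ℝ ι)).map (EuclideanSpace.equiv ι ℝ) = stdGauss ι := by
    rw [← map_pi_eq_stdGaussian, Measure.map_map (by fun_prop) (by fun_prop)]
    exact Measure.map_id
  rw [← h]
  infer_instance

lemma integrable_prod_strongDual {E : Type*} [NormedAddCommGroup E] [NormedSpace ℝ E]
    [MeasurableSpace E] [BorelSpace E] [SecondCountableTopology E] [CompleteSpace E]
    (μ : Measure E) [IsGaussian μ] {α : Type*} (s : Finset α) (L : α → StrongDual ℝ E) :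
    Integrable (fun g => ∏ a ∈ s, L a g) μ := by
  rcases s.eq_empty_or_nonempty with rfl | hs
  · simp
  · have h : MemLp (fun g => ∏ a ∈ s, L a g) (∑ _a ∈ s, ((s.card : ENNReal))⁻¹)⁻¹ μ :=
      MemLp.prod' fun a _ => IsGaussian.memLp_dual μ (L a) _ (ENNReal.natCast_ne_top _)
    have h1 : (∑ _a ∈ s, ((s.card : ENNReal))⁻¹)⁻¹ = 1 := by
      rw [Finset.sum_const, nsmul_eq_mul, ENNReal.mul_inv_cancel, inv_one]
      · simpa using hs.ne_empty
      · exact ENNReal.natCast_ne_top _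
    rw [h1] at h
    exact memLp_one_iff_integrable.1 h

/-- The law of `B g`, for a vector `g` of independent standard Gaussian variables. -/
def gaussianFamily (B : Matrix ι ι ℝ) : Measure (ι → ℝ) :=
  (stdGauss ι).map (LinearMap.toContinuousLinearMap B.mulVecLin)

instance (B : Matrix ι ι ℝ) : IsGaussian (gaussianFamily B) := by
  unfold gaussianFamily; infer_instance

lemma integral_gaussianFamily (B : Matrix ι ι ℝ) {f : (ι → ℝ) → ℝ} (hf : Measurable f) :
    ∫ y, f y ∂(gaussianFamily B) = ∫ g, f (B *ᵥ g) ∂(stdGauss ι) := by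
  unfold gaussianFamily
  rw [integral_map (by fun_prop) hf.aestronglyMeasurable]
  rfl

/-- Gaussian integration by parts for products of linear functions. -/
lemma integral_mul_prod_gaussianFamily [DecidableEq ι] (B : Matrix ι ι ℝ) {α : Type*}
    [DecidableEq α] (s : Finset α) (e : α → ι) (k : ι) :
    ∫ y, y k * ∏ a ∈ s, y (e a) ∂(gaussianFamily B)
      = ∑ a ∈ s, (B * Bᵀ) k (e a) * ∫ y, ∏ b ∈ s.erase a, y (e b) ∂(gaussianFamily B) := by
  have hm : ∀ t : Finset α, Measurable fun y : ι → ℝ => ∏ a ∈ t, y (e a) := fun t => by fun_prop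
  rw [integral_gaussianFamily B (by fun_prop)]
  simp only [integral_gaussianFamily B (hm _)]
  set L : ι → StrongDual ℝ (ι → ℝ) := fun i =>
    (ContinuousLinearMap.proj (R := ℝ) (φ := fun _ : ι => ℝ) i).comp
      (LinearMap.toContinuousLinearMap B.mulVecLin) with hL
  have hLe : ∀ i g, (B *ᵥ g) i = L i g := fun i g => rfl
  have hint : ∀ t : Finset α, Integrable (fun g => ∏ a ∈ t, L (e a) g) (stdGauss ι) :=
    fun t => integrable_prod_strongDual _ t _
  have hint' : ∀ (j : ι) (t : Finset α),
      Integrable (fun g => g j * ∏ a ∈ t, L (e a) g) (stdGauss ι) := fun j t => by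
    have := integrable_prod_strongDual (stdGauss ι) (Finset.insertNone t)
      (fun o : Option α => o.elim (ContinuousLinearMap.proj (R := ℝ) (φ := fun _ : ι => ℝ) j)
        (fun a => L (e a)))
    simpa [Finset.prod_insertNone] using this
  simp only [hLe]
  have hk : ∀ g, L k g * ∏ a ∈ s, L (e a) g
      = ∑ j, B k j * (g j * ∏ a ∈ s, L (e a) g) := fun g => by
    rw [← hLe, Matrix.mulVec, dotProduct, Finset.sum_mul]
    exact Finset.sum_congr rfl fun j _ => by ring
  have hstein : ∀ j, ∫ g, g j * ∏ a ∈ s, L (e a) g ∂(stdGauss ι)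
      = ∑ a ∈ s, B (e a) j * ∫ g, ∏ b ∈ s.erase a, L (e b) g ∂(stdGauss ι) := fun j => by
    rw [integral_stdGauss_coord_mul j
      (φ' := fun g => ∑ a ∈ s, (∏ b ∈ s.erase a, L (e b) g) • B (e a) j) ?_ (hint s) ?_
      (hint' j s)]
    · rw [integral_finsetSum]
      · refine Finset.sum_congr rfl fun a _ => ?_
        simp only [smul_eq_mul]
        rw [integral_mul_const, mul_comm]
      · exact fun a _ => (hint _).mul_const _
    · intro g
      have := HasDerivAt.fun_finsetProd (u := s)
        (f := fun a t => L (e a) (Function.update g j t)) (f' := fun a => B (e a) j) (x := g j)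
        (fun a _ => by
          have h1 : ∀ t, L (e a) (Function.update g j t)
              = L (e a) g + (t - g j) * B (e a) j := fun t => by
            have : Function.update g j t = g + (t - g j) • Pi.single j (1 : ℝ) := by
              ext i
              by_cases h : i = j
              · subst h; simp
              · simp [h]
            rw [this, map_add, map_smul, smul_eq_mul]
            congr 2
            rw [← hLe]
            simp
          simp only [h1]
          simpa using (((hasDerivAt_id (g j)).sub_const (g j)).mul_const (B (e a) j)).const_add
            (L (e a) g))
      simpa using this
    · exact integrable_finsetSum _ fun a _ => (hint _).mul_const _
  simp only [hk]
  rw [integral_finsetSum _ fun j _ => (hint' j s).const_mul _]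
  simp only [integral_const_mul, hstein, Finset.mul_sum]
  rw [Finset.sum_comm]
  refine Finset.sum_congr rfl fun a _ => ?_
  rw [Matrix.mul_apply, Finset.sum_mul]
  exact Finset.sum_congr rfl fun j _ => by rw [Matrix.transpose_apply]; ring

lemma integral_eval_gaussianFamily [DecidableEq ι] (B : Matrix ι ι ℝ) (k : ι) :
    ∫ y, y k ∂(gaussianFamily B) = 0 := by
  simpa using integral_mul_prod_gaussianFamily B (∅ : Finset ι) id k

lemma covariance_gaussianFamily [DecidableEq ι] (B : Matrix ι ι ℝ) (k l : ι) :
    covariance (fun y => y k) (fun y => y l) (gaussianFamily B) = (B * Bᵀ) k l := by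
  unfold covariance
  simp only [integral_eval_gaussianFamily, sub_zero]
  simpa using integral_mul_prod_gaussianFamily B {l} id k

end GaussianFamily

/-! ### Convergence of the moments -/

section Convergence

open Filter Topology
open scoped Matrix

variable {P : Params} {n : ℕ}

/-- The case distinction by common replicas, in terms of indicators. -/
lemma etaCov_eq_etaArray (e f : RPair n) :
    etaCov P e f = etaArray P f.1.1 f.1.2 e.1.1 e.1.2 := by
  obtain ⟨⟨a, b⟩, hab⟩ := e
  obtain ⟨⟨c, d⟩, hcd⟩ := f
  simp only at hab hcd
  simp only [etaCov, RPair.supp, etaArray]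
  by_cases h1 : a = b
  · subst h1
    by_cases h2 : c = d
    · subst h2
      by_cases h3 : a = c
      · subst h3; simp [ind]
      · simp [ind, h3]
    · by_cases h3 : a = c
      · subst h3; simp [ind, h2, Finset.card_pair h2]
      · by_cases h4 : a = d
        · subst h4; simp [ind, h2, h3, Finset.card_pair h2]
        · simp [ind, h2, h3, h4, Finset.card_pair h2]
  · by_cases h2 : c = d
    · subst h2
      by_cases h3 : a = c
      · subst h3; simp [ind, h1, Ne.symm h1, Finset.card_pair h1]
      · by_cases h4 : b = c
        · subst h4; simp [ind, h1, Finset.card_pair h1]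
        · simp [ind, h1, h3, h4, Finset.card_pair h1]
    · have h1' : ¬ b = a := fun h => h1 h.symm
      have h2' : ¬ d = c := fun h => h2 h.symm
      by_cases h3 : a = c
      · subst h3
        by_cases h4 : b = d
        · subst h4
          simp [ind, h1, h1', Finset.card_pair h1]
          ring
        · simp [ind, h1, h1', h2, h4, Finset.card_pair h1, Finset.card_pair h2,
            Finset.inter_insert_of_mem]
      · by_cases h4 : a = d
        · subst h4
          by_cases h5 : b = c
          · subst h5
            simp [ind, h1, h1', Finset.card_pair h1, Finset.pair_comm b a]
            ring
          · simp [ind, h1, h1', h2, h2', h5, Finset.card_pair h1, Finset.card_pair h2]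
        · by_cases h5 : b = c
          · subst h5
            simp [ind, h1, h1', h2, h2', h4, Finset.card_pair h1, Finset.card_pair h2]
          · by_cases h6 : b = d
            · subst h6
              simp [ind, h1, h2, h2', h3, Finset.card_pair h1, Finset.card_pair h2]
            · simp [ind, h1, h2, h3, h4, h5, h6, Finset.card_pair h1, Finset.card_pair h2]

lemma etaCov_symm (e f : RPair n) : etaCov P e f = etaCov P f e := by
  unfold etaCov
  simp only [Finset.inter_comm e.supp, and_comm]

lemma tendsto_inv_sqrt : Tendsto (fun N : ℕ => (√(N : ℝ))⁻¹) atTop (𝓝 0) :=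
  tendsto_inv_atTop_zero.comp (Real.tendsto_sqrt_atTop.comp tendsto_natCast_atTop_atTop)

lemma tendsto_nu_dev_mul_dev (hP : P.Admissible) (e f : RPair n) :
    Tendsto (fun N : ℕ => (N : ℝ) * nu P.β P.D P.h (fun x : Fin n → Config N P.S =>
      dev P x e.1.1 e.1.2 * dev P x f.1.1 f.1.2)) atTop (𝓝 (etaCov P e f)) := by
  obtain ⟨C, hC0, hC⟩ := exists_nu_devProd_mul_dev hP (fun e : RPair n => e.1) f.1.1 f.1.2 {e}
  rw [tendsto_iff_norm_sub_tendsto_zero]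
  refine squeeze_zero' (Eventually.of_forall fun _ => norm_nonneg _) ?_
    (by simpa using tendsto_inv_sqrt.const_mul C)
  filter_upwards [eventually_ge_atTop 1] with N hN
  have hN' : (0 : ℝ) < N := by exact_mod_cast hN
  have h := hC N hN
  simp only [Finset.sum_singleton, Finset.card_singleton, Finset.erase_singleton, devProd,
    Finset.prod_singleton, Finset.prod_empty, nu_const, mul_one] at h
  rw [← etaCov_eq_etaArray, etaCov_symm] at h
  rw [Real.norm_eq_abs]
  have h1 : ∀ v : ℝ, (N : ℝ) * v - etaCov P e f = N * (v - 1 / N * etaCov P e f) := fun v => by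
    field_simp
  rw [h1, abs_mul, abs_of_pos hN']
  refine (mul_le_mul_of_nonneg_left h hN'.le).trans (le_of_eq ?_)
  have h2 : (N : ℝ) * (√(N : ℝ))⁻¹ ^ 2 = 1 := by
    rw [← one_div_eq_inv_sqrt_sq]; field_simp
  linear_combination C * (√(N : ℝ))⁻¹ * h2

/-- `etaCov` is the limit of the matrices of the second moments of `√N * dev`. -/
lemma posSemidef_etaCov (hP : P.Admissible) :
    (Matrix.of (etaCov P) : Matrix (RPair n) (RPair n) ℝ).PosSemidef := by
  refine Matrix.PosSemidef.of_dotProduct_mulVec_nonneg ?_ fun v => ?_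
  · ext e f
    simp only [Matrix.conjTranspose_apply, Matrix.of_apply, star_trivial]
    exact etaCov_symm f e
  · have h1 : star v ⬝ᵥ (Matrix.of (etaCov P) *ᵥ v)
        = ∑ e, ∑ f, v e * v f * etaCov P e f := by
      simp only [dotProduct, Matrix.mulVec, Pi.star_apply, star_trivial, Matrix.of_apply,
        Finset.mul_sum]
      exact Finset.sum_congr rfl fun e _ => Finset.sum_congr rfl fun f _ => by ring
    rw [h1]
    have ht : Tendsto (fun N : ℕ => ∑ e : RPair n, ∑ f : RPair n, v e * v f * ((N : ℝ)
        * nu P.β P.D P.h (fun x : Fin n → Config N P.S =>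
          dev P x e.1.1 e.1.2 * dev P x f.1.1 f.1.2))) atTop
        (𝓝 (∑ e, ∑ f, v e * v f * etaCov P e f)) :=
      tendsto_finsetSum _ fun e _ => tendsto_finsetSum _ fun f _ =>
        (tendsto_nu_dev_mul_dev hP e f).const_mul _
    refine ge_of_tendsto' ht fun N => ?_
    have h2 : ∑ e : RPair n, ∑ f : RPair n, v e * v f * ((N : ℝ)
        * nu P.β P.D P.h (fun x : Fin n → Config N P.S =>
          dev P x e.1.1 e.1.2 * dev P x f.1.1 f.1.2))
        = N * nu P.β P.D P.h (fun x : Fin n → Config N P.S =>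
          (∑ e : RPair n, v e * dev P x e.1.1 e.1.2) ^ 2) := by
      have h3 : (fun x : Fin n → Config N P.S => (∑ e : RPair n, v e * dev P x e.1.1 e.1.2) ^ 2)
          = fun x => ∑ e : RPair n, ∑ f : RPair n,
            v e * v f * (dev P x e.1.1 e.1.2 * dev P x f.1.1 f.1.2) := by
        ext x
        rw [sq, Finset.sum_mul_sum]
        exact Finset.sum_congr rfl fun e _ => Finset.sum_congr rfl fun f _ => by ring
      rw [h3, nu_sum, Finset.mul_sum]
      refine Finset.sum_congr rfl fun e _ => ?_
      rw [nu_sum, Finset.mul_sum]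
      refine Finset.sum_congr rfl fun f _ => ?_
      rw [nu_const_mul]
      ring
    rw [h2]
    exact mul_nonneg (Nat.cast_nonneg _) (nu_nonneg _ _ _ fun x => sq_nonneg _)

lemma exists_mul_transpose_eq_etaCov (hP : P.Admissible) (n : ℕ) :
    ∃ B : Matrix (RPair n) (RPair n) ℝ, ∀ e f, (B * Bᵀ) e f = etaCov P e f := by
  open scoped MatrixOrder in
  obtain ⟨C, hC⟩ :=
    CStarAlgebra.nonneg_iff_eq_star_mul_self.mp (posSemidef_etaCov (n := n) hP).nonneg
  refine ⟨Cᵀ, fun e f => ?_⟩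
  have := congrFun (congrFun hC e) f
  rw [Matrix.of_apply, Matrix.star_eq_conjTranspose, Matrix.conjTranspose_eq_transpose_of_trivial]
    at this
  rw [Matrix.transpose_transpose, this]

/-- The rescaled moments of the overlaps converge to those of the Gaussian family: both satisfy
the same recursion, up to a small error. -/
lemma exists_moment_convergence (hP : P.Admissible) {B : Matrix (RPair n) (RPair n) ℝ}
    (hB : ∀ e f, (B * Bᵀ) e f = etaCov P e f) {α : Type*} [DecidableEq α] (e : α → RPair n)
    (s : Finset α) :
    ∃ K : ℝ, 0 ≤ K ∧ ∀ N : ℕ, 1 ≤ N →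
      |√(N : ℝ) ^ s.card * nu P.β P.D P.h
          (fun x : Fin n → Config N P.S => devProd P (fun a => (e a).1) s x)
        - ∫ y, ∏ a ∈ s, y (e a) ∂(gaussianFamily B)| ≤ K * (√(N : ℝ))⁻¹ := by
  induction s using Finset.strongInduction with
  | H s ih =>
    rcases s.eq_empty_or_nonempty with rfl | ⟨b, hb⟩
    · refine ⟨0, le_rfl, fun N _ => ?_⟩
      simp [devProd, nu_const]
    · set t := s.erase b with ht
      have hst : t ⊂ s := Finset.erase_ssubset hb
      have hcard : t.card + 1 = s.card := Finset.card_erase_add_one hb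
      obtain ⟨C, hC0, hC⟩ := exists_nu_devProd_mul_dev hP (fun a => (e a).1) (e b).1.1 (e b).1.2 t
      have ih' : ∀ a, ∃ K : ℝ, 0 ≤ K ∧ ∀ N : ℕ, 1 ≤ N →
          |√(N : ℝ) ^ (t.erase a).card * nu P.β P.D P.h
            (fun x : Fin n → Config N P.S => devProd P (fun a => (e a).1) (t.erase a) x)
          - ∫ y, ∏ a ∈ t.erase a, y (e a) ∂(gaussianFamily B)| ≤ K * (√(N : ℝ))⁻¹ := fun a =>
        ih _ ((Finset.erase_subset a t).trans_ssubset hst)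
      choose K hK0 hK using ih'
      refine ⟨C + ∑ a ∈ t, |etaCov P (e b) (e a)| * K a, add_nonneg hC0
        (Finset.sum_nonneg fun a _ => mul_nonneg (abs_nonneg _) (hK0 a)), fun N hN => ?_⟩
      have hN' : (0 : ℝ) < √(N : ℝ) := Real.sqrt_pos.2 (by exact_mod_cast hN)
      have hsq : (1 : ℝ) / N = (√(N : ℝ))⁻¹ ^ 2 := one_div_eq_inv_sqrt_sq N
      have hg : ∫ y, ∏ a ∈ s, y (e a) ∂(gaussianFamily B)
          = ∑ a ∈ t, etaCov P (e b) (e a) * ∫ y, ∏ a ∈ t.erase a, y (e a) ∂(gaussianFamily B) := by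
        simp only [← hB]
        rw [← integral_mul_prod_gaussianFamily B t e (e b)]
        exact integral_congr_ae (ae_of_all _ fun y =>
          (Finset.mul_prod_erase s (fun a => y (e a)) hb).symm)
      have hn : nu P.β P.D P.h (fun x : Fin n → Config N P.S => devProd P (fun a => (e a).1) s x)
          = nu P.β P.D P.h (fun x : Fin n → Config N P.S => devProd P (fun a => (e a).1) t x
            * dev P x (e b).1.1 (e b).1.2) := by
        congr 1
        ext x
        exact (Finset.prod_erase_mul s _ hb).symm
      have h1 := hC N hN
      simp only [← etaCov_eq_etaArray] at h1
      rw [hn, hg]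
      set V := nu P.β P.D P.h (fun x : Fin n → Config N P.S => devProd P (fun a => (e a).1) t x
        * dev P x (e b).1.1 (e b).1.2)
      set W : α → ℝ := fun a => nu P.β P.D P.h
        (fun x : Fin n → Config N P.S => devProd P (fun a => (e a).1) (t.erase a) x)
      set I : α → ℝ := fun a => ∫ y, ∏ a ∈ t.erase a, y (e a) ∂(gaussianFamily B)
      have hsplit : √(N : ℝ) ^ s.card * V - ∑ a ∈ t, etaCov P (e b) (e a) * I a
          = √(N : ℝ) ^ s.card * (V - 1 / (N : ℝ) * ∑ a ∈ t, etaCov P (e b) (e a) * W a)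
            + ∑ a ∈ t, etaCov P (e b) (e a) * (√(N : ℝ) ^ (t.erase a).card * W a - I a) := by
        have h2 : ∑ a ∈ t, etaCov P (e b) (e a) * (√(N : ℝ) ^ (t.erase a).card * W a - I a)
            = √(N : ℝ) ^ s.card * (1 / (N : ℝ) * ∑ a ∈ t, etaCov P (e b) (e a) * W a)
              - ∑ a ∈ t, etaCov P (e b) (e a) * I a := by
          rw [Finset.mul_sum, Finset.mul_sum, ← Finset.sum_sub_distrib]
          refine Finset.sum_congr rfl fun a ha => ?_
          have h3 : √(N : ℝ) ^ s.card * (1 / (N : ℝ)) = √(N : ℝ) ^ (t.erase a).card := by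
            rw [hsq, ← hcard, ← Finset.card_erase_add_one ha]
            field_simp
            ring
          rw [← h3]
          ring
        rw [h2]
        ring
      rw [hsplit]
      refine (abs_add_le _ _).trans ?_
      rw [add_mul, Finset.sum_mul]
      refine add_le_add ?_ ((Finset.abs_sum_le_sum_abs _ _).trans
        (Finset.sum_le_sum fun a _ => ?_))
      · rw [abs_mul, abs_of_pos (pow_pos hN' _)]
        refine (mul_le_mul_of_nonneg_left h1 (pow_pos hN' _).le).trans (le_of_eq ?_)
        rw [← hcard, mul_left_comm, pow_succ _ (t.card + 1), ← mul_assoc (√(N : ℝ) ^ _), ← mul_pow,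
          mul_inv_cancel₀ hN'.ne', one_pow, one_mul]
      · rw [abs_mul, mul_assoc]
        exact mul_le_mul_of_nonneg_left (hK a N hN) (abs_nonneg _)

lemma overlapMonomial_eq_devProd {N : ℕ} (m : RPair n → ℕ) (x : Fin n → Config N P.S) :
    overlapMonomial P.p P.q m x
      = devProd P (fun a : (e : RPair n) × Fin (m e) => a.1.1) Finset.univ x := by
  unfold devProd overlapMonomial
  rw [Fintype.prod_sigma]
  refine Finset.prod_congr rfl fun e _ => ?_
  change _ = ∏ _y : Fin (m e), dev P x e.1.1 e.1.2
  rw [Finset.prod_const, Finset.card_univ, Fintype.card_fin]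
  rfl

/-- The convergence of the moments, in the scaling by powers of the size of the system. -/
lemma exists_overlapMonomial_convergence (hP : P.Admissible)
    {B : Matrix (RPair n) (RPair n) ℝ} (hB : ∀ e f, (B * Bᵀ) e f = etaCov P e f)
    (m : RPair n → ℕ) :
    ∃ K : ℝ, ∀ N : ℕ, 1 ≤ N →
      |(N : ℝ) ^ (((∑ e, m e : ℕ) : ℝ) / 2)
          * nu (N := N) (S := P.S) P.β P.D P.h (overlapMonomial P.p P.q m)
        - ∫ x, ∏ e, x e ^ m e ∂(gaussianFamily B)| ≤ K * (N : ℝ) ^ (-(1 / 2) : ℝ) := by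
  obtain ⟨K, -, hK⟩ := exists_moment_convergence hP hB
    (fun a : (e : RPair n) × Fin (m e) => a.1) Finset.univ
  refine ⟨K, fun N hN => ?_⟩
  have h1 : (N : ℝ) ^ (((∑ e, m e : ℕ) : ℝ) / 2)
      = √(N : ℝ) ^ (Finset.univ : Finset ((e : RPair n) × Fin (m e))).card := by
    rw [Finset.card_univ, Fintype.card_sigma]
    simp only [Fintype.card_fin]
    rw [Real.sqrt_eq_rpow, ← Real.rpow_natCast, ← Real.rpow_mul (Nat.cast_nonneg _)]
    congr 1
    ring
  have h2 : (N : ℝ) ^ (-(1 / 2) : ℝ) = (√(N : ℝ))⁻¹ := by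
    rw [Real.rpow_neg (Nat.cast_nonneg _), Real.sqrt_eq_rpow]
  have h3 : (overlapMonomial P.p P.q m : (Fin n → Config N P.S) → ℝ)
      = devProd P (fun a : (e : RPair n) × Fin (m e) => a.1.1) Finset.univ :=
    funext (overlapMonomial_eq_devProd m)
  have h4 : ∀ y : RPair n → ℝ, ∏ e, y e ^ m e
      = ∏ a : (e : RPair n) × Fin (m e), y a.1 := fun y => by
    rw [Fintype.prod_sigma]
    simp
  rw [h1, h2, h3]
  simp only [h4]
  exact hK N hN

end Convergence

end GhatakSherrington

end

theorem theorem1 (S : ℕ) (hS : 1 ≤ S) :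
    ∃ β' : ℝ, 0 < β' ∧ ∀ β D h : ℝ, 0 ≤ β → β < β' → 0 ≤ h →
      (∃! pq : ℝ × ℝ, (GhatakSherrington.Params.mk S β D h pq.1 pq.2).IsFixedPoint) ∧
      ∀ p q : ℝ, (GhatakSherrington.Params.mk S β D h p q).IsFixedPoint →
        0 < (GhatakSherrington.Params.mk S β D h p q).M3 ∧
        0 < (GhatakSherrington.Params.mk S β D h p q).M ∧
        ∀ n : ℕ, ∃ η : MeasureTheory.Measure (GhatakSherrington.RPair n → ℝ),
          ProbabilityTheory.IsGaussian η ∧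
          (∀ e : GhatakSherrington.RPair n, ∫ x, x e ∂η = 0) ∧
          (∀ e f : GhatakSherrington.RPair n,
            ProbabilityTheory.covariance (fun x => x e) (fun x => x f) η
              = GhatakSherrington.etaCov (GhatakSherrington.Params.mk S β D h p q) e f) ∧
          ∀ m : GhatakSherrington.RPair n → ℕ, ∃ K : ℝ, ∀ N : ℕ, 1 ≤ N →
            |(N : ℝ) ^ (((∑ e, m e : ℕ) : ℝ) / 2)
                * GhatakSherrington.nu (N := N) (S := S) β D h
                    (GhatakSherrington.overlapMonomial p q m)
              - ∫ x, ∏ e, x e ^ m e ∂η| ≤ K * (N : ℝ) ^ (-(1 / 2) : ℝ) := by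
  open GhatakSherrington in
  have ht1 := tiltMass_nonneg 1
  have ht2 := tiltMass_nonneg 2
  have h1 : 0 ≤ (S : ℝ) ^ 4 * (tiltMass 1 + tiltMass 2) := by positivity
  have h2 : 0 ≤ 16 * (S : ℝ) ^ 4 := by positivity
  have h3 : 0 ≤ 128 * (S : ℝ) ^ 4 * tiltMass 2 * Real.exp (2 * (S : ℝ) ^ 4 * tiltMass 4) := by
    positivity
  have hc : 1 ≤ smallConst S := by unfold smallConst; linarith
  have hc' : (S : ℝ) ^ 4 * (tiltMass 1 + tiltMass 2) ≤ smallConst S := by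
    unfold smallConst; linarith
  have hpos : 0 < √(smallConst S) := Real.sqrt_pos.2 (by linarith)
  refine ⟨1 / (2 * √(smallConst S)), by positivity, fun β D h hβ hβ' _ => ?_⟩
  have hsmall : β ^ 2 * smallConst S ≤ 1 / 4 := by
    have h4 : β * √(smallConst S) ≤ 1 / 2 := by
      rw [lt_div_iff₀ (by positivity)] at hβ'
      linarith
    calc β ^ 2 * smallConst S = (β * √(smallConst S)) ^ 2 := by
          rw [mul_pow, Real.sq_sqrt (by linarith)]
      _ ≤ (1 / 2) ^ 2 := by gcongr
      _ = 1 / 4 := by norm_num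
  refine ⟨existsUnique_isFixedPoint D h
    ((mul_le_mul_of_nonneg_left hc' (sq_nonneg β)).trans hsmall), fun p q hpq => ?_⟩
  have hP : (Params.mk S β D h p q).Admissible := ⟨hS, hsmall, hpq⟩
  refine ⟨M3_pos hP, M_pos hP, fun n => ?_⟩
  obtain ⟨B, hB⟩ := exists_mul_transpose_eq_etaCov hP n
  exact ⟨gaussianFamily B, inferInstance, integral_eval_gaussianFamily B,
    fun e f => (covariance_gaussianFamily B e f).trans (hB e f),
    fun m => exists_overlapMonomial_convergence hP hB m⟩
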